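/- Let $x\in\mathbb{R}^n$ and $w\in\mathbb{R}^m$ be arbitrary fixed vectors, and let $f:\mathbb{R}^n\to\mathbb{R}$ be a convex function whose sublevel sets are closed. Let $A\in\mathbb{R}^{m\times n}$ be a random matrix with independent $\mathcal{N}(0,1)$ entries, and let $y=Ax+w$. Put $\mathcal{K}=\{z\in\mathbb{R}^n: f(z)\le f(x)\}$, let $\mathcal{P}_{\mathcal{K}}$ be the Euclidean projection onto $\mathcal{K}$, and consider projected gradient descent started at $z_0=0$, $$z_{\tau+1}=\mathcal{P}_{\mathcal{K}}\bigl(z_\tau+\mu A^{*}(y-Az_\tau)\bigr).$$ Let $\mathcal{C}$ be a cone of descent of $f$ at $x$, that is, a closed cone that contains $\{h\in\mathbb{R}^n: f(x+h)\le f(x)\}$ (the smallest one is the tangent cone). Let $\omega=\mathbb{E}\bigl[\sup_{z\in\mathcal{C},\,\|z\|\le 1}\langle g,z\rangle\bigr]$ with $g\sim\mathcal{N}(0,I_n)$ be its Gaussian width. Let $\phi(t)=\sqrt2\,\Gamma(\frac{t+1}{2})/\Gamma(\frac t2)$ for $t>0$ and $\phi(0)=0$, let $\phi^{-1}$ be the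 inverse of $\phi$ on $[0,\infty)$, and put $b_m=\phi(m)$. For $\eta\ge 0$ let $m_0=\phi^{-1}(\omega+\eta)$, and set the step size to $$\mu=\frac{m}{b_m^2}\cdot\frac{2-\sqrt{2m_0}\,\sqrt[4]{m}\,\bigl(\sqrt m-\sqrt{m_0}\bigr)^{-3/2}}{m_0-2\sqrt{m m_0}+2m}.$$ If $m>4m_0$, then with probability at least $1-3e^{-\eta^2/8}-e^{-\eta^2/2}$ the iterates satisfy, for all $\tau=0,1,2,\dots$ simultaneously, $$\|z_\tau-x\|\le\Bigl(1-\psi\bigl(\tfrac{m_0}{m}\bigr)\Bigr)^{\tau}\|x\|+\frac45\,\frac{\sqrt{2\pi}}{\psi\bigl(\frac{m_0}{m}\bigr)}\,\frac{\sqrt{m_0}}{m}\,\|w\|,$$ where $$\psi(\gamma)=2\,\frac{\bigl(\sqrt2\,(1-\sqrt\gamma)^{3/2}-\sqrt\gamma\bigr)^2}{(\gamma-2\sqrt\gamma+2)^2}.$$ Here $\|\cdot\|$ is the Euclidean norm. -/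

import Mathlib

open MeasureTheory ProbabilityTheory

noncomputable section

namespace PGD

/-- The descent set `{h : f (x + h) ≤ f x}` of `f` at `x`. -/
def descentSet {n : ℕ} (f : EuclideanSpace ℝ (Fin n) → ℝ) (x : EuclideanSpace ℝ (Fin n)) :
    Set (EuclideanSpace ℝ (Fin n)) :=
  {h | f (x + h) ≤ f x}

/-- A cone of descent of `f` at `x`: a closed cone that contains the descent set.
The smallest one is the tangent cone. -/
structure IsDescentCone {n : ℕ} (f : EuclideanSpace ℝ (Fin n) → ℝ)
    (x : EuclideanSpace ℝ (Fin n)) (C : Set (EuclideanSpace ℝ (Fin n))) : Prop where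
  isClosed : IsClosed C
  smul_mem : ∀ v ∈ C, ∀ t : ℝ, 0 ≤ t → t • v ∈ C
  descentSet_subset : descentSet f x ⊆ C

/-- The Gaussian width `E [sup_{z ∈ S} ⟨g, z⟩]`, `g` a standard Gaussian vector. -/
def gaussianWidth {n : ℕ} (S : Set (EuclideanSpace ℝ (Fin n))) : ℝ :=
  ∫ g, sSup ((fun z => inner ℝ g z) '' S) ∂(stdGaussian (EuclideanSpace ℝ (Fin n)))

/-- `φ(t) = √2 Γ((t+1)/2) / Γ(t/2)`, used for `t ≥ 0` only. -/
def phi (t : ℝ) : ℝ := √2 * Real.Gamma ((t + 1) / 2) / Real.Gamma (t / 2)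

/-- The value at `0` agrees with the limit of `φ` at `0` from the right. -/
theorem phi_zero : phi 0 = 0 := by simp [phi, Real.Gamma_zero]

/-- The phase transition function: `φ⁻¹(ω + η)` with `ω` the Gaussian width of the intersection
of `C` with the unit ball, and `φ⁻¹` the inverse of `φ` on `[0, ∞)`. -/
def phaseTransition {n : ℕ} (C : Set (EuclideanSpace ℝ (Fin n))) (η : ℝ) : ℝ :=
  Function.invFunOn phi (Set.Ici 0) (gaussianWidth (C ∩ Metric.closedBall 0 1) + η)

/-- `p` is a Euclidean projection of `v` onto `K`. -/
def IsProj {n : ℕ} (K : Set (EuclideanSpace ℝ (Fin n))) (v p : EuclideanSpace ℝ (Fin n)) : Prop :=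
  p ∈ K ∧ ∀ q ∈ K, ‖v - p‖ ≤ ‖v - q‖

/-- The Euclidean projection of `v` onto `K`. -/
def proj {n : ℕ} (K : Set (EuclideanSpace ℝ (Fin n))) (v : EuclideanSpace ℝ (Fin n)) :
    EuclideanSpace ℝ (Fin n) :=
  Classical.epsilon (IsProj K v)

theorem isProj_proj {n : ℕ} {K : Set (EuclideanSpace ℝ (Fin n))} (hK : IsClosed K)
    (hne : K.Nonempty) (v : EuclideanSpace ℝ (Fin n)) : IsProj K v (proj K v) := by
  obtain ⟨p, hp, hd⟩ := hK.exists_infDist_eq_dist hne v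
  refine Classical.epsilon_spec (p := IsProj K v) ⟨p, hp, fun q hq => ?_⟩
  rw [← dist_eq_norm, ← dist_eq_norm, ← hd]
  exact Metric.infDist_le_dist_of_mem hq

/-- The projected gradient descent iterates `z₀ = 0`,
`z_{τ+1} = P_K (z_τ + μ Aᵀ (y - A z_τ))`. -/
def iterate {m n : ℕ} (K : Set (EuclideanSpace ℝ (Fin n))) (A : Matrix (Fin m) (Fin n) ℝ)
    (y : EuclideanSpace ℝ (Fin m)) (μ : ℝ) : ℕ → EuclideanSpace ℝ (Fin n)
  | 0 => 0
  | τ + 1 => proj K (iterate K A y μ τ +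
      μ • A.transpose.toEuclideanLin (y - A.toEuclideanLin (iterate K A y μ τ)))

/-- The structure dependent step size, with `b_m = φ(m)`. -/
def stepSize (m : ℕ) (m₀ : ℝ) : ℝ :=
  m / phi m ^ 2 *
    ((2 - √(2 * m₀) * (m : ℝ) ^ (1 / 4 : ℝ) * (√m - √m₀) ^ (-(3 / 2) : ℝ)) /
      (m₀ - 2 * √(m * m₀) + 2 * m))

/-- `ψ(γ) = 2 (√2 (1 - √γ)^{1.5} - √γ)² / (γ - 2√γ + 2)²`. -/
def psi (γ : ℝ) : ℝ :=
  2 * ((√2 * (1 - √γ) ^ (3 / 2 : ℝ) - √γ) ^ 2 / (γ - 2 * √γ + 2) ^ 2)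

end PGD

end

/-! Write `h τ = z τ - x`. As `x` lies in the convex set `K`, the obtuse-angle property of
projections gives `‖h (τ+1)‖² ≤ ⟪h τ + μ Aᵀ(w - A h τ), h (τ+1)⟫`. Dividing by `‖h (τ+1)‖` leaves a
noise term `μ sup ⟪Aᵀ w, u⟫` plus `ρ ‖h τ‖`, where `ρ` bounds `⟪u, v⟫ - μ ⟪A u, A v⟫` for the unit
directions `u`, `v` of the two errors.

By polarization this form depends only on the norms of `u ± v` and `A (u ± v)`. From the second step
on, both errors lie in the convex descent set, so `u + v` stays in the cone although the cone itself
need not be convex. Uniform bounds on `‖A (u + v)‖` from below and `‖A (u - v)‖` from above then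
turn the form into a concave quadratic in `‖u - v‖`, whose maximum for the prescribed step size is
exactly `1 - ψ` (`StepRelation.contraction_le`, `GoodMatrix.inner_sub_le`). The first error is `-x`,
which need not lie in the cone. Its direction is a fixed vector, so translating by it costs no
Gaussian width, and a cruder estimate still gives the same rate (`StepRelation.first_step_le`).

The uniform bounds are the five clauses of `GoodMatrix`. In mean, the supremum of `±(‖A z‖ - b ‖z‖)`
is controlled by Gordon's comparison with `±‖z‖ (‖h‖ - b) + ⟪g, z⟫`
(`integral_smoothMax_gordon_le`), with `b = E ‖h‖` and `Var ‖h‖ ≤ 1`. Around the mean it is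
controlled by Gaussian concentration (`hasSubgaussianMGF_of_grad`). Both rest on one interpolation
inequality, `integral_comp_le_of_sum_lineDeriv_le`, proved by rotating one Gaussian vector into an
independent one and applying Stein's identity. They are applied to a smoothed maximum over finitely
many points; inner regularity passes to arbitrary index sets.

The additive losses (`1/2` in the means, `φ(m)` versus `√m`) are absorbed by taking deviation levels
slightly below `η`. This is affordable because for `η < 2.95` the claimed probability is not
positive, and otherwise `m ≥ 35`. -/

open scoped NNReal

noncomputable section

namespace PGD

/-! ### Gaussian integrals of functions of exponential growth, and Stein's identity. -/

section

/-- The law of a family of independent standard Gaussian variables indexed by `ι`. -/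
abbrev stdPi (ι : Type*) [Fintype ι] : Measure (ι → ℝ) :=
  Measure.pi fun _ : ι => gaussianReal 0 1

/-- The Lebesgue density of `stdPi`. -/
def stdDensity {ι : Type*} [Fintype ι] (x : ι → ℝ) : ℝ := ∏ i, gaussianPDFReal 0 1 (x i)

variable {ι κ : Type*} [Fintype ι] [Fintype κ]

theorem stdDensity_nonneg (x : ι → ℝ) : 0 ≤ stdDensity x :=
  Finset.prod_nonneg fun _ _ => gaussianPDFReal_nonneg _ _ _

theorem measurable_stdDensity : Measurable (stdDensity (ι := ι)) :=
  Finset.measurable_prod _ fun i _ =>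
    (measurable_gaussianPDFReal 0 1).comp (measurable_pi_apply i)

theorem stdPi_eq_withDensity :
    stdPi ι = (volume : Measure (ι → ℝ)).withDensity fun x => ENNReal.ofReal (stdDensity x) := by
  refine Measure.pi_eq fun s hs => ?_
  rw [withDensity_apply _ (MeasurableSet.univ_pi hs), volume_pi, Measure.restrict_pi_pi,
    ← ofReal_integral_eq_lintegral_ofReal]
  · simp only [stdDensity]
    rw [integral_fintype_prod_eq_prod (f := fun _ : ι => gaussianPDFReal 0 1),
      ENNReal.ofReal_prod_of_nonneg]
    · refine Finset.prod_congr rfl fun i _ => ?_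
      rw [gaussianReal_apply_eq_integral _ one_ne_zero]
    · exact fun i _ => integral_nonneg fun x => gaussianPDFReal_nonneg _ _ _
  · exact Integrable.fintype_prod (f := fun _ : ι => gaussianPDFReal 0 1)
      fun i => (integrable_gaussianPDFReal 0 1).restrict
  · exact Filter.Eventually.of_forall stdDensity_nonneg

theorem integral_stdPi (f : (ι → ℝ) → ℝ) :
    ∫ x, f x ∂(stdPi ι) = ∫ x, f x * stdDensity x := by
  rw [stdPi_eq_withDensity, integral_withDensity_eq_integral_toReal_smul]
  · refine integral_congr_ae (Filter.Eventually.of_forall fun x => ?_)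
    simp [ENNReal.toReal_ofReal (stdDensity_nonneg x), mul_comm]
  · exact measurable_stdDensity.ennreal_ofReal
  · simp

theorem integrable_stdPi_iff {f : (ι → ℝ) → ℝ} :
    Integrable f (stdPi ι) ↔ Integrable fun x => f x * stdDensity x := by
  rw [stdPi_eq_withDensity, integrable_withDensity_iff measurable_stdDensity.ennreal_ofReal]
  · simp only [ENNReal.toReal_ofReal (stdDensity_nonneg _)]
  · simp

/-- Functions of at most exponential growth. -/
def ExpBounded (G : (ι → ℝ) → ℝ) : Prop :=
  ∃ C c : ℝ, 0 ≤ C ∧ 0 ≤ c ∧ ∀ x, |G x| ≤ C * Real.exp (c * ‖x‖)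

namespace ExpBounded

variable {F G : (ι → ℝ) → ℝ}

theorem of_abs_le (hG : ExpBounded G) (h : ∀ x, |F x| ≤ |G x|) : ExpBounded F := by
  obtain ⟨C, c, hC, hc, hb⟩ := hG
  exact ⟨C, c, hC, hc, fun x => (h x).trans (hb x)⟩

theorem const (r : ℝ) : ExpBounded fun _ : ι → ℝ => r :=
  ⟨|r|, 0, abs_nonneg _, le_rfl, fun x => by simp⟩

theorem of_bounded {K : ℝ} (h : ∀ x, |F x| ≤ K) : ExpBounded F :=
  (const K).of_abs_le fun x => (h x).trans (le_abs_self K)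

theorem add (hF : ExpBounded F) (hG : ExpBounded G) : ExpBounded fun x => F x + G x := by
  obtain ⟨C, c, hC, hc, hb⟩ := hF
  obtain ⟨C', c', hC', hc', hb'⟩ := hG
  refine ⟨C + C', c + c', by positivity, by positivity, fun x => ?_⟩
  calc |F x + G x| ≤ |F x| + |G x| := abs_add_le _ _
    _ ≤ C * Real.exp (c * ‖x‖) + C' * Real.exp (c' * ‖x‖) := add_le_add (hb x) (hb' x)
    _ ≤ C * Real.exp ((c + c') * ‖x‖) + C' * Real.exp ((c + c') * ‖x‖) := by
        gcongr <;> linarith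
    _ = _ := by ring

theorem mul (hF : ExpBounded F) (hG : ExpBounded G) : ExpBounded fun x => F x * G x := by
  obtain ⟨C, c, hC, hc, hb⟩ := hF
  obtain ⟨C', c', hC', hc', hb'⟩ := hG
  refine ⟨C * C', c + c', by positivity, by positivity, fun x => ?_⟩
  rw [abs_mul, add_mul, Real.exp_add]
  calc |F x| * |G x| ≤ (C * Real.exp (c * ‖x‖)) * (C' * Real.exp (c' * ‖x‖)) :=
        mul_le_mul (hb x) (hb' x) (abs_nonneg _) (by positivity)
    _ = _ := by ring

theorem const_mul (r : ℝ) (hG : ExpBounded G) : ExpBounded fun x => r * G x := (const r).mul hG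

theorem sub (hF : ExpBounded F) (hG : ExpBounded G) : ExpBounded fun x => F x - G x := by
  refine (hF.add (hG.const_mul (-1))).of_abs_le fun x => le_of_eq ?_
  rw [neg_one_mul, sub_eq_add_neg]

theorem sum {α : Type*} (s : Finset α) {H : α → (ι → ℝ) → ℝ} (h : ∀ a ∈ s, ExpBounded (H a)) :
    ExpBounded fun x => ∑ a ∈ s, H a x := by
  classical
  induction s using Finset.induction_on with
  | empty => simpa using const (ι := ι) 0
  | insert a s ha ih =>
    simp only [Finset.sum_insert ha]
    exact (h a (Finset.mem_insert_self _ _)).add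
      (ih fun b hb => h b (Finset.mem_insert_of_mem hb))

theorem of_abs_le_affine {a b : ℝ} (ha : 0 ≤ a) (hb : 0 ≤ b) (h : ∀ x, |F x| ≤ a + b * ‖x‖) :
    ExpBounded F := by
  refine ⟨a + b, 1, by positivity, zero_le_one, fun x => (h x).trans ?_⟩
  have h1 : ‖x‖ + 1 ≤ Real.exp ‖x‖ := Real.add_one_le_exp _
  have h2 : 0 ≤ ‖x‖ := norm_nonneg x
  rw [one_mul, add_mul]
  gcongr
  · exact le_mul_of_one_le_right ha (by linarith)
  · linarith

theorem exp_of_abs_le_affine {a b : ℝ} (hb : 0 ≤ b) (h : ∀ x, |F x| ≤ a + b * ‖x‖) :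
    ExpBounded fun x => Real.exp (F x) := by
  refine ⟨Real.exp a, b, (Real.exp_pos _).le, hb, fun x => ?_⟩
  rw [abs_of_pos (Real.exp_pos _), ← Real.exp_add]
  exact Real.exp_le_exp.2 ((le_abs_self _).trans (h x))

theorem coord (i : ι) : ExpBounded fun x : ι → ℝ => x i :=
  of_abs_le_affine le_rfl zero_le_one fun x => by
    simpa using norm_le_pi_norm x i

theorem comp_clm (hG : ExpBounded G) (L : (κ → ℝ) →L[ℝ] (ι → ℝ)) :
    ExpBounded fun x => G (L x) := by
  obtain ⟨C, c, hC, hc, hb⟩ := hG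
  refine ⟨C, c * ‖L‖, hC, by positivity, fun x => (hb _).trans ?_⟩
  rw [mul_assoc]
  gcongr
  exact L.le_opNorm x

end ExpBounded

/-- The sup norm is at most `∑ |x i|`, so the integrand is dominated by a product of one-dimensional
integrable functions. -/
theorem integrable_exp_norm (c : ℝ) (hc : 0 ≤ c) :
    Integrable (fun x : ι → ℝ => Real.exp (c * ‖x‖)) (stdPi ι) := by
  have h1 : Integrable (fun t : ℝ => Real.exp (c * |t|)) (gaussianReal 0 1) := by
    refine Integrable.mono' ((integrable_exp_mul_gaussianReal (μ := 0) (v := 1) c).add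
      (integrable_exp_mul_gaussianReal (μ := 0) (v := 1) (-c))) (by fun_prop)
      (Filter.Eventually.of_forall fun t => ?_)
    rw [Real.norm_of_nonneg (Real.exp_pos _).le]
    simp only [Pi.add_apply]
    rcases abs_cases t with ⟨h, _⟩ | ⟨h, _⟩ <;> rw [h]
    · linarith [Real.exp_pos (-c * t)]
    · rw [show c * -t = -c * t by ring]
      linarith [Real.exp_pos (c * t)]
  refine Integrable.mono' (Integrable.fintype_prod (f := fun _ : ι => fun t => Real.exp (c * |t|))
    fun i => h1) (by fun_prop) (Filter.Eventually.of_forall fun x => ?_)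
  rw [Real.norm_of_nonneg (Real.exp_pos _).le, ← Real.exp_sum, ← Finset.mul_sum]
  refine Real.exp_le_exp.2 (mul_le_mul_of_nonneg_left ?_ hc)
  refine (pi_norm_le_iff_of_nonneg (Finset.sum_nonneg fun i _ => abs_nonneg _)).2 fun i => ?_
  exact Finset.single_le_sum (f := fun i => |x i|) (fun i _ => abs_nonneg _) (Finset.mem_univ i)

theorem ExpBounded.integrable {G : (ι → ℝ) → ℝ} (hG : ExpBounded G)
    (hm : AEStronglyMeasurable G (stdPi ι)) : Integrable G (stdPi ι) := by
  obtain ⟨C, c, hC, hc, hb⟩ := hG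
  exact Integrable.mono' ((integrable_exp_norm c hc).const_mul C) hm
    (Filter.Eventually.of_forall hb)

theorem ExpBounded.integrable_of_continuous {G : (ι → ℝ) → ℝ} (hG : ExpBounded G)
    (hm : Continuous G) : Integrable G (stdPi ι) :=
  hG.integrable hm.aestronglyMeasurable

theorem stdDensity_eq (x : ι → ℝ) :
    stdDensity x = (√(2 * Real.pi))⁻¹ ^ Fintype.card ι * Real.exp (-(∑ i, x i ^ 2) / 2) := by
  simp only [stdDensity, gaussianPDFReal]
  rw [Finset.prod_mul_distrib, Finset.prod_const, ← Real.exp_sum]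
  simp [Finset.sum_div, neg_div, Finset.card_univ]

theorem hasLineDerivAt_stdDensity (x a : ι → ℝ) :
    HasLineDerivAt ℝ stdDensity (-(∑ i, a i * x i) * stdDensity x) x a := by
  unfold HasLineDerivAt
  have h1 : HasDerivAt (fun t : ℝ => ∑ i, (x i + t * a i) ^ 2)
      (∑ i, 2 * (x i + 0 * a i) * a i) 0 := by
    refine HasDerivAt.fun_sum fun i _ => ?_
    refine (((hasDerivAt_mul_const (a i)).const_add (x i)).fun_pow 2).congr_deriv ?_
    simp
  have h2 := ((h1.fun_neg.div_const 2).exp.const_mul ((√(2 * Real.pi))⁻¹ ^ Fintype.card ι))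
  simp only [stdDensity_eq, Pi.add_apply, Pi.smul_apply, smul_eq_mul]
  refine h2.congr_deriv ?_
  have h3 : ∑ i, 2 * (x i + 0 * a i) * a i = 2 * ∑ i, a i * x i := by
    rw [Finset.mul_sum]
    exact Finset.sum_congr rfl fun i _ => by ring
  rw [h3]
  simp only [zero_mul, add_zero]
  ring

/-- **Stein's identity** (Gaussian integration by parts). -/
theorem integral_mul_eq_integral_lineDeriv {G G' : (ι → ℝ) → ℝ} {a : ι → ℝ}
    (hG : ExpBounded G) (hGm : AEStronglyMeasurable G (stdPi ι))
    (hG' : ExpBounded G') (hGm' : AEStronglyMeasurable G' (stdPi ι))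
    (h : ∀ x, HasLineDerivAt ℝ G (G' x) x a) :
    ∫ x, G x * ∑ i, a i * x i ∂(stdPi ι) = ∫ x, G' x ∂(stdPi ι) := by
  have hlin : ExpBounded fun x : ι → ℝ => ∑ i, a i * x i :=
    ExpBounded.sum _ fun i _ => (ExpBounded.coord i).const_mul _
  have h1 := integrable_stdPi_iff.1 (hG.integrable hGm)
  have h2 := integrable_stdPi_iff.1 (hG'.integrable hGm')
  have h3 := integrable_stdPi_iff.1 ((hG.mul hlin).integrable (hGm.mul
    (by fun_prop : Continuous fun x : ι → ℝ => ∑ i, a i * x i).aestronglyMeasurable))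
  -- Integration by parts against Lebesgue measure: differentiating the density along `a` produces
  -- the factor `-∑ a i * x i`.
  have key := integral_bilinear_hasLineDerivAt_right_eq_neg_left_of_integrable
    (μ := (volume : Measure (ι → ℝ))) (f := G) (f' := G') (g := stdDensity)
    (g' := fun x => -(∑ i, a i * x i) * stdDensity x) (v := a) (B := ContinuousLinearMap.mul ℝ ℝ)
    (by simpa using h2) (by
      convert h3.neg using 1
      ext x
      simp
      ring) (by simpa using h1) (fun x _ => h x) (fun x _ => hasLineDerivAt_stdDensity x a)
  rw [integral_stdPi, integral_stdPi]
  simp only [ContinuousLinearMap.mul_apply'] at key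
  rw [← neg_inj, ← key, ← integral_neg]
  refine integral_congr_ae (Filter.Eventually.of_forall fun x => ?_)
  simp only
  ring

end

/-! ### Gaussian comparison along a rotation. -/

section

variable {ι κ : Type*} [Fintype ι] [Fintype κ]

/-- The rotation path `θ ↦ sin θ • P + cos θ • Q` between two linear maps. -/
def rotationPath (P Q : Matrix ι κ ℝ) (θ : ℝ) : (κ → ℝ) →L[ℝ] (ι → ℝ) :=
  Real.sin θ • P.mulVecLin.toContinuousLinearMap + Real.cos θ • Q.mulVecLin.toContinuousLinearMap

theorem rotationPath_apply (P Q : Matrix ι κ ℝ) (θ : ℝ) (x : κ → ℝ) :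
    rotationPath P Q θ x = Real.sin θ • P.mulVec x + Real.cos θ • Q.mulVec x := rfl

/-- The derivative in `θ` of `rotationPath`. -/
def rotationPathDeriv (P Q : Matrix ι κ ℝ) (θ : ℝ) : (κ → ℝ) →L[ℝ] (ι → ℝ) :=
  Real.cos θ • P.mulVecLin.toContinuousLinearMap - Real.sin θ • Q.mulVecLin.toContinuousLinearMap

theorem rotationPathDeriv_apply (P Q : Matrix ι κ ℝ) (θ : ℝ) (x : κ → ℝ) :
    rotationPathDeriv P Q θ x = Real.cos θ • P.mulVec x - Real.sin θ • Q.mulVec x := rfl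

/-- Uniformity in `θ` supplies the dominating function when differentiating under the integral sign.
-/
theorem exists_rotationPath_bound (P Q : Matrix ι κ ℝ) : ∃ K : ℝ, 0 ≤ K ∧ ∀ θ x,
    ‖rotationPath P Q θ x‖ ≤ K * ‖x‖ ∧ ‖rotationPathDeriv P Q θ x‖ ≤ K * ‖x‖ := by
  set p := P.mulVecLin.toContinuousLinearMap
  set q := Q.mulVecLin.toContinuousLinearMap
  have h : ∀ a b : ℝ, |a| ≤ 1 → |b| ≤ 1 → ∀ x, ‖a • p x‖ + ‖b • q x‖ ≤ (‖p‖ + ‖q‖) * ‖x‖ := by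
    intro a b ha hb x
    rw [norm_smul, norm_smul, Real.norm_eq_abs, Real.norm_eq_abs, add_mul]
    exact add_le_add ((mul_le_of_le_one_left (norm_nonneg _) ha).trans (p.le_opNorm x))
      ((mul_le_of_le_one_left (norm_nonneg _) hb).trans (q.le_opNorm x))
  refine ⟨‖p‖ + ‖q‖, by positivity, fun θ x => ⟨?_, ?_⟩⟩
  · exact (norm_add_le _ _).trans (h _ _ (Real.abs_sin_le_one θ) (Real.abs_cos_le_one θ) x)
  · exact (norm_sub_le _ _).trans (h _ _ (Real.abs_cos_le_one θ) (Real.abs_sin_le_one θ) x)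

theorem hasDerivAt_rotationPath (P Q : Matrix ι κ ℝ) (θ : ℝ) (x : κ → ℝ) :
    HasDerivAt (fun t => rotationPath P Q t x) (rotationPathDeriv P Q θ x) θ := by
  simp only [rotationPath_apply, rotationPathDeriv_apply]
  refine (((Real.hasDerivAt_sin θ).smul_const (P.mulVec x)).fun_add
    ((Real.hasDerivAt_cos θ).smul_const (Q.mulVec x))).congr_deriv ?_
  rw [neg_smul, sub_eq_add_neg]

variable {P Q : Matrix ι κ ℝ} {f : (ι → ℝ) → ℝ} {g D : ι → (ι → ℝ) → ℝ}

theorem hasDerivAt_integral_rotationPath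
    (hfb : ExpBounded f) (hgb : ∀ i, ExpBounded (g i)) (hgc : ∀ i, Continuous (g i))
    (hf : ∀ y, HasFDerivAt f (∑ i, g i y • (ContinuousLinearMap.proj i : (ι → ℝ) →L[ℝ] ℝ)) y)
    (θ : ℝ) :
    HasDerivAt (fun t => ∫ x, f (rotationPath P Q t x) ∂(stdPi κ))
      (∫ x, ∑ i, g i (rotationPath P Q θ x) * rotationPathDeriv P Q θ x i ∂(stdPi κ)) θ := by
  obtain ⟨K, hK, hKb⟩ := exists_rotationPath_bound P Q
  have hfc : Continuous f := continuous_iff_continuousAt.2 fun y => (hf y).continuousAt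
  choose C c hC hc hb using hgb
  refine (hasDerivAt_integral_of_dominated_loc_of_deriv_le (s := Set.univ)
    (F := fun t x => f (rotationPath P Q t x))
    (F' := fun t x => ∑ i, g i (rotationPath P Q t x) * rotationPathDeriv P Q t x i)
    (bound := fun x => ∑ i, C i * Real.exp (c i * (K * ‖x‖)) * (K * ‖x‖))
    Filter.univ_mem ?_ ?_ ?_ ?_ ?_ ?_).2
  · exact Filter.Eventually.of_forall fun t =>
      (hfc.comp (rotationPath P Q t).continuous).aestronglyMeasurable
  · exact (hfb.comp_clm _).integrable_of_continuous (hfc.comp (rotationPath P Q θ).continuous)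
  · refine (continuous_finsetSum _ fun i _ => ?_).aestronglyMeasurable
    exact ((hgc i).comp (rotationPath P Q θ).continuous).mul
      ((continuous_apply i).comp (rotationPathDeriv P Q θ).continuous)
  · refine Filter.Eventually.of_forall fun x t _ => ?_
    rw [Real.norm_eq_abs]
    refine (Finset.abs_sum_le_sum_abs _ _).trans (Finset.sum_le_sum fun i _ => ?_)
    rw [abs_mul]
    refine mul_le_mul ((hb i _).trans ?_) ?_ (abs_nonneg _)
      (mul_nonneg (hC i) (Real.exp_pos _).le)
    · have := (hKb t x).1
      have := hC i
      have := hc i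
      gcongr
    · exact (norm_le_pi_norm (rotationPathDeriv P Q t x) i).trans (hKb t x).2
  · refine ExpBounded.integrable_of_continuous (ExpBounded.sum _ fun i _ => ?_) (by fun_prop)
    refine ExpBounded.mul ((ExpBounded.const _).mul ?_) ?_
    · exact ExpBounded.exp_of_abs_le_affine (a := 0) (mul_nonneg (hc i) hK) fun x => by
        rw [abs_of_nonneg (by have := hc i; positivity)]
        linarith
    · exact ExpBounded.of_abs_le_affine (a := 0) le_rfl hK fun x => by
        rw [abs_of_nonneg (by positivity)]
        linarith
  · refine Filter.Eventually.of_forall fun x t _ => ?_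
    refine ((hf _).comp_hasDerivAt t (hasDerivAt_rotationPath P Q t x)).congr_deriv ?_
    simp

/-- This is the covariance of the rotated vector with coordinate `i` of its velocity. Independence
(`P Qᵀ = 0`) kills the mixed terms, and the pure terms come with opposite signs. -/
theorem rotationPath_rotationPathDeriv_row (hPQ : P * Q.transpose = 0) (θ : ℝ) (i : ι) :
    rotationPath P Q θ (fun j => Real.cos θ * P i j - Real.sin θ * Q i j) =
      (Real.sin θ * Real.cos θ) • (P * P.transpose - Q * Q.transpose) i := by
  have h1 : ∀ k, ∑ j, P k j * Q i j = 0 := fun k => by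
    simpa [Matrix.mul_apply] using congrFun (congrFun hPQ k) i
  have h2 : ∀ k, ∑ j, Q k j * P i j = 0 := fun k => by
    have := congrFun (congrFun hPQ i) k
    simp only [Matrix.mul_apply, Matrix.transpose_apply, Matrix.zero_apply] at this
    rw [← this]
    exact Finset.sum_congr rfl fun j _ => mul_comm _ _
  ext k
  simp only [rotationPath_apply, Pi.add_apply, Pi.smul_apply, smul_eq_mul, Matrix.mulVec,
    dotProduct, Matrix.sub_apply, Matrix.mul_apply, Matrix.transpose_apply, mul_sub,
    Finset.sum_sub_distrib]
  have e1 : ∀ (A B : Matrix ι κ ℝ) (c : ℝ),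
      ∑ j, A k j * (c * B i j) = c * ∑ j, A k j * B i j := fun A B c => by
    rw [Finset.mul_sum]
    exact Finset.sum_congr rfl fun j _ => by ring
  rw [e1, e1, e1, e1, h1, h2]
  have e2 : ∀ A : Matrix ι κ ℝ, ∑ j, A i j * A k j = ∑ j, A k j * A i j := fun A =>
    Finset.sum_congr rfl fun j _ => mul_comm _ _
  rw [e2 P, e2 Q]
  ring

/-- **Gaussian comparison.** If `X = P ξ` and `Y = Q ξ` are independent centred Gaussian vectors
and `f` satisfies `∑ᵢⱼ (Cov X - Cov Y)ᵢⱼ ∂ᵢⱼ f ≤ 2 K f`, then `E f(X) ≤ e^K E f(Y)`. -/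
theorem integral_comp_le_of_sum_lineDeriv_le (hPQ : P * Q.transpose = 0)
    (hfb : ExpBounded f) (hgb : ∀ i, ExpBounded (g i)) (hgc : ∀ i, Continuous (g i))
    (hDb : ∀ i, ExpBounded (D i)) (hDc : ∀ i, Continuous (D i))
    (hf : ∀ y, HasFDerivAt f (∑ i, g i y • (ContinuousLinearMap.proj i : (ι → ℝ) →L[ℝ] ℝ)) y)
    (hg : ∀ i y, HasLineDerivAt ℝ (g i) (D i y) y ((P * P.transpose - Q * Q.transpose) i))
    {K : ℝ} (hD : ∀ y, ∑ i, D i y ≤ 2 * K * f y) :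
    ∫ x, f (P.mulVec x) ∂(stdPi κ) ≤ Real.exp K * ∫ x, f (Q.mulVec x) ∂(stdPi κ) := by
  have hfc : Continuous f := continuous_iff_continuousAt.2 fun y => (hf y).continuousAt
  set Ψ : ℝ → ℝ := fun t => ∫ x, f (rotationPath P Q t x) ∂(stdPi κ) with hΨ
  have hderiv : ∀ θ, HasDerivAt Ψ
      (Real.sin θ * Real.cos θ * ∫ x, ∑ i, D i (rotationPath P Q θ x) ∂(stdPi κ)) θ := by
    intro θ
    refine (hasDerivAt_integral_rotationPath hfb hgb hgc hf θ).congr_deriv ?_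
    have hcont := (rotationPath P Q θ).continuous
    rw [integral_finsetSum, integral_finsetSum, Finset.mul_sum]
    · refine Finset.sum_congr rfl fun i _ => ?_
      rw [← integral_const_mul]
      -- Coordinate `i` of the velocity is a linear form in the Gaussian vector, so Stein's identity
      -- trades it for a derivative of `g i` along its covariance with the path.
      rw [← integral_mul_eq_integral_lineDeriv (G := fun x => g i (rotationPath P Q θ x))
        (G' := fun x => Real.sin θ * Real.cos θ * D i (rotationPath P Q θ x))
        (a := fun j => Real.cos θ * P i j - Real.sin θ * Q i j)]
      · refine integral_congr_ae (Filter.Eventually.of_forall fun x => ?_)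
        simp only [rotationPathDeriv_apply, Pi.sub_apply, Pi.smul_apply, smul_eq_mul,
          Matrix.mulVec, dotProduct, Finset.mul_sum, sub_mul, Finset.sum_sub_distrib, mul_assoc]
      · exact (hgb i).comp_clm _
      · exact ((hgc i).comp hcont).aestronglyMeasurable
      · exact ((hDb i).comp_clm _).const_mul _
      · exact (((hDc i).comp hcont).const_mul _).aestronglyMeasurable
      · intro x
        have h := (hg i (rotationPath P Q θ x)).smul (Real.sin θ * Real.cos θ)
        rw [← rotationPath_rotationPathDeriv_row hPQ] at h
        unfold HasLineDerivAt at h ⊢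
        simpa only [map_add, map_smul, smul_eq_mul] using h
    · exact fun i _ => ((hDb i).comp_clm _).integrable_of_continuous ((hDc i).comp hcont)
    · refine fun i _ => ExpBounded.integrable_of_continuous (((hgb i).comp_clm _).mul
        ((ExpBounded.coord i).comp_clm _)) (((hgc i).comp hcont).mul
          ((continuous_apply i).comp (rotationPathDeriv P Q θ).continuous))
  have hle : ∀ θ, ∫ x, ∑ i, D i (rotationPath P Q θ x) ∂(stdPi κ) ≤ 2 * K * Ψ θ := by
    intro θ
    have hcont := (rotationPath P Q θ).continuous
    rw [hΨ, ← integral_const_mul]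
    refine integral_mono ?_ ?_ fun x => hD _
    · exact (ExpBounded.sum _ fun i _ => (hDb i).comp_clm _).integrable_of_continuous
        (continuous_finsetSum _ fun i _ => (hDc i).comp hcont)
    · exact ((hfb.comp_clm _).const_mul _).integrable_of_continuous ((hfc.comp hcont).const_mul _)
  -- Grönwall's integrating factor: the derivative of `K sin²` is `2 K sin cos`, which matches the
  -- bound on the derivative of `Ψ`.
  have hh : ∀ θ, HasDerivAt (fun t => Real.exp (-K * Real.sin t ^ 2) * Ψ t)
      (Real.exp (-K * Real.sin θ ^ 2) * (Real.sin θ * Real.cos θ) *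
        (∫ x, ∑ i, D i (rotationPath P Q θ x) ∂(stdPi κ) - 2 * K * Ψ θ)) θ := by
    intro θ
    refine (((((Real.hasDerivAt_sin θ).fun_pow 2).const_mul (-K)).exp).fun_mul
      (hderiv θ)).congr_deriv ?_
    simp
    ring
  have hanti : AntitoneOn (fun t => Real.exp (-K * Real.sin t ^ 2) * Ψ t)
      (Set.Icc 0 (Real.pi / 2)) := by
    refine antitoneOn_of_deriv_nonpos (convex_Icc _ _)
      (fun t _ => (hh t).continuousAt.continuousWithinAt)
      (fun t _ => (hh t).differentiableAt.differentiableWithinAt) fun t ht => ?_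
    rw [interior_Icc] at ht
    rw [(hh t).deriv]
    refine mul_nonpos_of_nonneg_of_nonpos (mul_nonneg (Real.exp_pos _).le (mul_nonneg ?_ ?_))
      (sub_nonpos.2 (hle t))
    · exact Real.sin_nonneg_of_nonneg_of_le_pi ht.1.le (by linarith [ht.2, Real.pi_pos])
    · exact Real.cos_nonneg_of_neg_pi_div_two_le_of_le (by linarith [ht.1, Real.pi_pos]) ht.2.le
  have h0 := hanti (Set.left_mem_Icc.2 (by positivity)) (Set.right_mem_Icc.2 (by positivity))
    (by positivity : (0 : ℝ) ≤ Real.pi / 2)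
  simp only [hΨ, rotationPath_apply, Real.sin_pi_div_two, Real.cos_pi_div_two, Real.sin_zero,
    Real.cos_zero, one_smul, zero_smul, add_zero, zero_add, one_pow, mul_one, ne_eq,
    OfNat.ofNat_ne_zero, not_false_eq_true, zero_pow, mul_zero, Real.exp_zero, one_mul] at h0
  rw [Real.exp_neg] at h0
  rwa [inv_mul_le_iff₀ (Real.exp_pos _)] at h0

end

/-! ### Gaussian concentration by a replica argument. -/

section

variable {ι κ : Type*} [Fintype ι] [Fintype κ]

/-- The linear form `w ↦ ∑ i, v i * w i`. -/
abbrev pairing (v : ι → ℝ) : (ι → ℝ) →L[ℝ] ℝ :=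
  ∑ i, v i • (ContinuousLinearMap.proj i : (ι → ℝ) →L[ℝ] ℝ)

theorem pairing_apply (v w : ι → ℝ) : pairing v w = ∑ i, v i * w i := by simp

/-- The coordinates with indices `e j` of a standard Gaussian vector are standard Gaussian. -/
theorem measurePreserving_comp_stdPi {e : κ → ι} (he : Function.Injective e) :
    MeasurePreserving (fun x : ι → ℝ => fun j => x (e j)) (stdPi ι) (stdPi κ) := by
  refine ⟨by fun_prop, ?_⟩
  have h1 : iIndepFun (fun (i : ι) (x : ι → ℝ) => x i) (stdPi ι) :=
    iIndepFun_pi (X := fun _ t => t) fun i => aemeasurable_id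
  have h2 := (iIndepFun_iff_map_fun_eq_pi_map 
    (fun j => (measurable_pi_apply (e j)).aemeasurable)).1 (h1.precomp he)
  rw [h2]
  congr 1
  funext j
  exact (measurePreserving_eval (fun _ : ι => gaussianReal 0 1) (e j)).map_eq

theorem integral_comp_stdPi {e : κ → ι} (he : Function.Injective e) {G : (κ → ℝ) → ℝ}
    (hG : Continuous G) :
    ∫ x, G (fun j => x (e j)) ∂(stdPi ι) = ∫ y, G y ∂(stdPi κ) := by
  rw [← (measurePreserving_comp_stdPi he).map_eq, integral_map
    (by fun_prop : Measurable fun x : ι → ℝ => fun j => x (e j)).aemeasurable hG.aestronglyMeasurable]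

theorem integral_mul_stdPi_sum {ι' : Type*} [Fintype ι'] (G : (ι → ℝ) → ℝ) (H : (ι' → ℝ) → ℝ) :
    ∫ x, G (fun i => x (.inl i)) * H (fun i => x (.inr i)) ∂(stdPi (ι ⊕ ι')) =
      (∫ x, G x ∂(stdPi ι)) * ∫ x, H x ∂(stdPi ι') := by
  have h := (measurePreserving_sumPiEquivProdPi
    (fun _ : ι ⊕ ι' => gaussianReal 0 1)).integral_comp
      (MeasurableEquiv.measurableEmbedding _) (fun p : (ι → ℝ) × (ι' → ℝ) => G p.1 * H p.2)
  rw [integral_prod_mul] at h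
  exact h

/-- The matrix of the map `x ↦ (x (p a))ₐ`. -/
def selectMatrix {α β : Type*} [DecidableEq β] (p : α → β) : Matrix α β ℝ :=
  Matrix.of fun a b => if p a = b then 1 else 0

theorem selectMatrix_mulVec {α β : Type*} [DecidableEq β] [Fintype β] (p : α → β) (x : β → ℝ) :
    (selectMatrix p).mulVec x = fun a => x (p a) := by
  ext a
  simp [selectMatrix, Matrix.mulVec, dotProduct]

theorem selectMatrix_mul_transpose {α β : Type*} [DecidableEq β] [Fintype β] (p q : α → β)
    (a b : α) : (selectMatrix p * (selectMatrix q).transpose) a b = if p a = q b then 1 else 0 := by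
  simp [selectMatrix, Matrix.mul_apply, eq_comm]

section Concentration

variable {F : (ι → ℝ) → ℝ} {G : ι → (ι → ℝ) → ℝ} {R : ℝ≥0}

theorem norm_pairing_le (v : ι → ℝ) : ‖pairing v‖ ≤ ∑ i, |v i| := by
  refine ContinuousLinearMap.opNorm_le_bound _ (Finset.sum_nonneg fun i _ => abs_nonneg _)
    fun w => ?_
  rw [pairing_apply, Real.norm_eq_abs, Finset.sum_mul]
  refine (Finset.abs_sum_le_sum_abs _ _).trans (Finset.sum_le_sum fun i _ => ?_)
  rw [abs_mul]
  exact mul_le_mul_of_nonneg_left (norm_le_pi_norm w i) (abs_nonneg _)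

theorem abs_le_of_sum_sq_le {v : ι → ℝ} (h : ∑ i, v i ^ 2 ≤ (R : ℝ) ^ 2) (i : ι) : |v i| ≤ R :=
  abs_le_of_sq_le_sq ((Finset.single_le_sum (f := fun i => v i ^ 2)
    (fun i _ => sq_nonneg _) (Finset.mem_univ i)).trans h) R.2

theorem abs_le_affine_of_grad (hF : ∀ y, HasFDerivAt F (pairing fun i => G i y) y)
    (hG : ∀ y, ∑ i, G i y ^ 2 ≤ (R : ℝ) ^ 2) (x : ι → ℝ) :
    |F x| ≤ |F 0| + (Fintype.card ι * R) * ‖x‖ := by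
  have h := Convex.norm_image_sub_le_of_norm_hasFDerivWithin_le (s := Set.univ)
    (C := Fintype.card ι * R) (fun y _ => (hF y).hasFDerivWithinAt)
    (fun y _ => (norm_pairing_le _).trans <| (Finset.sum_le_sum fun i _ =>
      abs_le_of_sum_sq_le (hG y) i).trans (by simp)) convex_univ (Set.mem_univ 0) (Set.mem_univ x)
  rw [sub_zero, Real.norm_eq_abs] at h
  linarith [abs_sub_abs_le_abs_sub (F x) (F 0)]

theorem expBounded_exp_mul_of_grad (hF : ∀ y, HasFDerivAt F (pairing fun i => G i y) y)
    (hG : ∀ y, ∑ i, G i y ^ 2 ≤ (R : ℝ) ^ 2) (t : ℝ) :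
    ExpBounded fun x => Real.exp (t * F x) := by
  refine ExpBounded.exp_of_abs_le_affine (a := |t| * |F 0|) (b := |t| * (Fintype.card ι * R))
    (by positivity) fun x => ?_
  rw [abs_mul, mul_assoc |t|, ← mul_add]
  exact mul_le_mul_of_nonneg_left (abs_le_affine_of_grad hF hG x) (abs_nonneg t)

/-- One step of the replica argument for Gaussian concentration. -/
theorem mgf_two_mul_le (hF : ∀ y, HasFDerivAt F (pairing fun i => G i y) y)
    (hGc : ∀ i, Continuous (G i)) (hG : ∀ y, ∑ i, G i y ^ 2 ≤ (R : ℝ) ^ 2) (t : ℝ) :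
    mgf F (stdPi ι) (2 * t) ≤ Real.exp (t ^ 2 * R ^ 2) * mgf F (stdPi ι) t ^ 2 := by
  classical
  have hFc : Continuous F := continuous_iff_continuousAt.2 fun y => (hF y).continuousAt
  -- Three independent copies: `p` reads the first one twice, giving `exp (2 t F)`, while `q` reads
  -- the other two, giving a product of two independent factors. The covariances differ only by the
  -- identity in the off-diagonal blocks.
  set p : ι ⊕ ι → ι ⊕ (ι ⊕ ι) := Sum.elim Sum.inl Sum.inl with hp
  set q : ι ⊕ ι → ι ⊕ (ι ⊕ ι) := Sum.inr with hq
  set l : (ι ⊕ ι → ℝ) → ι → ℝ := fun y i => y (.inl i) with hl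
  set r : (ι ⊕ ι → ℝ) → ι → ℝ := fun y i => y (.inr i) with hr
  have hlc : Continuous l := by fun_prop
  have hrc : Continuous r := by fun_prop
  set lL : (ι ⊕ ι → ℝ) →L[ℝ] (ι → ℝ) :=
    ContinuousLinearMap.pi fun i => ContinuousLinearMap.proj (.inl i) with hlL
  set rL : (ι ⊕ ι → ℝ) →L[ℝ] (ι → ℝ) :=
    ContinuousLinearMap.pi fun i => ContinuousLinearMap.proj (.inr i) with hrL
  set f : (ι ⊕ ι → ℝ) → ℝ := fun y => Real.exp (t * F (l y) + t * F (r y)) with hf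
  have hfc : Continuous f := by fun_prop
  set g : ι ⊕ ι → (ι ⊕ ι → ℝ) → ℝ :=
    Sum.elim (fun i y => t * G i (l y) * f y) (fun i y => t * G i (r y) * f y) with hg
  set D : ι ⊕ ι → (ι ⊕ ι → ℝ) → ℝ :=
    Sum.elim (fun i y => t ^ 2 * G i (l y) * G i (r y) * f y)
      (fun i y => t ^ 2 * G i (l y) * G i (r y) * f y) with hD
  have hfb : ExpBounded f := by
    have h1 := (expBounded_exp_mul_of_grad hF hG t).comp_clm lL
    have h2 := (expBounded_exp_mul_of_grad hF hG t).comp_clm rL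
    refine (h1.mul h2).of_abs_le fun y => le_of_eq ?_
    rw [hf]
    simp only [Real.exp_add]
    rfl
  have hGl : ∀ i, ExpBounded fun y => G i (l y) := fun i =>
    ExpBounded.of_bounded fun y => abs_le_of_sum_sq_le (hG _) i
  have hGr : ∀ i, ExpBounded fun y => G i (r y) := fun i =>
    ExpBounded.of_bounded fun y => abs_le_of_sum_sq_le (hG _) i
  have hline : ∀ (y v : ι ⊕ ι → ℝ), HasLineDerivAt ℝ f
      (f y * (t * (∑ i, G i (l y) * v (.inl i)) + t * ∑ i, G i (r y) * v (.inr i))) y v := by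
    intro y v
    have h1 : HasFDerivAt (fun y => F (l y)) ((pairing fun i => G i (l y)).comp lL) y :=
      (hF (l y)).comp y (show HasFDerivAt l lL y from lL.hasFDerivAt)
    have h2 : HasFDerivAt (fun y => F (r y)) ((pairing fun i => G i (r y)).comp rL) y :=
      (hF (r y)).comp y (show HasFDerivAt r rL y from rL.hasFDerivAt)
    have h3 := (((h1.const_mul t).fun_add (h2.const_mul t)).exp).hasLineDerivAt v
    unfold HasLineDerivAt at h3 ⊢
    refine h3.congr_deriv ?_
    simp [hlL, hrL, hf, pairing]
    ring
  have hfd : ∀ y, HasFDerivAt f (pairing fun i => g i y) y := by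
    intro y
    have hd : DifferentiableAt ℝ f y := by
      have h1 : DifferentiableAt ℝ (fun y => F (l y)) y :=
        (hF (l y)).differentiableAt.comp y (by fun_prop)
      have h2 : DifferentiableAt ℝ (fun y => F (r y)) y :=
        (hF (r y)).differentiableAt.comp y (by fun_prop)
      exact ((h1.const_mul t).add (h2.const_mul t)).exp
    convert hd.hasFDerivAt using 1
    ext v
    rw [← hd.lineDeriv_eq_fderiv, (hline y v).lineDeriv, pairing_apply, Fintype.sum_sum_type]
    simp only [hg, Sum.elim_inl, Sum.elim_inr, Finset.mul_sum, mul_add]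
    congr 1 <;> exact Finset.sum_congr rfl fun i _ => by ring
  have key := integral_comp_le_of_sum_lineDeriv_le (P := selectMatrix p) (Q := selectMatrix q)
    (f := f) (g := g) (D := D) (K := t ^ 2 * R ^ 2) ?_ hfb ?_ ?_ ?_ ?_ hfd ?_ ?_
  · simp only [selectMatrix_mulVec] at key
    refine le_of_eq_of_le ?_ (key.trans_eq ?_)
    · rw [mgf]
      rw [← integral_comp_stdPi (e := (Sum.inl : ι → ι ⊕ (ι ⊕ ι))) Sum.inl_injective
        (G := fun x => Real.exp (2 * t * F x)) (by fun_prop)]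
      refine integral_congr_ae (Filter.Eventually.of_forall fun x => ?_)
      simp only [hf, hp, hl, hr, Sum.elim_inl, Sum.elim_inr]
      congr 1
      ring
    · rw [pow_two (mgf F (stdPi ι) t), mgf, ← integral_mul_stdPi_sum]
      rw [← integral_comp_stdPi (e := q) Sum.inr_injective
        (G := fun x => Real.exp (t * F fun i => x (.inl i)) * Real.exp (t * F fun i => x (.inr i)))
        (by fun_prop)]
      simp only [hf, hl, hr, Real.exp_add]
  · ext a b
    rw [selectMatrix_mul_transpose]
    rcases a with a | a <;> simp [hp, hq]
  · rintro (i | i)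
    · exact ((hGl i).const_mul t).mul hfb
    · exact ((hGr i).const_mul t).mul hfb
  · rintro (i | i)
    · exact (((hGc i).comp hlc).const_mul t).mul hfc
    · exact (((hGc i).comp hrc).const_mul t).mul hfc
  · rintro (i | i) <;> exact (((hGl i).const_mul _).mul (hGr i)).mul hfb
  · rintro (i | i) <;>
      exact ((((hGc i).comp hlc).const_mul _).mul ((hGc i).comp hrc)).mul hfc
  · rintro (i | i) y
    · have hv : (selectMatrix p * (selectMatrix p).transpose -
          selectMatrix q * (selectMatrix q).transpose) (.inl i) = Pi.single (.inr i) 1 := by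
        ext b
        rw [Matrix.sub_apply, selectMatrix_mul_transpose, selectMatrix_mul_transpose]
        rcases b with b | b <;> simp [hp, hq, Pi.single_apply, eq_comm]
      rw [hv]
      have h := hline y (Pi.single (.inr i) 1)
      unfold HasLineDerivAt at h ⊢
      have h' := h.const_mul (t * G i (l y))
      simp only [hg, hD, Sum.elim_inl]
      refine (h'.congr_deriv ?_).congr_of_eventuallyEq
        (Filter.Eventually.of_forall fun s => ?_)
      · simp [Pi.single_apply]
        ring
      -- Moving the right block leaves the left gradient unchanged, so no second derivative of `F`
      -- is needed.
      · have : l (y + s • Pi.single (.inr i) 1) = l y := by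
          ext j
          simp [hl]
        simp only [this]
    · have hv : (selectMatrix p * (selectMatrix p).transpose -
          selectMatrix q * (selectMatrix q).transpose) (.inr i) = Pi.single (.inl i) 1 := by
        ext b
        rw [Matrix.sub_apply, selectMatrix_mul_transpose, selectMatrix_mul_transpose]
        rcases b with b | b <;> simp [hp, hq, Pi.single_apply, eq_comm]
      rw [hv]
      have h := hline y (Pi.single (.inl i) 1)
      unfold HasLineDerivAt at h ⊢
      have h' := h.const_mul (t * G i (r y))
      simp only [hg, hD, Sum.elim_inr]
      refine (h'.congr_deriv ?_).congr_of_eventuallyEq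
        (Filter.Eventually.of_forall fun s => ?_)
      · simp [Pi.single_apply]
        ring
      · have : r (y + s • Pi.single (.inl i) 1) = r y := by
          ext j
          simp [hr]
        simp only [this]
  · intro y
    rw [Fintype.sum_sum_type]
    simp only [hD, Sum.elim_inl, Sum.elim_inr]
    have h1 : ∑ i, G i (l y) * G i (r y) ≤ R ^ 2 := by
      have h2 : ∑ i, G i (l y) * G i (r y) ≤ ∑ i, (G i (l y) ^ 2 + G i (r y) ^ 2) / 2 :=
        Finset.sum_le_sum fun i _ => by nlinarith [sq_nonneg (G i (l y) - G i (r y))]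
      rw [← Finset.sum_div, Finset.sum_add_distrib] at h2
      linarith [hG (l y), hG (r y)]
    have h3 : ∑ i, t ^ 2 * G i (l y) * G i (r y) * f y =
        (t ^ 2 * f y) * ∑ i, G i (l y) * G i (r y) := by
      rw [Finset.mul_sum]
      exact Finset.sum_congr rfl fun i _ => by ring
    rw [h3]
    have h4 : 0 ≤ t ^ 2 * f y := mul_nonneg (sq_nonneg t) (Real.exp_pos _).le
    nlinarith [mul_le_mul_of_nonneg_left h1 h4]

/-- The replica step reads `cgf (2 s) ≤ 2 cgf s + s² R²`. Iterating it from `t / 2 ^ n` adds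
geometric errors of total at most `R² t² / 2`, and `2 ^ n * cgf (t / 2 ^ n)` tends to `t` times the
derivative of the cgf at `0`, which is the mean. -/
theorem mgf_le_of_grad (hF : ∀ y, HasFDerivAt F (pairing fun i => G i y) y)
    (hGc : ∀ i, Continuous (G i)) (hG : ∀ y, ∑ i, G i y ^ 2 ≤ (R : ℝ) ^ 2) (t : ℝ) :
    mgf F (stdPi ι) t ≤ Real.exp (t * ∫ x, F x ∂(stdPi ι) + R ^ 2 * t ^ 2 / 2) := by
  have hFc : Continuous F := continuous_iff_continuousAt.2 fun y => (hF y).continuousAt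
  have hint : ∀ s, Integrable (fun x => Real.exp (s * F x)) (stdPi ι) := fun s =>
    (expBounded_exp_mul_of_grad hF hG s).integrable_of_continuous (by fun_prop)
  have hmem : (0 : ℝ) ∈ interior (integrableExpSet F (stdPi ι)) := by
    rw [show integrableExpSet F (stdPi ι) = Set.univ from Set.eq_univ_of_forall hint]
    simp
  have hpos : ∀ s, 0 < mgf F (stdPi ι) s := fun s => mgf_pos (hint s)
  have hstep : ∀ s, cgf F (stdPi ι) (2 * s) ≤ 2 * cgf F (stdPi ι) s + s ^ 2 * R ^ 2 := by
    intro s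
    have h := Real.log_le_log (hpos _) (mgf_two_mul_le hF hGc hG s)
    rw [Real.log_mul (Real.exp_pos _).ne' (pow_pos (hpos s) 2).ne', Real.log_exp,
      Real.log_pow] at h
    simp only [cgf]
    push_cast at h
    linarith
  have hiter : ∀ n : ℕ, cgf F (stdPi ι) t - R ^ 2 * t ^ 2 / 2 ≤
      2 ^ n * cgf F (stdPi ι) (t / 2 ^ n) - R ^ 2 * t ^ 2 / (2 * 2 ^ n) := by
    intro n
    induction n with
    | zero => simp
    | succ n ih =>
      have h := hstep (t / 2 ^ (n + 1))
      have e : 2 * (t / 2 ^ (n + 1)) = t / 2 ^ n := by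
        rw [pow_succ]
        field_simp
      rw [e] at h
      have h2 : (2 : ℝ) ^ n * cgf F (stdPi ι) (t / 2 ^ n) ≤
          2 ^ n * (2 * cgf F (stdPi ι) (t / 2 ^ (n + 1)) + (t / 2 ^ (n + 1)) ^ 2 * R ^ 2) :=
        mul_le_mul_of_nonneg_left h (by positivity)
      refine ih.trans ?_
      have e2 : (2 : ℝ) ^ n * ((t / 2 ^ (n + 1)) ^ 2 * R ^ 2) =
          R ^ 2 * t ^ 2 / (2 * 2 ^ n) - R ^ 2 * t ^ 2 / (2 * 2 ^ (n + 1)) := by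
        rw [pow_succ]
        field_simp
        ring
      have e3 : (2 : ℝ) ^ (n + 1) = 2 * 2 ^ n := by ring
      rw [mul_add, e2] at h2
      rw [e3] at h2 ⊢
      linarith
  have hlim : Filter.Tendsto (fun n : ℕ => (2 : ℝ) ^ n * cgf F (stdPi ι) (t / 2 ^ n))
      Filter.atTop (nhds (t * ∫ x, F x ∂(stdPi ι))) := by
    have hd : HasDerivAt (cgf F (stdPi ι)) (∫ x, F x ∂(stdPi ι)) 0 := by
      have := (analyticAt_cgf hmem).differentiableAt.hasDerivAt
      rw [deriv_cgf_zero hmem] at this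
      simpa using this
    rcases eq_or_ne t 0 with rfl | ht
    · simp
    have hseq : Filter.Tendsto (fun n : ℕ => t / 2 ^ n) Filter.atTop
        (nhdsWithin 0 {0}ᶜ) := by
      refine tendsto_nhdsWithin_iff.2 ⟨?_, Filter.Eventually.of_forall fun n => ?_⟩
      · have := (tendsto_pow_atTop_nhds_zero_of_lt_one (r := (1 / 2 : ℝ)) (by norm_num)
          (by norm_num)).const_mul t
        simpa [div_eq_mul_inv] using this
      · simp [ht]
    have h := ((hasDerivAt_iff_tendsto_slope.1 hd).comp hseq).const_mul t
    refine h.congr fun n => ?_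
    simp only [Function.comp_apply, slope_def_field, cgf_zero, sub_zero]
    field_simp
  have hfin : cgf F (stdPi ι) t - R ^ 2 * t ^ 2 / 2 ≤ t * ∫ x, F x ∂(stdPi ι) := by
    refine ge_of_tendsto hlim (Filter.Eventually.of_forall fun n => (hiter n).trans ?_)
    have : (0 : ℝ) ≤ R ^ 2 * t ^ 2 / (2 * 2 ^ n) := by positivity
    linarith
  rw [← Real.log_le_iff_le_exp (hpos t)]
  simp only [cgf] at hfin
  linarith

/-- **Gaussian concentration** for smooth Lipschitz functions. -/
theorem hasSubgaussianMGF_of_grad (hF : ∀ y, HasFDerivAt F (pairing fun i => G i y) y)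
    (hGc : ∀ i, Continuous (G i)) (hG : ∀ y, ∑ i, G i y ^ 2 ≤ (R : ℝ) ^ 2) :
    HasSubgaussianMGF (fun x => F x - ∫ y, F y ∂(stdPi ι)) (R ^ 2) (stdPi ι) := by
  have hFc : Continuous F := continuous_iff_continuousAt.2 fun y => (hF y).continuousAt
  refine ⟨fun t => ?_, fun t => ?_⟩
  · simp only [mul_sub, Real.exp_sub]
    exact ((expBounded_exp_mul_of_grad hF hG t).integrable_of_continuous (by fun_prop)).div_const _
  · have h := mgf_le_of_grad hF hGc hG t
    simp only [mgf, mul_sub, Real.exp_sub, integral_div] at h ⊢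
    rw [div_le_iff₀ (Real.exp_pos _), ← Real.exp_add]
    refine h.trans (Real.exp_le_exp.2 (le_of_eq ?_))
    push_cast
    ring

theorem measure_ge_integral_add_le (hF : ∀ y, HasFDerivAt F (pairing fun i => G i y) y)
    (hGc : ∀ i, Continuous (G i)) (hG : ∀ y, ∑ i, G i y ^ 2 ≤ (R : ℝ) ^ 2) {u : ℝ} (hu : 0 ≤ u) :
    (stdPi ι).real {x | ∫ y, F y ∂(stdPi ι) + u ≤ F x} ≤ Real.exp (-u ^ 2 / (2 * R ^ 2)) := by
  have h := (hasSubgaussianMGF_of_grad hF hGc hG).measure_ge_le hu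
  push_cast at h
  refine le_of_eq_of_le ?_ h
  congr 1
  ext x
  simp [le_sub_iff_add_le, add_comm]

end Concentration

end

/-! ### The smoothed maximum of the energies and its Gibbs weights. -/

section

section SmoothMax

variable {ζ : Type*} [Fintype ζ] {m : ℕ}

/-- A smooth approximation of the Euclidean norm of the block `a` of `y`. -/
def smoothNorm (δ : ℝ) (a : ζ) (y : (ζ × Fin m) ⊕ ζ → ℝ) : ℝ :=
  √(∑ k, y (.inl (a, k)) ^ 2 + δ ^ 2)

/-- The coordinate `k` of the gradient of `smoothNorm` in the block `a`. -/
def smoothDir (δ : ℝ) (a : ζ) (k : Fin m) (y : (ζ × Fin m) ⊕ ζ → ℝ) : ℝ :=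
  y (.inl (a, k)) / smoothNorm δ a y

/-- The energy of the block `a`. -/
def energy (σ δ : ℝ) (c : ζ → ℝ) (a : ζ) (y : (ζ × Fin m) ⊕ ζ → ℝ) : ℝ :=
  σ * smoothNorm δ a y + y (.inr a) - c a

/-- A smooth approximation of the maximum of the energies. -/
def smoothMax (σ β δ : ℝ) (c : ζ → ℝ) (y : (ζ × Fin m) ⊕ ζ → ℝ) : ℝ :=
  β⁻¹ * Real.log (∑ a, Real.exp (β * energy σ δ c a y))

/-- The Gibbs weights of the energies. -/
def gibbs (σ β δ : ℝ) (c : ζ → ℝ) (a : ζ) (y : (ζ × Fin m) ⊕ ζ → ℝ) : ℝ :=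
  Real.exp (β * (energy σ δ c a y - smoothMax σ β δ c y))

/-- The differential of `energy`. -/
def energyDeriv (σ δ : ℝ) (a : ζ) (y : (ζ × Fin m) ⊕ ζ → ℝ) :
    ((ζ × Fin m) ⊕ ζ → ℝ) →L[ℝ] ℝ :=
  σ • (∑ k, smoothDir δ a k y • ContinuousLinearMap.proj (.inl (a, k))) +
    ContinuousLinearMap.proj (.inr a)

variable {σ β δ : ℝ} {c : ζ → ℝ}

omit [Fintype ζ] in
theorem energyDeriv_apply (a : ζ) (y v : (ζ × Fin m) ⊕ ζ → ℝ) :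
    energyDeriv σ δ a y v = σ * ∑ k, smoothDir δ a k y * v (.inl (a, k)) + v (.inr a) := by
  simp [energyDeriv]

omit [Fintype ζ] in
theorem smoothNorm_pos (hδ : 0 < δ) (a : ζ) (y : (ζ × Fin m) ⊕ ζ → ℝ) : 0 < smoothNorm δ a y :=
  Real.sqrt_pos.2 (add_pos_of_nonneg_of_pos (Finset.sum_nonneg fun _ _ => sq_nonneg _)
    (by positivity))

omit [Fintype ζ] in
theorem continuous_smoothNorm (a : ζ) : Continuous (smoothNorm (m := m) δ a) := by
  unfold smoothNorm
  fun_prop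

omit [Fintype ζ] in
theorem continuous_smoothDir (hδ : 0 < δ) (a : ζ) (k : Fin m) :
    Continuous (smoothDir δ a k) :=
  (continuous_apply _).div (continuous_smoothNorm a) fun y => (smoothNorm_pos hδ a y).ne'

omit [Fintype ζ] in
theorem sum_smoothDir_sq_le (hδ : 0 < δ) (a : ζ) (y : (ζ × Fin m) ⊕ ζ → ℝ) :
    ∑ k, smoothDir δ a k y ^ 2 ≤ 1 := by
  have h := smoothNorm_pos hδ a y
  simp only [smoothDir, div_pow]
  rw [← Finset.sum_div, div_le_one (by positivity), smoothNorm, Real.sq_sqrt]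
  · linarith [sq_nonneg δ]
  · exact add_nonneg (Finset.sum_nonneg fun _ _ => sq_nonneg _) (sq_nonneg δ)

omit [Fintype ζ] in
theorem abs_smoothDir_le (hδ : 0 < δ) (a : ζ) (k : Fin m) (y : (ζ × Fin m) ⊕ ζ → ℝ) :
    |smoothDir δ a k y| ≤ 1 :=
  abs_le_of_sq_le_sq (by
    have := (Finset.single_le_sum (f := fun k => smoothDir δ a k y ^ 2)
      (fun _ _ => sq_nonneg _) (Finset.mem_univ k)).trans (sum_smoothDir_sq_le hδ a y)
    simpa using this) zero_le_one

theorem hasFDerivAt_energy (hδ : 0 < δ) (a : ζ) (y : (ζ × Fin m) ⊕ ζ → ℝ) :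
    HasFDerivAt (energy σ δ c a) (energyDeriv σ δ a y) y := by
  have hs := smoothNorm_pos hδ a y
  have h1 : HasFDerivAt (fun y : (ζ × Fin m) ⊕ ζ → ℝ => ∑ k, y (.inl (a, k)) ^ 2 + δ ^ 2)
      (∑ k, (2 * y (.inl (a, k))) •
        (ContinuousLinearMap.proj (.inl (a, k)) : ((ζ × Fin m) ⊕ ζ → ℝ) →L[ℝ] ℝ)) y := by
    refine HasFDerivAt.add_const _ (HasFDerivAt.fun_sum fun k _ => ?_)
    have h := (hasDerivAt_pow 2 (y (.inl (a, k)))).comp_hasFDerivAt y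
      (hasFDerivAt_apply (𝕜 := ℝ) (.inl (a, k) : (ζ × Fin m) ⊕ ζ) y)
    refine h.congr_fderiv ?_
    ext v
    simp
  have h2 := h1.sqrt (Real.sqrt_pos.1 hs).ne'
  have h3 := ((h2.const_mul σ).fun_add
    (hasFDerivAt_apply (𝕜 := ℝ) (.inr a : (ζ × Fin m) ⊕ ζ) y)).sub_const (c a)
  refine h3.congr_fderiv ?_
  ext v
  rw [energyDeriv_apply]
  simp only [smoothDir, smoothNorm, add_apply, smul_apply,
    sum_apply, ContinuousLinearMap.proj_apply, smul_eq_mul, Finset.mul_sum]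
  congr 1
  refine Finset.sum_congr rfl fun k _ => ?_
  change √(∑ k, y (.inl (a, k)) ^ 2 + δ ^ 2) > 0 at hs
  field_simp

theorem continuous_energy (a : ζ) : Continuous (energy (m := m) σ δ c a) :=
  (((continuous_smoothNorm a).const_mul σ).add (continuous_apply _)).sub continuous_const

variable [Nonempty ζ]

theorem sum_exp_energy_pos (y : (ζ × Fin m) ⊕ ζ → ℝ) :
    0 < ∑ a, Real.exp (β * energy σ δ c a y) :=
  Finset.sum_pos (fun _ _ => Real.exp_pos _) Finset.univ_nonempty

theorem continuous_smoothMax : Continuous (smoothMax (m := m) σ β δ c) :=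
  ((continuous_finsetSum _ fun a _ =>
    Real.continuous_exp.comp ((continuous_energy a).const_mul β)).log
      fun y => (sum_exp_energy_pos y).ne').const_mul _

theorem continuous_gibbs (a : ζ) : Continuous (gibbs (m := m) σ β δ c a) :=
  Real.continuous_exp.comp (((continuous_energy a).sub continuous_smoothMax).const_mul β)

theorem gibbs_eq (hβ : 0 < β) (a : ζ) (y : (ζ × Fin m) ⊕ ζ → ℝ) :
    gibbs σ β δ c a y =
      Real.exp (β * energy σ δ c a y) / ∑ b, Real.exp (β * energy σ δ c b y) := by
  rw [gibbs, smoothMax, mul_sub, mul_inv_cancel_left₀ hβ.ne', Real.exp_sub,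
    Real.exp_log (sum_exp_energy_pos y)]

theorem gibbs_pos (a : ζ) (y : (ζ × Fin m) ⊕ ζ → ℝ) : 0 < gibbs σ β δ c a y := Real.exp_pos _

theorem sum_gibbs (hβ : 0 < β) (y : (ζ × Fin m) ⊕ ζ → ℝ) : ∑ a, gibbs σ β δ c a y = 1 := by
  simp only [gibbs_eq hβ]
  rw [← Finset.sum_div, div_self (sum_exp_energy_pos y).ne']

theorem gibbs_le_one (hβ : 0 < β) (a : ζ) (y : (ζ × Fin m) ⊕ ζ → ℝ) : gibbs σ β δ c a y ≤ 1 :=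
  (Finset.single_le_sum (f := fun a => gibbs σ β δ c a y) (fun _ _ => (gibbs_pos _ _).le)
    (Finset.mem_univ a)).trans_eq (sum_gibbs hβ y)

theorem energy_le_smoothMax (hβ : 0 < β) (a : ζ) (y : (ζ × Fin m) ⊕ ζ → ℝ) :
    energy σ δ c a y ≤ smoothMax σ β δ c y := by
  have h := gibbs_le_one (σ := σ) (δ := δ) (c := c) hβ a y
  rw [gibbs, Real.exp_le_one_iff] at h
  nlinarith

theorem smoothMax_le (hβ : 0 < β) {y : (ζ × Fin m) ⊕ ζ → ℝ} {M : ℝ}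
    (h : ∀ a, energy σ δ c a y ≤ M) :
    smoothMax σ β δ c y ≤ M + Real.log (Fintype.card ζ) / β := by
  have h1 : ∑ a, Real.exp (β * energy σ δ c a y) ≤ Fintype.card ζ * Real.exp (β * M) := by
    refine (Finset.sum_le_sum fun a _ => Real.exp_le_exp.2
      (mul_le_mul_of_nonneg_left (h a) hβ.le)).trans_eq ?_
    simp
  have h2 := Real.log_le_log (sum_exp_energy_pos y) h1
  rw [Real.log_mul (by simp) (Real.exp_pos _).ne', Real.log_exp] at h2
  rw [smoothMax, inv_mul_le_iff₀ hβ, mul_add, mul_div_cancel₀ _ hβ.ne']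
  linarith

theorem hasFDerivAt_smoothMax (hβ : 0 < β) (hδ : 0 < δ) (y : (ζ × Fin m) ⊕ ζ → ℝ) :
    HasFDerivAt (smoothMax σ β δ c) (∑ a, gibbs σ β δ c a y • energyDeriv σ δ a y) y := by
  have h1 : HasFDerivAt (fun y => ∑ a, Real.exp (β * energy σ δ c a y))
      (∑ a, Real.exp (β * energy σ δ c a y) • (β • energyDeriv σ δ a y)) y :=
    HasFDerivAt.fun_sum fun a _ => ((hasFDerivAt_energy hδ a y).const_mul β).exp
  refine ((h1.log (sum_exp_energy_pos y).ne').const_mul β⁻¹).congr_fderiv ?_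
  simp only [Finset.smul_sum, smul_smul]
  refine Finset.sum_congr rfl fun a _ => ?_
  rw [gibbs_eq hβ]
  congr 1
  field_simp

/-- The partial derivatives of `smoothMax`. -/
def smoothMaxGrad (σ β δ : ℝ) (c : ζ → ℝ) :
    (ζ × Fin m) ⊕ ζ → ((ζ × Fin m) ⊕ ζ → ℝ) → ℝ :=
  Sum.elim (fun i y => σ * smoothDir δ i.1 i.2 y * gibbs σ β δ c i.1 y) fun a => gibbs σ β δ c a

theorem hasFDerivAt_smoothMax_pairing (hβ : 0 < β) (hδ : 0 < δ) (y : (ζ × Fin m) ⊕ ζ → ℝ) :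
    HasFDerivAt (smoothMax σ β δ c) (pairing fun i => smoothMaxGrad σ β δ c i y) y := by
  refine (hasFDerivAt_smoothMax hβ hδ y).congr_fderiv ?_
  ext v
  rw [pairing_apply, Fintype.sum_sum_type, Fintype.sum_prod_type, ← Finset.sum_add_distrib,
    sum_apply]
  refine Finset.sum_congr rfl fun a _ => ?_
  simp only [smul_apply, energyDeriv_apply, smul_eq_mul, smoothMaxGrad,
    Sum.elim_inl, Sum.elim_inr, mul_add, Finset.mul_sum]
  congr 1
  exact Finset.sum_congr rfl fun k _ => by ring

theorem continuous_smoothMaxGrad (hδ : 0 < δ) (i : (ζ × Fin m) ⊕ ζ) :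
    Continuous (smoothMaxGrad σ β δ c i) := by
  rcases i with ⟨a, k⟩ | a
  · exact ((continuous_smoothDir hδ a k).const_mul σ).mul (continuous_gibbs a)
  · exact continuous_gibbs a

theorem expBounded_gibbs (hβ : 0 < β) (a : ζ) : ExpBounded (gibbs (m := m) σ β δ c a) :=
  ExpBounded.of_bounded fun y => by
    rw [abs_of_pos (gibbs_pos a y)]
    exact gibbs_le_one hβ a y

omit [Fintype ζ] [Nonempty ζ] in
theorem expBounded_smoothDir [Fintype ζ] (hδ : 0 < δ) (a : ζ) (k : Fin m) :
    ExpBounded (smoothDir δ a k) :=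
  ExpBounded.of_bounded (abs_smoothDir_le hδ a k)

theorem expBounded_smoothMaxGrad (hβ : 0 < β) (hδ : 0 < δ) (i : (ζ × Fin m) ⊕ ζ) :
    ExpBounded (smoothMaxGrad σ β δ c i) := by
  rcases i with ⟨a, k⟩ | a
  · exact ((expBounded_smoothDir hδ a k).const_mul σ).mul (expBounded_gibbs hβ a)
  · exact expBounded_gibbs hβ a

theorem expBounded_smoothMax (hσ : |σ| ≤ 1) (hβ : 0 < β) (hδ : 0 < δ) :
    ExpBounded (smoothMax (m := m) σ β δ c) := by
  -- A crude Lipschitz constant suffices here: every partial derivative is at most `1` in absolute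
  -- value, and the number of coordinates is at most its square.
  have h := abs_le_affine_of_grad (R := (Fintype.card ((ζ × Fin m) ⊕ ζ) : ℝ≥0))
    (hasFDerivAt_smoothMax_pairing (m := m) (σ := σ) (c := c) hβ hδ) (fun y => by
      refine (Finset.sum_le_sum (g := fun _ => 1) fun i _ => ?_).trans (by
        rw [Finset.sum_const, nsmul_eq_mul, mul_one, Finset.card_univ, NNReal.coe_natCast]
        exact_mod_cast Nat.le_self_pow two_ne_zero _)
      rw [sq_le_one_iff_abs_le_one]
      rcases i with ⟨a, k⟩ | a
      · simp only [smoothMaxGrad, Sum.elim_inl, abs_mul, abs_of_pos (gibbs_pos a y)]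
        exact mul_le_one₀ (mul_le_one₀ hσ (abs_nonneg _) (abs_smoothDir_le hδ a k y))
          (gibbs_pos a y).le (gibbs_le_one hβ a y)
      · simp only [smoothMaxGrad, Sum.elim_inr, abs_of_pos (gibbs_pos a y)]
        exact gibbs_le_one hβ a y)
  exact ExpBounded.of_abs_le_affine (abs_nonneg _) (by positivity) h

theorem hasLineDerivAt_gibbs (hβ : 0 < β) (hδ : 0 < δ) (a : ζ) (y v : (ζ × Fin m) ⊕ ζ → ℝ) :
    HasLineDerivAt ℝ (gibbs σ β δ c a) (gibbs σ β δ c a y * (β *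
      (energyDeriv σ δ a y v - ∑ b, gibbs σ β δ c b y * energyDeriv σ δ b y v))) y v := by
  have h := ((((hasFDerivAt_energy (c := c) (σ := σ) hδ a y).fun_sub
    (hasFDerivAt_smoothMax (c := c) (σ := σ) hβ hδ y)).const_mul β).exp).hasLineDerivAt v
  unfold HasLineDerivAt at h ⊢
  refine h.congr_deriv ?_
  simp [gibbs]

/-- Concentration of `smoothMax` around its mean under a linear image of a standard Gaussian
vector. -/
theorem measure_smoothMax_ge_le {κ : Type*} [Fintype κ] (hβ : 0 < β) (hδ : 0 < δ) {R : ℝ≥0}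
    (B : Matrix ((ζ × Fin m) ⊕ ζ) κ ℝ)
    (hB : ∀ a (y : (ζ × Fin m) ⊕ ζ → ℝ),
      ∑ x, (σ * ∑ k, smoothDir δ a k y * B (.inl (a, k)) x + B (.inr a) x) ^ 2 ≤ (R : ℝ) ^ 2)
    {u : ℝ} (hu : 0 ≤ u) :
    (stdPi κ).real {x | ∫ y, smoothMax σ β δ c (B.mulVec y) ∂(stdPi κ) + u ≤
      smoothMax σ β δ c (B.mulVec x)} ≤ Real.exp (-u ^ 2 / (2 * R ^ 2)) := by
  set L := B.mulVecLin.toContinuousLinearMap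
  have hL : ∀ x, L x = B.mulVec x := fun _ => rfl
  refine measure_ge_integral_add_le (F := fun x => smoothMax σ β δ c (B.mulVec x))
    (G := fun j x => ∑ a, gibbs σ β δ c a (B.mulVec x) *
      (σ * ∑ k, smoothDir δ a k (B.mulVec x) * B (.inl (a, k)) j + B (.inr a) j)) ?_ ?_ ?_ hu
  · intro x
    have h := (hasFDerivAt_smoothMax (c := c) (σ := σ) hβ hδ (L x)).comp x L.hasFDerivAt
    refine h.congr_fderiv ?_
    ext v
    rw [pairing_apply, ContinuousLinearMap.comp_apply, sum_apply]
    simp only [smul_apply, energyDeriv_apply, smul_eq_mul, hL,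
      Matrix.mulVec, dotProduct]
    simp only [Finset.sum_mul]
    rw [Finset.sum_comm]
    refine Finset.sum_congr rfl fun a _ => ?_
    simp only [mul_assoc, ← Finset.mul_sum]
    congr 1
    simp only [add_mul, Finset.sum_add_distrib, Finset.mul_sum, Finset.sum_mul]
    rw [Finset.sum_comm]
    congr 1
    exact Finset.sum_congr rfl fun j _ => Finset.sum_congr rfl fun k _ => by ring
  · intro j
    have hc : Continuous fun x : κ → ℝ => B.mulVec x := L.continuous
    refine continuous_finsetSum _ fun a _ => ((continuous_gibbs a).comp hc).mul ?_
    refine (Continuous.const_mul (continuous_finsetSum _ fun k _ => ?_) σ).add continuous_const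
    exact ((continuous_smoothDir hδ a k).comp hc).mul continuous_const
  · intro x
    -- The gradient is a Gibbs average of the gradients of the energies, so by convexity of the
    -- square its length obeys the bound common to all of them.
    have h1 : ∀ j, (∑ a, gibbs σ β δ c a (B.mulVec x) *
        (σ * ∑ k, smoothDir δ a k (B.mulVec x) * B (.inl (a, k)) j + B (.inr a) j)) ^ 2 ≤
        ∑ a, gibbs σ β δ c a (B.mulVec x) *
          (σ * ∑ k, smoothDir δ a k (B.mulVec x) * B (.inl (a, k)) j + B (.inr a) j) ^ 2 :=
      fun j => Real.pow_arith_mean_le_arith_mean_pow_of_even _ _ _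
        (fun a _ => (gibbs_pos a _).le) (sum_gibbs hβ _) even_two
    refine (Finset.sum_le_sum fun j _ => h1 j).trans ?_
    rw [Finset.sum_comm]
    simp only [← Finset.mul_sum]
    refine (Finset.sum_le_sum fun a _ =>
      mul_le_mul_of_nonneg_left (hB a (B.mulVec x)) (gibbs_pos a _).le).trans_eq ?_
    rw [← Finset.sum_mul, sum_gibbs hβ, one_mul]

end SmoothMax

end

/-! ### Gordon's comparison inequality. -/

section

section Gordon

variable {ζ : Type*} {m n : ℕ}

/-- The matrix of the process `(A u_a)ₐ` as a function of the Gaussian matrix `A`. -/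
def matrixProcess (m : ℕ) (u : ζ → EuclideanSpace ℝ (Fin n)) :
    Matrix ((ζ × Fin m) ⊕ ζ) (Fin m × Fin n) ℝ :=
  Matrix.of fun i q => Sum.elim (fun p : ζ × Fin m => if p.2 = q.1 then u p.1 q.2 else 0)
    (fun _ => 0) i

/-- The process `matrixProcess` on a larger probability space. -/
def gordonLeft (m : ℕ) (u : ζ → EuclideanSpace ℝ (Fin n)) :
    Matrix ((ζ × Fin m) ⊕ ζ) ((Fin m × Fin n) ⊕ (Fin m ⊕ Fin n)) ℝ :=
  Matrix.of fun i => Sum.elim (matrixProcess m u i) fun _ => 0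

/-- The matrix of the decoupled process `(‖u_a‖ h, ⟪g, u_a⟫)ₐ`. -/
def gordonRight (m : ℕ) (u : ζ → EuclideanSpace ℝ (Fin n)) :
    Matrix ((ζ × Fin m) ⊕ ζ) ((Fin m × Fin n) ⊕ (Fin m ⊕ Fin n)) ℝ :=
  Matrix.of fun i => Sum.elim (fun _ => 0) (Sum.elim
    (fun k => Sum.elim (fun p : ζ × Fin m => if p.2 = k then ‖u p.1‖ else 0) (fun _ => 0) i)
    (fun j => Sum.elim (fun _ : ζ × Fin m => 0) (fun a => u a j) i))

variable (u : ζ → EuclideanSpace ℝ (Fin n))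

/-- The two processes read disjoint sets of coordinates, hence are independent. -/
theorem gordonLeft_mul_gordonRight :
    gordonLeft m u * (gordonRight m u).transpose = 0 := by
  ext i j
  simp [Matrix.mul_apply, gordonLeft, gordonRight, Fintype.sum_sum_type]

/-- The difference of the covariances of `gordonLeft` and `gordonRight`. -/
def gordonCov (m : ℕ) (u : ζ → EuclideanSpace ℝ (Fin n)) :
    (ζ × Fin m) ⊕ ζ → (ζ × Fin m) ⊕ ζ → ℝ :=
  Sum.elim
    (fun p => Sum.elim
      (fun q => if q.2 = p.2 then inner ℝ (u p.1) (u q.1) - ‖u p.1‖ * ‖u q.1‖ else 0) fun _ => 0)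
    (fun a => Sum.elim (fun _ => 0) fun b => -inner ℝ (u a) (u b))

theorem gordonLeft_sub_gordonRight (i : (ζ × Fin m) ⊕ ζ) :
    (gordonLeft m u * (gordonLeft m u).transpose -
      gordonRight m u * (gordonRight m u).transpose) i = gordonCov m u i := by
  ext j
  rw [Matrix.sub_apply, Matrix.mul_apply, Matrix.mul_apply]
  simp only [Fintype.sum_sum_type, Fintype.sum_prod_type, Matrix.transpose_apply]
  rcases i with ⟨a, k⟩ | a <;> rcases j with ⟨b, l⟩ | b
  · by_cases h : l = k
    · subst h
      simp [gordonLeft, gordonRight, matrixProcess, gordonCov, PiLp.inner_apply, mul_comm]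
    · simp [gordonLeft, gordonRight, matrixProcess, gordonCov, h, Ne.symm h]
  · simp [gordonLeft, gordonRight, matrixProcess, gordonCov]
  · simp [gordonLeft, gordonRight, matrixProcess, gordonCov]
  · simp [gordonLeft, gordonRight, matrixProcess, gordonCov, PiLp.inner_apply, mul_comm]

variable [Fintype ζ] [Nonempty ζ] {σ β δ : ℝ} {c : ζ → ℝ}

/-- The derivative of `smoothMaxGrad` in the direction of `gordonCov`. -/
def gordonHess (u : ζ → EuclideanSpace ℝ (Fin n)) (σ β δ : ℝ) (c : ζ → ℝ)
    (i : (ζ × Fin m) ⊕ ζ) (y : (ζ × Fin m) ⊕ ζ → ℝ) : ℝ :=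
  Sum.elim (fun p => σ * smoothDir δ p.1 p.2 y) (fun _ => 1) i *
    (gibbs σ β δ c (Sum.elim Prod.fst id i) y *
      (β * (energyDeriv σ δ (Sum.elim Prod.fst id i) y (gordonCov m u i) -
        ∑ b, gibbs σ β δ c b y * energyDeriv σ δ b y (gordonCov m u i))))

theorem continuous_energyDeriv_apply (hδ : 0 < δ) (a : ζ) (v : (ζ × Fin m) ⊕ ζ → ℝ) :
    Continuous fun y => energyDeriv σ δ a y v := by
  simp only [energyDeriv_apply]
  exact ((continuous_finsetSum _ fun k _ =>
    (continuous_smoothDir hδ a k).mul continuous_const).const_mul σ).add continuous_const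

theorem expBounded_energyDeriv_apply (hδ : 0 < δ) (a : ζ) (v : (ζ × Fin m) ⊕ ζ → ℝ) :
    ExpBounded fun y => energyDeriv σ δ a y v := by
  simp only [energyDeriv_apply]
  exact ((ExpBounded.sum _ fun k _ =>
    (expBounded_smoothDir hδ a k).mul (ExpBounded.const _)).const_mul σ).add (ExpBounded.const _)

theorem continuous_gordonHess (hδ : 0 < δ) (i : (ζ × Fin m) ⊕ ζ) :
    Continuous (gordonHess u σ β δ c i) := by
  refine Continuous.mul ?_ ((continuous_gibbs _).mul (Continuous.const_mul
    ((continuous_energyDeriv_apply hδ _ _).sub (continuous_finsetSum _ fun b _ =>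
      (continuous_gibbs b).mul (continuous_energyDeriv_apply hδ b _))) β))
  rcases i with ⟨a, k⟩ | a
  · exact (continuous_smoothDir hδ a k).const_mul σ
  · exact continuous_const

theorem expBounded_gordonHess (hβ : 0 < β) (hδ : 0 < δ) (i : (ζ × Fin m) ⊕ ζ) :
    ExpBounded (gordonHess u σ β δ c i) := by
  refine ExpBounded.mul ?_ ((expBounded_gibbs hβ _).mul (ExpBounded.const_mul β ?_))
  · rcases i with ⟨a, k⟩ | a
    · exact (expBounded_smoothDir hδ a k).const_mul σ
    · exact ExpBounded.const 1
  · exact (expBounded_energyDeriv_apply hδ _ _).sub (ExpBounded.sum _ fun b _ =>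
      (expBounded_gibbs hβ b).mul (expBounded_energyDeriv_apply hδ b _))

/-- Row `(a, k)` of the covariance difference vanishes on block `a`, since `⟪u a, u a⟫ = ‖u a‖²`.
The direction `smoothDir` is therefore constant along that line: the curvature of the norm never
enters, and only the Gibbs weight is differentiated. -/
theorem hasLineDerivAt_smoothMaxGrad_gordonCov (hβ : 0 < β) (hδ : 0 < δ)
    (i : (ζ × Fin m) ⊕ ζ) (y : (ζ × Fin m) ⊕ ζ → ℝ) :
    HasLineDerivAt ℝ (smoothMaxGrad σ β δ c i) (gordonHess u σ β δ c i y) y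
      (gordonCov m u i) := by
  rcases i with ⟨a, k⟩ | a
  · have h := hasLineDerivAt_gibbs (c := c) (σ := σ) hβ hδ a y (gordonCov m u (.inl (a, k)))
    unfold HasLineDerivAt at h ⊢
    refine (h.const_mul (σ * smoothDir δ a k y)).congr_of_eventuallyEq
      (Filter.Eventually.of_forall fun t => ?_)
    have h0 : ∀ l, (y + t • gordonCov m u (.inl (a, k))) (.inl (a, l)) = y (.inl (a, l)) := by
      intro l
      simp [gordonCov, pow_two]
    simp only [smoothMaxGrad, Sum.elim_inl, smoothDir, smoothNorm, h0]
  · simpa [gordonHess, smoothMaxGrad] using hasLineDerivAt_gibbs (c := c) (σ := σ) hβ hδ a y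
      (gordonCov m u (.inr a))

/-- The factor `‖u a‖ ‖u b‖ - ⟪u a, u b⟫` is nonnegative, so its coefficient `σ² ∑ N a k N b k ≤ 1`
may be replaced by `1`. The inner products then cancel, and what remains is `-β` times the variance
of `‖u a‖` under the Gibbs weights. The sign of `σ` plays no role, so upper and lower bounds are
covered at once. -/
theorem sum_gordonHess_le (hσ : |σ| ≤ 1) (hβ : 0 < β) (hδ : 0 < δ)
    (y : (ζ × Fin m) ⊕ ζ → ℝ) : ∑ i, gordonHess u σ β δ c i y ≤ 0 := by
  set p : ζ → ℝ := fun a => gibbs σ β δ c a y with hp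
  set N : ζ → Fin m → ℝ := fun a k => smoothDir δ a k y with hN
  have hp0 : ∀ a, 0 ≤ p a := fun a => (gibbs_pos a y).le
  have hp1 : ∑ a, p a = 1 := sum_gibbs hβ y
  have hN1 : ∀ a, ∑ k, N a k ^ 2 ≤ 1 := fun a => sum_smoothDir_sq_le hδ a y
  have e1 : ∀ a k, gordonHess u σ β δ c (.inl (a, k)) y =
      ∑ b, β * p a * p b * (σ ^ 2 * (N a k * N b k) *
        (‖u a‖ * ‖u b‖ - inner ℝ (u a) (u b))) := by
    intro a k
    simp only [gordonHess, Sum.elim_inl, energyDeriv_apply, gordonCov, Sum.elim_inr, mul_ite,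
      mul_zero, Finset.sum_ite_eq', Finset.mem_univ, if_true, real_inner_self_eq_norm_mul_norm,
      sub_self, add_zero, zero_sub]
    rw [← Finset.sum_neg_distrib, Finset.mul_sum, Finset.mul_sum, Finset.mul_sum]
    exact Finset.sum_congr rfl fun b _ => by
      simp only [hp, hN]
      ring
  have e2 : ∀ a, gordonHess u σ β δ c (.inr a) y =
      -(β * p a * ‖u a‖ ^ 2) + ∑ b, β * p a * p b * inner ℝ (u a) (u b) := by
    intro a
    simp only [gordonHess, Sum.elim_inr, energyDeriv_apply, gordonCov, Sum.elim_inl, mul_zero,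
      Finset.sum_const_zero, zero_add, one_mul, id_eq, real_inner_self_eq_norm_sq, mul_neg,
      Finset.sum_neg_distrib, sub_neg_eq_add]
    rw [mul_add, mul_add, Finset.mul_sum, Finset.mul_sum]
    congr 1
    · simp only [hp]
      ring
    · exact Finset.sum_congr rfl fun b _ => by
        simp only [hp]
        ring
  rw [Fintype.sum_sum_type, Fintype.sum_prod_type]
  simp only [e1, e2]
  have e3 : ∑ a, ∑ k, ∑ b, β * p a * p b * (σ ^ 2 * (N a k * N b k) *
        (‖u a‖ * ‖u b‖ - inner ℝ (u a) (u b))) =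
      ∑ a, ∑ b, β * p a * p b * (σ ^ 2 * (∑ k, N a k * N b k) *
        (‖u a‖ * ‖u b‖ - inner ℝ (u a) (u b))) := by
    refine Finset.sum_congr rfl fun a _ => ?_
    rw [Finset.sum_comm]
    refine Finset.sum_congr rfl fun b _ => ?_
    rw [Finset.mul_sum, Finset.sum_mul, Finset.mul_sum]
  have e4 : ∑ a, ∑ b, β * p a * p b * (σ ^ 2 * (∑ k, N a k * N b k) *
        (‖u a‖ * ‖u b‖ - inner ℝ (u a) (u b))) ≤
      ∑ a, ∑ b, β * p a * p b * (‖u a‖ * ‖u b‖ - inner ℝ (u a) (u b)) := by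
    refine Finset.sum_le_sum fun a _ => Finset.sum_le_sum fun b _ => ?_
    refine mul_le_mul_of_nonneg_left ?_ (mul_nonneg (mul_nonneg hβ.le (hp0 a)) (hp0 b))
    have h1 : ∑ k, N a k * N b k ≤ 1 := by
      have h2 : ∑ k, N a k * N b k ≤ ∑ k, (N a k ^ 2 + N b k ^ 2) / 2 :=
        Finset.sum_le_sum fun k _ => by nlinarith [sq_nonneg (N a k - N b k)]
      rw [← Finset.sum_div, Finset.sum_add_distrib] at h2
      linarith [hN1 a, hN1 b]
    have h3 : σ ^ 2 ≤ 1 := (sq_le_one_iff_abs_le_one σ).2 hσ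
    have h4 : 0 ≤ ‖u a‖ * ‖u b‖ - inner ℝ (u a) (u b) := sub_nonneg.2 (real_inner_le_norm _ _)
    have h5 : σ ^ 2 * (∑ k, N a k * N b k) ≤ 1 := by nlinarith [sq_nonneg σ]
    nlinarith
  have e5 : ∑ a, ∑ b, β * p a * p b * (‖u a‖ * ‖u b‖ - inner ℝ (u a) (u b)) +
      ∑ a, (-(β * p a * ‖u a‖ ^ 2) + ∑ b, β * p a * p b * inner ℝ (u a) (u b)) =
      β * ((∑ a, p a * ‖u a‖) ^ 2 - ∑ a, p a * ‖u a‖ ^ 2) := by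
    rw [mul_sub, pow_two, Finset.sum_mul_sum, Finset.mul_sum, Finset.mul_sum,
      ← Finset.sum_add_distrib, ← Finset.sum_sub_distrib]
    refine Finset.sum_congr rfl fun a _ => ?_
    rw [add_comm (-_), ← add_assoc, ← Finset.sum_add_distrib, Finset.mul_sum, ← sub_eq_add_neg]
    congr 1
    · exact Finset.sum_congr rfl fun b _ => by ring
    · ring
  have e6 : (∑ a, p a * ‖u a‖) ^ 2 ≤ ∑ a, p a * ‖u a‖ ^ 2 :=
    Real.pow_arith_mean_le_arith_mean_pow_of_even _ _ _ (fun a _ => hp0 a) hp1 even_two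
  rw [e3]
  calc _ ≤ _ := add_le_add_left e4 _
    _ = _ := e5
    _ ≤ 0 := mul_nonpos_of_nonneg_of_nonpos hβ.le (sub_nonpos.2 e6)

theorem integral_smoothMax_gordonLeft :
    ∫ x, smoothMax σ β δ c ((gordonLeft m u).mulVec x)
        ∂(stdPi ((Fin m × Fin n) ⊕ (Fin m ⊕ Fin n))) =
      ∫ x, smoothMax σ β δ c ((matrixProcess m u).mulVec x) ∂(stdPi (Fin m × Fin n)) := by
  have hc : Continuous fun x : Fin m × Fin n → ℝ => (matrixProcess m u).mulVec x :=
    (matrixProcess m u).mulVecLin.toContinuousLinearMap.continuous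
  rw [← integral_comp_stdPi
    (e := (Sum.inl : Fin m × Fin n → (Fin m × Fin n) ⊕ (Fin m ⊕ Fin n))) Sum.inl_injective
    (G := fun x => smoothMax σ β δ c ((matrixProcess m u).mulVec x))
    (continuous_smoothMax.comp hc)]
  have hx : ∀ x : (Fin m × Fin n) ⊕ (Fin m ⊕ Fin n) → ℝ, (gordonLeft m u).mulVec x =
      (matrixProcess m u).mulVec fun q => x (.inl q) := by
    intro x
    ext i
    simp only [Matrix.mulVec, dotProduct, gordonLeft, Fintype.sum_sum_type, Matrix.of_apply,
      Sum.elim_inl, Sum.elim_inr, zero_mul, Finset.sum_const_zero, add_zero]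
  simp only [hx]

/-- **Gordon's comparison inequality** for the smoothed maximum. -/
theorem integral_smoothMax_gordon_le (hσ : |σ| ≤ 1) (hβ : 0 < β) (hδ : 0 < δ) :
    ∫ x, smoothMax σ β δ c ((matrixProcess m u).mulVec x) ∂(stdPi (Fin m × Fin n)) ≤
      ∫ x, smoothMax σ β δ c ((gordonRight m u).mulVec x)
        ∂(stdPi ((Fin m × Fin n) ⊕ (Fin m ⊕ Fin n))) := by
  have hg : ∀ i (y : (ζ × Fin m) ⊕ ζ → ℝ),
      HasLineDerivAt ℝ (smoothMaxGrad σ β δ c i) (gordonHess u σ β δ c i y) y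
        ((gordonLeft m u * (gordonLeft m u).transpose -
          gordonRight m u * (gordonRight m u).transpose) i) := by
    intro i y
    rw [gordonLeft_sub_gordonRight]
    exact hasLineDerivAt_smoothMaxGrad_gordonCov u hβ hδ i y
  have hD : ∀ y : (ζ × Fin m) ⊕ ζ → ℝ,
      ∑ i, gordonHess u σ β δ c i y ≤ 2 * 0 * smoothMax σ β δ c y := by
    intro y
    rw [mul_zero, zero_mul]
    exact sum_gordonHess_le u hσ hβ hδ y
  have h := integral_comp_le_of_sum_lineDeriv_le (gordonLeft_mul_gordonRight u)
    (expBounded_smoothMax hσ hβ hδ)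
    (expBounded_smoothMaxGrad hβ hδ) (continuous_smoothMaxGrad hδ)
    (expBounded_gordonHess u hβ hδ) (continuous_gordonHess u hδ)
    (hasFDerivAt_smoothMax_pairing hβ hδ) hg hD
  rwa [Real.exp_zero, one_mul, integral_smoothMax_gordonLeft] at h

end Gordon

end

/-! ### Uniform deviation of `‖A z‖` from `b ‖z‖`, from finite to arbitrary sets. -/

section

variable {m n : ℕ}

/-- The matrix with the given family of entries. -/
def toMatrix (x : Fin m × Fin n → ℝ) : Matrix (Fin m) (Fin n) ℝ := Matrix.of fun k j => x (k, j)

theorem toMatrix_toEuclideanLin_apply (x : Fin m × Fin n → ℝ) (v : EuclideanSpace ℝ (Fin n))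
    (k : Fin m) : (toMatrix x).toEuclideanLin v k = ∑ j, x (k, j) * v j := rfl

theorem continuous_toMatrix_toEuclideanLin (v : EuclideanSpace ℝ (Fin n)) :
    Continuous fun x : Fin m × Fin n → ℝ => (toMatrix x).toEuclideanLin v := by
  have h : Continuous fun x : Fin m × Fin n → ℝ => fun k => ∑ j, x (k, j) * v j :=
    continuous_pi fun k =>
      continuous_finsetSum _ fun j _ => (continuous_apply _).mul continuous_const
  exact (PiLp.continuous_toLp 2 fun _ : Fin m => ℝ).comp h

theorem measurePreserving_toLp_stdPi {ι κ : Type*} [Fintype ι] [Fintype κ] {e : κ → ι}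
    (he : Function.Injective e) :
    MeasurePreserving (fun x : ι → ℝ => WithLp.toLp 2 fun j => x (e j)) (stdPi ι)
      (stdGaussian (EuclideanSpace ℝ κ)) := by
  have h2 : MeasurePreserving (WithLp.toLp 2) (stdPi κ) (stdGaussian (EuclideanSpace ℝ κ)) :=
    ⟨by fun_prop, map_pi_eq_stdGaussian⟩
  exact h2.comp (measurePreserving_comp_stdPi he)

theorem integral_toLp_stdPi {ι κ : Type*} [Fintype ι] [Fintype κ] {e : κ → ι}
    (he : Function.Injective e) {s : EuclideanSpace ℝ κ → ℝ}
    (hs : Integrable s (stdGaussian (EuclideanSpace ℝ κ))) :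
    ∫ x, s (WithLp.toLp 2 fun j => x (e j)) ∂(stdPi ι) = ∫ g, s g ∂(stdGaussian _) := by
  have h := measurePreserving_toLp_stdPi (ι := ι) he
  rw [← h.map_eq, integral_map h.measurable.aemeasurable (by rw [h.map_eq]; exact hs.1)]

section Finite

variable {ζ : Type*} (u : ζ → EuclideanSpace ℝ (Fin n)) {σ δ : ℝ} {c : ζ → ℝ}

theorem energy_matrixProcess (a : ζ) (x : Fin m × Fin n → ℝ) :
    energy σ δ c a ((matrixProcess m u).mulVec x) =
      σ * √(‖(toMatrix x).toEuclideanLin (u a)‖ ^ 2 + δ ^ 2) - c a := by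
  simp only [energy, smoothNorm, EuclideanSpace.real_norm_sq_eq, toMatrix_toEuclideanLin_apply]
  simp [matrixProcess, Matrix.mulVec, dotProduct, Fintype.sum_prod_type, mul_comm]

theorem energy_gordonRight (a : ζ) (x : (Fin m × Fin n) ⊕ (Fin m ⊕ Fin n) → ℝ) :
    energy σ δ c a ((gordonRight m u).mulVec x) =
      σ * √((‖u a‖ * ‖WithLp.toLp 2 fun k => x (.inr (.inl k))‖) ^ 2 + δ ^ 2) +
        inner ℝ (WithLp.toLp 2 fun j => x (.inr (.inr j))) (u a) - c a := by
  have h := EuclideanSpace.real_norm_sq_eq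
    (WithLp.toLp 2 fun k => x (.inr (.inl k)) : EuclideanSpace ℝ (Fin m))
  simp only [energy, smoothNorm, mul_pow, PiLp.inner_apply]
  rw [h]
  simp [gordonRight, Matrix.mulVec, dotProduct, Fintype.sum_sum_type, mul_pow, Finset.mul_sum]

theorem abs_sqrt_sq_add_sq_sub_le {r d : ℝ} (hr : 0 ≤ r) (hd : 0 ≤ d) :
    |√(r ^ 2 + d ^ 2) - r| ≤ d := by
  rw [abs_of_nonneg (sub_nonneg.2 (Real.le_sqrt_of_sq_le (by nlinarith [sq_nonneg d]))),
    sub_le_iff_le_add]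
  exact Real.sqrt_le_iff.2 ⟨by positivity, by nlinarith [mul_nonneg hr hd]⟩

variable [Fintype ζ] {R : ℝ≥0} {b t : ℝ} {s : EuclideanSpace ℝ (Fin n) → ℝ}

/-- The gradient in `A` of one energy is the rank-one matrix `σ N (u a)ᵀ` with `‖N‖ ≤ 1`, so its
Frobenius norm is at most `R`. -/
theorem sum_matrixProcess_sq_le (hσ : |σ| ≤ 1) (hδ : 0 < δ) (hR : ∀ a, ‖u a‖ ≤ R) (a : ζ)
    (y : (ζ × Fin m) ⊕ ζ → ℝ) :
    ∑ x, (σ * ∑ k, smoothDir δ a k y * matrixProcess m u (.inl (a, k)) x +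
      matrixProcess m u (.inr a) x) ^ 2 ≤ (R : ℝ) ^ 2 := by
  have h1 : ∑ x, (σ * ∑ k, smoothDir δ a k y * matrixProcess m u (.inl (a, k)) x +
      matrixProcess m u (.inr a) x) ^ 2 = σ ^ 2 * (∑ k, smoothDir δ a k y ^ 2) * ‖u a‖ ^ 2 := by
    rw [EuclideanSpace.real_norm_sq_eq, mul_assoc, Finset.sum_mul_sum, Finset.mul_sum,
      Fintype.sum_prod_type]
    refine Finset.sum_congr rfl fun k _ => ?_
    rw [Finset.mul_sum]
    refine Finset.sum_congr rfl fun j _ => ?_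
    simp [matrixProcess]
    ring
  rw [h1]
  have h2 := sum_smoothDir_sq_le hδ a y
  have h3 : σ ^ 2 ≤ 1 := (sq_le_one_iff_abs_le_one σ).2 hσ
  have h4 : ‖u a‖ ^ 2 ≤ (R : ℝ) ^ 2 := pow_le_pow_left₀ (norm_nonneg _) (hR a) 2
  have h5 : 0 ≤ ∑ k, smoothDir δ a k y ^ 2 := Finset.sum_nonneg fun _ _ => sq_nonneg _
  calc _ ≤ 1 * 1 * (R : ℝ) ^ 2 := by gcongr
    _ = _ := by ring

theorem integrable_norm_stdGaussian (k : ℕ) :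
    Integrable (fun h => ‖h‖) (stdGaussian (EuclideanSpace ℝ (Fin k))) :=
  IsGaussian.integrable_id.norm

/-- Gordon's inequality bounds the mean of the smoothed maximum and concentration its fluctuations;
`s` is any integrable majorant of the process `⟪g, u a⟫`, and `ε` pays for the smoothing. -/
theorem measure_exists_ge_le_aux [Nonempty ζ] (hσ : σ = 1 ∨ σ = -1) (hRpos : 0 < R)
    (hR : ∀ a, ‖u a‖ ≤ R)
    (hb : ∫ h, max (σ * (‖h‖ - b)) 0 ∂(stdGaussian (EuclideanSpace ℝ (Fin m))) ≤ 1 / 2)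
    (hs : Integrable s (stdGaussian _)) (hus : ∀ a g, inner ℝ g (u a) ≤ s g) (ht : 0 ≤ t)
    {ε : ℝ} (hε : 0 < ε) :
    (stdPi (Fin m × Fin n)).real {x | ∃ a, ∫ g, s g ∂(stdGaussian _) + R / 2 + R * t + ε ≤
      σ * (‖(toMatrix x).toEuclideanLin (u a)‖ - b * ‖u a‖)} ≤ Real.exp (-t ^ 2 / 2) := by
  have hσ1 : |σ| = 1 := by rcases hσ with rfl | rfl <;> simp
  -- Three errors share `ε`: smoothing the norm on the decoupled side, the entropy term `log (card
  -- ζ) / β`, and smoothing the norm on the matrix side.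
  set δ : ℝ := ε / 3 with hδd
  have hδ : 0 < δ := by positivity
  have hlog : 0 ≤ Real.log (Fintype.card ζ) :=
    Real.log_nonneg (by exact_mod_cast Fintype.card_pos)
  -- The summand `1` keeps `β` positive when the index set has a single point.
  set β : ℝ := Real.log (Fintype.card ζ) / δ + 1 with hβd
  have hβ : 0 < β := by positivity
  have hlogβ : Real.log (Fintype.card ζ) / β ≤ δ := by
    rw [div_le_iff₀ hβ, hβd, mul_add, mul_div_cancel₀ _ hδ.ne']
    linarith
  set c : ζ → ℝ := fun a => σ * (b * ‖u a‖) with hc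
  have hclose : ∀ r : ℝ, 0 ≤ r → |σ * √(r ^ 2 + δ ^ 2) - σ * r| ≤ δ := fun r hr => by
    rw [← mul_sub, abs_mul, hσ1, one_mul]
    exact abs_sqrt_sq_add_sq_sub_le hr hδ.le
  have hmean : ∫ x, smoothMax σ β δ c ((matrixProcess m u).mulVec x) ∂(stdPi (Fin m × Fin n)) ≤
      ∫ g, s g ∂(stdGaussian _) + R / 2 + 2 * δ := by
    refine (integral_smoothMax_gordon_le u hσ1.le hβ hδ).trans ?_
    set e1 : Fin m → (Fin m × Fin n) ⊕ (Fin m ⊕ Fin n) := fun k => .inr (.inl k) with he1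
    set e2 : Fin n → (Fin m × Fin n) ⊕ (Fin m ⊕ Fin n) := fun k => .inr (.inr k) with he2
    have he1i : Function.Injective e1 := Sum.inr_injective.comp Sum.inl_injective
    have he2i : Function.Injective e2 := Sum.inr_injective.comp Sum.inr_injective
    have hi1 : Integrable (fun h => max (σ * (‖h‖ - b)) 0)
        (stdGaussian (EuclideanSpace ℝ (Fin m))) :=
      ((((integrable_norm_stdGaussian m).sub (integrable_const b)).const_mul σ).sup
        (integrable_const 0))
    have hi1' := (measurePreserving_toLp_stdPi (ι := (Fin m × Fin n) ⊕ (Fin m ⊕ Fin n))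
      he1i).integrable_comp_of_integrable hi1
    have hi2' := (measurePreserving_toLp_stdPi (ι := (Fin m × Fin n) ⊕ (Fin m ⊕ Fin n))
      he2i).integrable_comp_of_integrable hs
    simp only [Function.comp_def] at hi1' hi2'
    have hint : ∫ x, (R * max (σ * (‖WithLp.toLp 2 fun j => x (e1 j)‖ - b)) 0 +
        s (WithLp.toLp 2 fun j => x (e2 j)) + 2 * δ)
          ∂(stdPi ((Fin m × Fin n) ⊕ (Fin m ⊕ Fin n))) =
        R * (∫ h, max (σ * (‖h‖ - b)) 0 ∂(stdGaussian (EuclideanSpace ℝ (Fin m)))) +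
          ∫ g, s g ∂(stdGaussian _) + 2 * δ := by
      have hi12 : Integrable (fun x => R * max (σ * (‖WithLp.toLp 2 fun j => x (e1 j)‖ - b)) 0 +
          s (WithLp.toLp 2 fun j => x (e2 j))) (stdPi ((Fin m × Fin n) ⊕ (Fin m ⊕ Fin n))) :=
        (hi1'.const_mul _).add hi2'
      rw [integral_add hi12 (integrable_const _), integral_add (hi1'.const_mul _) hi2', integral_const_mul,
        integral_toLp_stdPi he1i hi1, integral_toLp_stdPi he2i hs]
      simp
    refine (integral_mono (ExpBounded.integrable_of_continuous
      ((expBounded_smoothMax hσ1.le hβ hδ).comp_clm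
        (gordonRight m u).mulVecLin.toContinuousLinearMap)
      (continuous_smoothMax.comp
        (gordonRight m u).mulVecLin.toContinuousLinearMap.continuous))
      (((hi1'.const_mul _).add hi2').add (integrable_const (2 * δ))) fun x => ?_).trans
      (hint.le.trans ?_)
    · refine (smoothMax_le hβ fun a => ?_).trans (add_le_add_right hlogβ
        (R * max (σ * (‖WithLp.toLp 2 fun j => x (e1 j)‖ - b)) 0 +
          s (WithLp.toLp 2 fun j => x (e2 j)) + δ) |>.trans_eq ?_)
      · have h1 := energy_gordonRight (σ := σ) (δ := δ) (c := c) u a x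
        refine h1.trans_le ?_
        have h2 := abs_le.1 (hclose (‖u a‖ * ‖WithLp.toLp 2 fun j => x (e1 j)‖) (by positivity))
        have h3 := hus a (WithLp.toLp 2 fun j => x (e2 j))
        -- The norms `‖u a‖` vary up to `R`, so only the positive part of the radial deviation can
        -- be bounded uniformly; hence the form of `hb`.
        have h4 : ‖u a‖ * (σ * (‖WithLp.toLp 2 fun j => x (e1 j)‖ - b)) ≤
            R * max (σ * (‖WithLp.toLp 2 fun j => x (e1 j)‖ - b)) 0 :=
          (mul_le_mul_of_nonneg_left (le_max_left _ _) (norm_nonneg _)).trans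
            (mul_le_mul_of_nonneg_right (hR a) (le_max_right _ _))
        simp only [he1, he2, hc] at h2 h3 h4 ⊢
        linarith [h2.2]
      · simp only [Pi.add_apply]
        ring
    · have := mul_le_mul_of_nonneg_left hb R.2
      simp only [NNReal.val_eq_coe] at this
      linarith
  have hconc := measure_smoothMax_ge_le (c := c) hβ hδ (matrixProcess m u)
    (sum_matrixProcess_sq_le u hσ1.le hδ hR) (mul_nonneg R.2 ht)
  have hRne : (R : ℝ) ≠ 0 := by exact_mod_cast hRpos.ne'
  have hexp : -((R : ℝ) * t) ^ 2 / (2 * R ^ 2) = -t ^ 2 / 2 := by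
    field_simp
  simp only [NNReal.val_eq_coe] at hconc
  rw [hexp] at hconc
  refine (measureReal_mono ?_).trans hconc
  rintro x ⟨a, ha⟩
  refine le_trans ?_ (energy_le_smoothMax hβ a _)
  rw [energy_matrixProcess]
  have h2 := abs_le.1 (hclose ‖(toMatrix x).toEuclideanLin (u a)‖ (norm_nonneg _))
  simp only [hc]
  linarith [h2.1]

/-- The slack is removed by spending `ε = R (t - r)` at a level `r < t` and letting `r` tend to `t`;
at `t = 0` the bound is trivial. -/
theorem measure_exists_ge_le [Nonempty ζ] (hσ : σ = 1 ∨ σ = -1) (hRpos : 0 < R)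
    (hR : ∀ a, ‖u a‖ ≤ R)
    (hb : ∫ h, max (σ * (‖h‖ - b)) 0 ∂(stdGaussian (EuclideanSpace ℝ (Fin m))) ≤ 1 / 2)
    (hs : Integrable s (stdGaussian _)) (hus : ∀ a g, inner ℝ g (u a) ≤ s g) (ht : 0 ≤ t) :
    (stdPi (Fin m × Fin n)).real {x | ∃ a, ∫ g, s g ∂(stdGaussian _) + R / 2 + R * t ≤
      σ * (‖(toMatrix x).toEuclideanLin (u a)‖ - b * ‖u a‖)} ≤ Real.exp (-t ^ 2 / 2) := by
  rcases ht.eq_or_lt with rfl | ht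
  · simp
  have hlim : Filter.Tendsto (fun r : ℝ => Real.exp (-r ^ 2 / 2)) (nhdsWithin t (Set.Iio t))
      (nhds (Real.exp (-t ^ 2 / 2))) :=
    ((by fun_prop : Continuous fun r : ℝ => Real.exp (-r ^ 2 / 2)).tendsto t).mono_left
      nhdsWithin_le_nhds
  refine ge_of_tendsto hlim ?_
  filter_upwards [Ioo_mem_nhdsLT ht] with r hr
  have hRr : (0 : ℝ) < R * (t - r) := mul_pos (by exact_mod_cast hRpos) (sub_pos.2 hr.2)
  have h := measure_exists_ge_le_aux u hσ hRpos hR hb hs hus hr.1.le hRr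
  refine le_of_eq_of_le ?_ h
  congr 1
  ext x
  simp only [Set.mem_ofPred_eq]
  refine exists_congr fun a => ?_
  rw [show ∫ g, s g ∂(stdGaussian _) + (R : ℝ) / 2 + R * r + R * (t - r) =
    ∫ g, s g ∂(stdGaussian _) + (R : ℝ) / 2 + R * t by ring]

end Finite

/-- If finite unions of a family of open sets have measure at most `r`, so has the whole union. -/
theorem measure_biUnion_le_of_finite {X ι : Type*} [TopologicalSpace X] [MeasurableSpace X]
    (μ : Measure X) [IsFiniteMeasure μ] [μ.InnerRegularCompactLTTop] [OpensMeasurableSpace X]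
    {Z : Set ι} {U : ι → Set X}
    (hU : ∀ z ∈ Z, IsOpen (U z)) {r : ℝ}
    (h : ∀ F : Finset ι, ↑F ⊆ Z → μ.real (⋃ z ∈ F, U z) ≤ r) : μ.real (⋃ z ∈ Z, U z) ≤ r := by
  have hr : 0 ≤ r := measureReal_nonneg.trans (h ∅ (by simp))
  rw [measureReal_def]
  refine ENNReal.toReal_le_of_le_ofReal hr ?_
  rw [(isOpen_biUnion hU).measurableSet.measure_eq_iSup_isCompact_of_ne_top (measure_ne_top _ _)]
  refine iSup₂_le fun K hK => iSup_le fun hKc => ?_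
  obtain ⟨t, htZ, htf, htK⟩ := hKc.elim_finite_subcover_image hU hK
  have h1 := h htf.toFinset (by simpa using htZ)
  rw [measureReal_def] at h1
  refine (measure_mono (htK.trans ?_)).trans
    ((ENNReal.le_ofReal_iff_toReal_le (measure_ne_top _ _) hr).2 h1)
  simp

/-- Tail bound for `sup_{z ∈ Z} σ (‖A z‖ - b ‖z‖)`, `A` a standard Gaussian matrix. -/
theorem measure_exists_mem_gt_le {σ : ℝ} (hσ : σ = 1 ∨ σ = -1) {R : ℝ≥0} (hRpos : 0 < R)
    {Z : Set (EuclideanSpace ℝ (Fin n))} (hR : ∀ z ∈ Z, ‖z‖ ≤ R) {b t : ℝ}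
    (hb : ∫ h, max (σ * (‖h‖ - b)) 0 ∂(stdGaussian (EuclideanSpace ℝ (Fin m))) ≤ 1 / 2)
    {s : EuclideanSpace ℝ (Fin n) → ℝ}
    (hs : Integrable s (stdGaussian _)) (hus : ∀ z ∈ Z, ∀ g, inner ℝ g z ≤ s g) (ht : 0 ≤ t) :
    (stdPi (Fin m × Fin n)).real {x | ∃ z ∈ Z, ∫ g, s g ∂(stdGaussian _) + R / 2 + R * t <
      σ * (‖(toMatrix x).toEuclideanLin z‖ - b * ‖z‖)} ≤ Real.exp (-t ^ 2 / 2) := by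
  have hset : {x : Fin m × Fin n → ℝ | ∃ z ∈ Z, ∫ g, s g ∂(stdGaussian _) + R / 2 + R * t <
      σ * (‖(toMatrix x).toEuclideanLin z‖ - b * ‖z‖)} =
      ⋃ z ∈ Z, {x | ∫ g, s g ∂(stdGaussian _) + R / 2 + R * t <
        σ * (‖(toMatrix x).toEuclideanLin z‖ - b * ‖z‖)} := by
    ext x
    simp
  rw [hset]
  -- The strict inequality makes each event open, which is what the reduction to finite subfamilies
  -- requires.
  have hopen : ∀ z ∈ Z, IsOpen {x : Fin m × Fin n → ℝ |
      ∫ g, s g ∂(stdGaussian (EuclideanSpace ℝ (Fin n))) + R / 2 + R * t <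
        σ * (‖(toMatrix x).toEuclideanLin z‖ - b * ‖z‖)} := by
    intro z _
    have hc : Continuous fun x : Fin m × Fin n → ℝ =>
        σ * (‖(toMatrix x).toEuclideanLin z‖ - b * ‖z‖) :=
      ((continuous_toMatrix_toEuclideanLin z).norm.sub continuous_const).const_mul σ
    exact isOpen_lt continuous_const hc
  refine measure_biUnion_le_of_finite _ hopen fun F hF => ?_
  rcases F.eq_empty_or_nonempty with rfl | hne
  · simpa using (Real.exp_pos _).le
  · have : Nonempty F := hne.to_subtype
    have h := measure_exists_ge_le (m := m) (fun a : F => (a : EuclideanSpace ℝ (Fin n))) hσ hRpos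
      (fun a => hR a.1 (hF a.2)) hb hs (fun a => hus a.1 (hF a.2)) ht
    refine le_trans (measureReal_mono ?_ (measure_ne_top _ _)) h
    intro x hx
    simp only [Set.mem_iUnion, Set.mem_ofPred_eq] at hx ⊢
    obtain ⟨z, hz, hxz⟩ := hx
    exact ⟨⟨z, hz⟩, hxz.le⟩

end

/-! ### The noise term `⟪Aᵀ w, z⟫`. -/

section

variable {m n : ℕ}

/-- Compare characteristic functions: `⟪Aᵀ w, t⟫` is the pairing of the entries of `A` with the
rank-one array `w tᵀ`, of norm `‖w‖ ‖t‖ = ‖t‖`. -/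
theorem map_toMatrix_transpose_stdPi {w : EuclideanSpace ℝ (Fin m)} (hw : ‖w‖ = 1) :
    MeasurePreserving (fun x => (toMatrix x).transpose.toEuclideanLin w) (stdPi (Fin m × Fin n))
      (stdGaussian (EuclideanSpace ℝ (Fin n))) := by
  have hc : Continuous fun x : Fin m × Fin n → ℝ => (toMatrix x).transpose.toEuclideanLin w := by
    have h : Continuous fun x : Fin m × Fin n → ℝ => fun j => ∑ k, x (k, j) * w k :=
      continuous_pi fun j =>
        continuous_finsetSum _ fun k _ => (continuous_apply _).mul continuous_const
    exact (PiLp.continuous_toLp 2 fun _ : Fin n => ℝ).comp h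
  refine ⟨hc.measurable, ?_⟩
  have : IsProbabilityMeasure ((stdPi (Fin m × Fin n)).map
      fun x => (toMatrix x).transpose.toEuclideanLin w) :=
    Measure.isProbabilityMeasure_map hc.measurable.aemeasurable
  refine Measure.ext_of_charFun (funext fun t => ?_)
  set S : EuclideanSpace ℝ (Fin m × Fin n) := WithLp.toLp 2 fun q => w q.1 * t q.2 with hS
  have hSn : ‖S‖ ^ 2 = ‖t‖ ^ 2 := by
    have h1 : ‖S‖ ^ 2 = ‖w‖ ^ 2 * ‖t‖ ^ 2 := by
      simp only [EuclideanSpace.real_norm_sq_eq, hS, Fintype.sum_prod_type, mul_pow,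
        Finset.sum_mul_sum]
    rw [h1, hw, one_pow, one_mul]
  have h2 : ∀ x : Fin m × Fin n → ℝ,
      inner ℝ ((toMatrix x).transpose.toEuclideanLin w) t = inner ℝ (WithLp.toLp 2 x) S := by
    intro x
    have h3 : ∀ j, (toMatrix x).transpose.toEuclideanLin w j = ∑ k, x (k, j) * w k := fun _ => rfl
    simp only [PiLp.inner_apply, h3, hS, Fintype.sum_prod_type, RCLike.inner_apply, conj_trivial]
    rw [Finset.sum_comm]
    refine Finset.sum_congr rfl fun j _ => ?_
    rw [Finset.mul_sum]
    exact Finset.sum_congr rfl fun k _ => by ring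
  have hcf : charFun (stdGaussian (EuclideanSpace ℝ (Fin n))) t =
      charFun (stdGaussian (EuclideanSpace ℝ (Fin m × Fin n))) S := by
    rw [charFun_stdGaussian, charFun_stdGaussian, ← Complex.ofReal_pow, ← Complex.ofReal_pow, hSn]
  rw [hcf, ← map_pi_eq_stdGaussian, charFun_apply, charFun_apply,
    integral_map hc.measurable.aemeasurable (by fun_prop), integral_map (by fun_prop)
      (by fun_prop)]
  simp only [h2]

section Finite

variable {ζ : Type*} [Fintype ζ] [Nonempty ζ] (u : ζ → EuclideanSpace ℝ (Fin n)) {R : ℝ≥0} {t : ℝ}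
  {s : EuclideanSpace ℝ (Fin n) → ℝ}

/-- The smoothed maximum is reused with empty norm blocks (`Fin 0`) and `σ = 0`, which leaves only
the linear energies. No comparison is needed, as `s` already dominates them pointwise. -/
theorem stdGaussian_exists_ge_le_aux (hRpos : 0 < R)
    (hR : ∀ a, ‖u a‖ ≤ R) (hs : Integrable s (stdGaussian _)) (hus : ∀ a g, inner ℝ g (u a) ≤ s g)
    (ht : 0 ≤ t) {ε : ℝ} (hε : 0 < ε) :
    (stdPi (Fin n)).real {x | ∃ a, ∫ g, s g ∂(stdGaussian _) + R * t + ε ≤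
      inner ℝ (WithLp.toLp 2 x) (u a)} ≤ Real.exp (-t ^ 2 / 2) := by
  have hlog : 0 ≤ Real.log (Fintype.card ζ) :=
    Real.log_nonneg (by exact_mod_cast Fintype.card_pos)
  set β : ℝ := Real.log (Fintype.card ζ) / ε + 1 with hβd
  have hβ : 0 < β := by positivity
  have hlogβ : Real.log (Fintype.card ζ) / β ≤ ε := by
    rw [div_le_iff₀ hβ, hβd, mul_add, mul_div_cancel₀ _ hε.ne']
    linarith
  set B : Matrix ((ζ × Fin 0) ⊕ ζ) (Fin n) ℝ :=
    Matrix.of (Sum.elim (fun _ => 0) fun a j => u a j) with hB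
  have henergy : ∀ a (x : Fin n → ℝ), energy 0 1 (fun _ => 0) a (B.mulVec x) =
      inner ℝ (WithLp.toLp 2 x) (u a) := by
    intro a x
    simp [energy, hB, Matrix.mulVec, dotProduct, PiLp.inner_apply]
  have hmean : ∫ x, smoothMax 0 β 1 (fun _ => 0) (B.mulVec x) ∂(stdPi (Fin n)) ≤
      ∫ g, s g ∂(stdGaussian _) + ε := by
    have hi := (measurePreserving_toLp_stdPi (ι := Fin n) (e := id)
      Function.injective_id).integrable_comp_of_integrable hs
    have hi2 := integral_toLp_stdPi (ι := Fin n) (e := id) Function.injective_id hs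
    simp only [Function.comp_def, id_eq] at hi hi2
    have hint : ∫ x, (s (WithLp.toLp 2 x) + ε) ∂(stdPi (Fin n)) =
        ∫ g, s g ∂(stdGaussian _) + ε := by
      rw [integral_add hi (integrable_const _), hi2]
      simp
    refine (integral_mono (ExpBounded.integrable_of_continuous
      ((expBounded_smoothMax (by simp) hβ one_pos).comp_clm
        B.mulVecLin.toContinuousLinearMap)
      (continuous_smoothMax.comp B.mulVecLin.toContinuousLinearMap.continuous))
      (hi.add (integrable_const ε)) fun x => ?_).trans hint.le
    refine (smoothMax_le hβ fun a => ?_).trans (add_le_add_right hlogβ (s (WithLp.toLp 2 x)))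
    exact (henergy a x).trans_le (hus a _)
  have hconc := measure_smoothMax_ge_le (σ := 0) (c := fun _ => 0) hβ one_pos B (R := R)
    (fun a y => by
      simp only [zero_mul, zero_add, hB, Matrix.of_apply, Sum.elim_inr,
        ← EuclideanSpace.real_norm_sq_eq]
      exact pow_le_pow_left₀ (norm_nonneg _) (hR a) 2) (mul_nonneg R.2 ht)
  have hRne : (R : ℝ) ≠ 0 := by exact_mod_cast hRpos.ne'
  have hexp : -((R : ℝ) * t) ^ 2 / (2 * R ^ 2) = -t ^ 2 / 2 := by
    field_simp
  simp only [NNReal.val_eq_coe] at hconc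
  rw [hexp] at hconc
  refine (measureReal_mono ?_).trans hconc
  rintro x ⟨a, ha⟩
  refine le_trans ?_ (energy_le_smoothMax hβ a _)
  rw [henergy]
  linarith

end Finite

/-- Concentration of the supremum of a Gaussian process indexed by `Z`. -/
theorem stdGaussian_exists_mem_gt_le {R : ℝ≥0} (hRpos : 0 < R)
    {Z : Set (EuclideanSpace ℝ (Fin n))} (hR : ∀ z ∈ Z, ‖z‖ ≤ R) {t : ℝ}
    {s : EuclideanSpace ℝ (Fin n) → ℝ}
    (hs : Integrable s (stdGaussian _)) (hus : ∀ z ∈ Z, ∀ g, inner ℝ g z ≤ s g) (ht : 0 ≤ t) :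
    (stdPi (Fin n)).real {x | ∃ z ∈ Z, ∫ g, s g ∂(stdGaussian _) + R * t <
      inner ℝ (WithLp.toLp 2 x) z} ≤ Real.exp (-t ^ 2 / 2) := by
  -- A slack `1 / (k + 1)` is built into the index. A finite subfamily has a largest `k`, which
  -- provides a common `ε`.
  set U : EuclideanSpace ℝ (Fin n) × ℕ → Set (Fin n → ℝ) := fun q =>
    {x | ∫ g, s g ∂(stdGaussian _) + R * t + 1 / ((q.2 : ℝ) + 1) <
      inner ℝ (WithLp.toLp 2 x) q.1} with hU
  have hset : {x : Fin n → ℝ | ∃ z ∈ Z, ∫ g, s g ∂(stdGaussian _) + R * t <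
      inner ℝ (WithLp.toLp 2 x) z} = ⋃ q ∈ {q | q.1 ∈ Z}, U q := by
    ext x
    simp only [Set.mem_ofPred_eq, Set.mem_iUnion, hU, Prod.exists, exists_prop]
    constructor
    · rintro ⟨z, hz, h⟩
      obtain ⟨k, hk⟩ := exists_nat_one_div_lt (sub_pos.2 h)
      exact ⟨z, k, hz, by linarith⟩
    · rintro ⟨z, k, hz, h⟩
      have : (0 : ℝ) < 1 / ((k : ℝ) + 1) := by positivity
      exact ⟨z, hz, by linarith⟩
  have hopen : ∀ q ∈ {q : EuclideanSpace ℝ (Fin n) × ℕ | q.1 ∈ Z}, IsOpen (U q) := by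
    intro q _
    have hc : Continuous fun x : Fin n → ℝ => (inner ℝ (WithLp.toLp 2 x) q.1 : ℝ) := by fun_prop
    exact isOpen_lt continuous_const hc
  rw [hset]
  refine measure_biUnion_le_of_finite _ hopen fun F hF => ?_
  rcases F.eq_empty_or_nonempty with rfl | hne
  · simpa using (Real.exp_pos _).le
  · have : Nonempty F := hne.to_subtype
    obtain ⟨N, hN⟩ : ∃ N : ℕ, ∀ q ∈ F, q.2 ≤ N :=
      ⟨F.sup Prod.snd, fun q hq => Finset.le_sup (f := Prod.snd) hq⟩
    have hε : (0 : ℝ) < 1 / ((N : ℝ) + 1) := by positivity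
    have h := stdGaussian_exists_ge_le_aux (fun a : F => a.1.1) hRpos
      (fun a => hR a.1.1 (hF a.2)) hs (fun a => hus a.1.1 (hF a.2)) ht hε
    refine le_trans (measureReal_mono ?_ (measure_ne_top _ _)) h
    intro x hx
    simp only [Set.mem_iUnion, Set.mem_ofPred_eq, hU] at hx ⊢
    obtain ⟨q, hq, hxq⟩ := hx
    refine ⟨⟨q, hq⟩, le_trans ?_ hxq.le⟩
    have : 1 / ((N : ℝ) + 1) ≤ 1 / ((q.2 : ℝ) + 1) := by
      have := hN q hq
      gcongr
    simpa using this

/-- Tail bound for `sup_{z ∈ Z} ⟪w, A z⟫`, `A` a standard Gaussian matrix and `w` a unit vector. -/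
theorem measure_exists_mem_inner_gt_le {w : EuclideanSpace ℝ (Fin m)} (hw : ‖w‖ = 1) {R : ℝ≥0}
    (hRpos : 0 < R) {Z : Set (EuclideanSpace ℝ (Fin n))} (hR : ∀ z ∈ Z, ‖z‖ ≤ R) {t : ℝ}
    {s : EuclideanSpace ℝ (Fin n) → ℝ}
    (hs : Integrable s (stdGaussian _)) (hus : ∀ z ∈ Z, ∀ g, inner ℝ g z ≤ s g) (ht : 0 ≤ t) :
    (stdPi (Fin m × Fin n)).real {x | ∃ z ∈ Z, ∫ g, s g ∂(stdGaussian _) + R * t <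
      inner ℝ ((toMatrix x).transpose.toEuclideanLin w) z} ≤ Real.exp (-t ^ 2 / 2) := by
  have hmeas : MeasurableSet {g : EuclideanSpace ℝ (Fin n) | ∃ z ∈ Z,
      ∫ g, s g ∂(stdGaussian _) + R * t < inner ℝ g z} := by
    have : {g : EuclideanSpace ℝ (Fin n) | ∃ z ∈ Z,
      ∫ g, s g ∂(stdGaussian _) + R * t < inner ℝ g z} = ⋃ z ∈ Z,
        {g | ∫ g, s g ∂(stdGaussian _) + R * t < inner ℝ g z} := by
      ext
      simp
    rw [this]
    exact (isOpen_biUnion fun z _ => isOpen_lt continuous_const (by fun_prop)).measurableSet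
  have h1 := (map_toMatrix_transpose_stdPi (n := n) hw).measureReal_preimage
    hmeas.nullMeasurableSet
  have h2 := (measurePreserving_toLp_stdPi (ι := Fin n) (e := id)
    Function.injective_id).measureReal_preimage hmeas.nullMeasurableSet
  simp only [Set.preimage_ofPred_eq, id_eq] at h1 h2
  rw [h1, ← h2]
  exact stdGaussian_exists_mem_gt_le hRpos hR hs hus ht

end

/-! ### The function `φ` and the norm of a Gaussian vector. -/

section

theorem phi_pos {t : ℝ} (ht : 0 < t) : 0 < phi t :=
  div_pos (mul_pos (by positivity) (Real.Gamma_pos_of_pos (by linarith)))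
    (Real.Gamma_pos_of_pos (by linarith))

theorem phi_mul_phi_add_one {t : ℝ} (ht : 0 < t) : phi t * phi (t + 1) = t := by
  have h1 : Real.Gamma (t / 2) ≠ 0 := (Real.Gamma_pos_of_pos (by linarith)).ne'
  have h2 : Real.Gamma ((t + 1) / 2) ≠ 0 := (Real.Gamma_pos_of_pos (by linarith)).ne'
  have h3 : Real.Gamma ((t + 1 + 1) / 2) = t / 2 * Real.Gamma (t / 2) := by
    rw [← Real.Gamma_add_one (by linarith)]
    congr 1
    ring
  have h4 : √2 * √2 = (2 : ℝ) := Real.mul_self_sqrt (by norm_num)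
  rw [phi, phi, h3]
  field_simp
  linear_combination h4

/-- Midpoint log-convexity of `Γ` on `t/2`, `(t+1)/2`, `(t+2)/2`. Together with `φ(t) φ(t+1) = t` it
yields `t - 1 ≤ φ(t)² ≤ t`. -/
theorem phi_le_phi_add_one {t : ℝ} (ht : 0 < t) : phi t ≤ phi (t + 1) := by
  have h1 := Real.Gamma_pos_of_pos (show 0 < t / 2 by linarith)
  have h2 := Real.Gamma_pos_of_pos (show 0 < (t + 1) / 2 by linarith)
  have h3 := Real.Gamma_pos_of_pos (show 0 < (t + 1 + 1) / 2 by linarith)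
  have h := Real.Gamma_mul_add_mul_le_rpow_Gamma_mul_rpow_Gamma
    (show 0 < t / 2 by linarith) (show 0 < (t + 1 + 1) / 2 by linarith)
    (show (0 : ℝ) < 1 / 2 by norm_num) (show (0 : ℝ) < 1 / 2 by norm_num) (by norm_num)
  rw [show 1 / 2 * (t / 2) + 1 / 2 * ((t + 1 + 1) / 2) = (t + 1) / 2 by ring,
    ← Real.mul_rpow h1.le h3.le, ← Real.sqrt_eq_rpow, Real.le_sqrt h2.le (by positivity)] at h
  rw [phi, phi, div_le_div_iff₀ h1 h2]
  have : (0 : ℝ) ≤ √2 := by positivity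
  nlinarith

theorem phi_sq_le {t : ℝ} (ht : 0 ≤ t) : phi t ^ 2 ≤ t := by
  rcases ht.eq_or_lt with rfl | ht
  · simp [phi_zero]
  · have h := mul_le_mul_of_nonneg_left (phi_le_phi_add_one ht) (phi_pos ht).le
    rwa [phi_mul_phi_add_one ht, ← pow_two] at h

theorem sub_one_le_phi_sq {t : ℝ} (ht : 1 < t) : t - 1 ≤ phi t ^ 2 := by
  have h0 : 0 < t - 1 := sub_pos.2 ht
  have h := phi_le_phi_add_one h0
  have h2 := phi_mul_phi_add_one h0
  rw [sub_add_cancel] at h h2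
  nlinarith [phi_pos (zero_lt_one.trans ht)]

/-- Rewriting `φ(t)` as `t / φ(t+1)` avoids the pole of `Γ` at `0`. -/
theorem continuousOn_phi : ContinuousOn phi (Set.Ici 0) := by
  have hG : ∀ x : ℝ, 0 < x → ContinuousAt Real.Gamma x := fun x hx =>
    (Real.differentiableAt_Gamma fun k => by
      have : (0 : ℝ) ≤ k := Nat.cast_nonneg k
      linarith).continuousAt
  have h1 : ContinuousOn (fun t => t / phi (t + 1)) (Set.Ici 0) := by
    refine continuousOn_id.div (fun t ht => ContinuousAt.continuousWithinAt ?_)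
      fun t (ht : 0 ≤ t) => (phi_pos (by linarith)).ne'
    have ht' : (0 : ℝ) ≤ t := ht
    unfold phi
    refine ContinuousAt.div (continuousAt_const.mul ?_) ?_
      (Real.Gamma_pos_of_pos (by linarith)).ne'
    · exact ContinuousAt.comp (f := fun t : ℝ => (t + 1 + 1) / 2) (hG _ (by linarith))
        (by fun_prop)
    · exact ContinuousAt.comp (f := fun t : ℝ => (t + 1) / 2) (hG _ (by linarith)) (by fun_prop)
  refine h1.congr fun t ht => ?_
  rcases (show (0 : ℝ) ≤ t from ht).eq_or_lt with rfl | ht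
  · simp [phi_zero]
  · rw [eq_div_iff (phi_pos (by linarith)).ne', phi_mul_phi_add_one ht]

theorem exists_phi_eq {r : ℝ} (hr : 0 ≤ r) : ∃ t ∈ Set.Ici 0, phi t = r := by
  rcases hr.eq_or_lt with rfl | hr
  · exact ⟨0, Set.self_mem_Ici, phi_zero⟩
  have hT : 0 ≤ r ^ 2 + 1 := by positivity
  have h1 : r ≤ phi (r ^ 2 + 1) := by
    have h := sub_one_le_phi_sq (t := r ^ 2 + 1) (by nlinarith)
    exact le_of_sq_le_sq (by linarith) (phi_pos (by positivity)).le
  obtain ⟨t, ht, htr⟩ := intermediate_value_Icc hT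
    (continuousOn_phi.mono Set.Icc_subset_Ici_self) ⟨by rw [phi_zero]; exact hr.le, h1⟩
  exact ⟨t, ht.1, htr⟩

/-- The Gaussian expectation of a radial function as a one-dimensional integral. -/
theorem exists_integral_norm_stdGaussian {m : ℕ} (hm : m ≠ 0) : ∃ c : ℝ, ∀ f : ℝ → ℝ,
    ∫ h, f ‖h‖ ∂(stdGaussian (EuclideanSpace ℝ (Fin m))) =
      c * ∫ y in Set.Ioi (0 : ℝ), y ^ (m - 1) * (f y * Real.exp (-(1 / 2) * y ^ (2 : ℝ))) := by
  have : Nonempty (Fin m) := ⟨⟨0, Nat.pos_of_ne_zero hm⟩⟩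
  refine ⟨(√(2 * Real.pi))⁻¹ ^ m * (m * (volume : Measure (EuclideanSpace ℝ (Fin m))).real
    (Metric.ball 0 1)), fun f => ?_⟩
  have h1 := MeasurePreserving.integral_comp (μ := stdPi (Fin m))
    (ν := stdGaussian (EuclideanSpace ℝ (Fin m))) (f := WithLp.toLp 2)
    ⟨by fun_prop, map_pi_eq_stdGaussian⟩
    (MeasurableEquiv.toLp 2 (Fin m → ℝ)).measurableEmbedding (fun h => f ‖h‖)
  rw [← h1, integral_stdPi]
  have h2 : ∀ x : Fin m → ℝ, f ‖WithLp.toLp 2 x‖ * stdDensity x = (√(2 * Real.pi))⁻¹ ^ m *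
      (fun y : ℝ => f y * Real.exp (-(1 / 2) * y ^ (2 : ℝ))) ‖WithLp.toLp 2 x‖ := by
    intro x
    simp only [stdDensity_eq, Real.rpow_two, EuclideanSpace.real_norm_sq_eq, Fintype.card_fin]
    rw [show -(∑ i, x i ^ 2) / 2 = -(1 / 2) * ∑ i, x i ^ 2 by ring]
    ring
  simp only [h2]
  rw [integral_const_mul]
  have h3 := (PiLp.volume_preserving_toLp (Fin m)).integral_comp
    (MeasurableEquiv.toLp 2 (Fin m → ℝ)).measurableEmbedding
    (fun h => (fun y : ℝ => f y * Real.exp (-(1 / 2) * y ^ (2 : ℝ))) ‖h‖)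
  have h4 := integral_fun_norm_addHaar (volume : Measure (EuclideanSpace ℝ (Fin m)))
    (fun y : ℝ => f y * Real.exp (-(1 / 2) * y ^ (2 : ℝ)))
  rw [h3, h4]
  simp only [finrank_euclideanSpace, Fintype.card_fin, smul_eq_mul, nsmul_eq_mul]
  ring

theorem integral_norm_pow_stdGaussian {m : ℕ} (hm : m ≠ 0) (k : ℕ) :
    ∫ h, ‖h‖ ^ k ∂(stdGaussian (EuclideanSpace ℝ (Fin m))) =
      √2 ^ k * Real.Gamma (((m : ℝ) + k) / 2) / Real.Gamma ((m : ℝ) / 2) := by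
  obtain ⟨c, hc⟩ := exists_integral_norm_stdGaussian hm
  have hm1 : (1 : ℝ) ≤ m := by exact_mod_cast Nat.one_le_iff_ne_zero.2 hm
  have hK : ∀ k : ℕ, ∫ y in Set.Ioi (0 : ℝ), y ^ (m - 1) *
      (y ^ k * Real.exp (-(1 / 2) * y ^ (2 : ℝ))) =
      √2 ^ m * √2 ^ k * (1 / 2) * Real.Gamma (((m : ℝ) + k) / 2) := by
    intro k
    have h := integral_rpow_mul_exp_neg_mul_rpow (p := 2) (q := (m : ℝ) - 1 + k) (b := 1 / 2)
      (by norm_num) (by linarith [(Nat.cast_nonneg k : (0 : ℝ) ≤ k)]) (by norm_num)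
    have e1 : (1 / 2 : ℝ) ^ (-((m : ℝ) - 1 + k + 1) / 2) = √2 ^ m * √2 ^ k := by
      rw [← pow_add, Real.sqrt_eq_rpow, ← Real.rpow_natCast, ← Real.rpow_mul (by norm_num),
        one_div, Real.inv_rpow (by norm_num), ← Real.rpow_neg (by norm_num)]
      congr 1
      push_cast
      ring
    rw [e1, show ((m : ℝ) - 1 + k + 1) / 2 = ((m : ℝ) + k) / 2 by ring] at h
    rw [← h]
    refine setIntegral_congr_fun measurableSet_Ioi fun y (hy : 0 < y) => ?_
    rw [Real.rpow_add hy, Real.rpow_natCast, ← mul_assoc]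
    congr 2
    rw [← Real.rpow_natCast, Nat.cast_sub (Nat.one_le_iff_ne_zero.2 hm)]
    simp
  -- Total mass `1` determines the polar-coordinate constant `c`, so the volume of the ball is never
  -- computed.
  have h0 := hc fun _ => 1
  have hk := hc fun y => y ^ k
  have hK0 := hK 0
  simp only [pow_zero, mul_one, Nat.cast_zero, add_zero, one_mul] at hK0
  simp only [integral_const, probReal_univ, smul_eq_mul, mul_one, one_mul, hK0] at h0
  rw [hk, hK]
  have hG : Real.Gamma ((m : ℝ) / 2) ≠ 0 := (Real.Gamma_pos_of_pos (by linarith)).ne'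
  rw [eq_div_iff hG]
  linear_combination (-(√2 ^ k * Real.Gamma (((m : ℝ) + k) / 2))) * h0

theorem integral_norm_stdGaussian {m : ℕ} (hm : m ≠ 0) :
    ∫ h, ‖h‖ ∂(stdGaussian (EuclideanSpace ℝ (Fin m))) = phi m := by
  have h := integral_norm_pow_stdGaussian hm 1
  simpa [phi] using h

theorem integral_norm_sq_stdGaussian {m : ℕ} (hm : m ≠ 0) :
    ∫ h, ‖h‖ ^ 2 ∂(stdGaussian (EuclideanSpace ℝ (Fin m))) = m := by
  have hm0 : (0 : ℝ) < m := by exact_mod_cast Nat.pos_of_ne_zero hm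
  have hG : Real.Gamma ((m : ℝ) / 2) ≠ 0 := (Real.Gamma_pos_of_pos (by linarith)).ne'
  rw [integral_norm_pow_stdGaussian hm 2, Real.sq_sqrt (by norm_num), Nat.cast_ofNat,
    show ((m : ℝ) + 2) / 2 = m / 2 + 1 by ring, Real.Gamma_add_one (by positivity)]
  field_simp

/-- Use `max y 0 ≤ (y + 1)² / 4` with `y = σ (‖h‖ - φ(m))`, which has mean `0` and variance `m -
φ(m)² ≤ 1`. -/
theorem integral_max_norm_sub_phi_le {m : ℕ} (hm : 2 ≤ m) {σ : ℝ} (hσ : σ = 1 ∨ σ = -1) :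
    ∫ h, max (σ * (‖h‖ - phi m)) 0 ∂(stdGaussian (EuclideanSpace ℝ (Fin m))) ≤ 1 / 2 := by
  have hm0 : m ≠ 0 := by omega
  have hσ2 : σ ^ 2 = 1 := by rcases hσ with rfl | rfl <;> norm_num
  have hi1 := integrable_norm_stdGaussian m
  have hi2 : Integrable (fun h => ‖h‖ ^ 2) (stdGaussian (EuclideanSpace ℝ (Fin m))) :=
    (IsGaussian.memLp_two_id (μ := stdGaussian (EuclideanSpace ℝ (Fin m)))).integrable_norm_pow
      two_ne_zero
  set φ := phi m with hφ
  have hi3 : Integrable (fun h : EuclideanSpace ℝ (Fin m) => (1 / 4) * ‖h‖ ^ 2 +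
      (σ / 2 - φ / 2) * ‖h‖) (stdGaussian _) := (hi2.const_mul _).add (hi1.const_mul _)
  have h1 : ∀ h : EuclideanSpace ℝ (Fin m), max (σ * (‖h‖ - φ)) 0 ≤
      (1 / 4) * ‖h‖ ^ 2 + (σ / 2 - φ / 2) * ‖h‖ + (φ ^ 2 / 4 - σ * φ / 2 + 1 / 4) := by
    intro h
    refine max_le ?_ ?_ <;> rcases hσ with rfl | rfl <;>
      nlinarith [sq_nonneg (‖h‖ - φ - 1), sq_nonneg (‖h‖ - φ + 1)]
  refine (integral_mono ((((hi1.sub (integrable_const φ)).const_mul σ).sup (integrable_const 0)))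
    (hi3.add (integrable_const (φ ^ 2 / 4 - σ * φ / 2 + 1 / 4))) h1).trans ?_
  have h2 : ∫ h : EuclideanSpace ℝ (Fin m), (((1 / 4) * ‖h‖ ^ 2 + (σ / 2 - φ / 2) * ‖h‖) +
      (φ ^ 2 / 4 - σ * φ / 2 + 1 / 4)) ∂(stdGaussian _) =
      (1 / 4) * m + (σ / 2 - φ / 2) * φ + (φ ^ 2 / 4 - σ * φ / 2 + 1 / 4) := by
    rw [integral_add hi3 (integrable_const _), integral_add (hi2.const_mul _) (hi1.const_mul _),
      integral_const_mul, integral_const_mul, integral_norm_sq_stdGaussian hm0,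
      integral_norm_stdGaussian hm0]
    simp [hφ]
  refine h2.le.trans ?_
  have h3 := sub_one_le_phi_sq (t := m) (by exact_mod_cast hm)
  nlinarith

end

/-! ### Gaussian width and the probability of the good event. -/

section

variable {m n : ℕ}

/-- The support function of `S`. -/
def supportFun (S : Set (EuclideanSpace ℝ (Fin n))) (g : EuclideanSpace ℝ (Fin n)) : ℝ :=
  sSup ((fun z => inner ℝ g z) '' S)

section SupportFun

variable {S : Set (EuclideanSpace ℝ (Fin n))}

theorem inner_le_norm_of_mem (hS : ∀ z ∈ S, ‖z‖ ≤ 1) {z : EuclideanSpace ℝ (Fin n)} (hz : z ∈ S)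
    (g : EuclideanSpace ℝ (Fin n)) : inner ℝ g z ≤ ‖g‖ :=
  (real_inner_le_norm g z).trans (mul_le_of_le_one_right (norm_nonneg _) (hS z hz))

theorem inner_le_supportFun (hS : ∀ z ∈ S, ‖z‖ ≤ 1) {z : EuclideanSpace ℝ (Fin n)} (hz : z ∈ S)
    (g : EuclideanSpace ℝ (Fin n)) : inner ℝ g z ≤ supportFun S g := by
  refine le_csSup ⟨‖g‖, ?_⟩ ⟨z, hz, rfl⟩
  rintro _ ⟨y, hy, rfl⟩
  exact inner_le_norm_of_mem hS hy g

theorem supportFun_le {g : EuclideanSpace ℝ (Fin n)} (hne : S.Nonempty) {r : ℝ}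
    (h : ∀ z ∈ S, inner ℝ g z ≤ r) : supportFun S g ≤ r := by
  refine csSup_le (hne.image _) ?_
  rintro _ ⟨y, hy, rfl⟩
  exact h y hy

theorem supportFun_nonneg (hS : ∀ z ∈ S, ‖z‖ ≤ 1) (h0 : (0 : EuclideanSpace ℝ (Fin n)) ∈ S)
    (g : EuclideanSpace ℝ (Fin n)) : 0 ≤ supportFun S g := by
  simpa using inner_le_supportFun hS h0 g

theorem continuous_supportFun (hS : ∀ z ∈ S, ‖z‖ ≤ 1) (hne : S.Nonempty) :
    Continuous (supportFun S) := by
  refine (LipschitzWith.of_le_add_mul 1 fun g g' => ?_).continuous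
  refine supportFun_le hne fun z hz => ?_
  have h1 := inner_le_norm_of_mem hS hz (g - g')
  have h2 := inner_le_supportFun hS hz g'
  rw [inner_sub_left] at h1
  rw [NNReal.coe_one, one_mul, dist_eq_norm]
  linarith

theorem integrable_supportFun (hS : ∀ z ∈ S, ‖z‖ ≤ 1)
    (h0 : (0 : EuclideanSpace ℝ (Fin n)) ∈ S) :
    Integrable (supportFun S) (stdGaussian (EuclideanSpace ℝ (Fin n))) := by
  refine (integrable_norm_stdGaussian n).mono'
    (continuous_supportFun hS ⟨0, h0⟩).aestronglyMeasurable (Filter.Eventually.of_forall fun g => ?_)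
  rw [Real.norm_of_nonneg (supportFun_nonneg hS h0 g)]
  exact supportFun_le ⟨0, h0⟩ fun z hz => inner_le_norm_of_mem hS hz g

theorem gaussianWidth_eq : gaussianWidth S = ∫ g, supportFun S g ∂(stdGaussian _) := rfl

theorem gaussianWidth_nonneg (hS : ∀ z ∈ S, ‖z‖ ≤ 1)
    (h0 : (0 : EuclideanSpace ℝ (Fin n)) ∈ S) : 0 ≤ gaussianWidth S :=
  integral_nonneg fun g => supportFun_nonneg hS h0 g

theorem measurePreserving_neg_stdGaussian :
    MeasurePreserving (fun g => -g) (stdGaussian (EuclideanSpace ℝ (Fin n)))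
      (stdGaussian (EuclideanSpace ℝ (Fin n))) :=
  ⟨measurable_neg, stdGaussian_map (LinearIsometryEquiv.neg ℝ)⟩

theorem integrable_supportFun_neg (hS : ∀ z ∈ S, ‖z‖ ≤ 1)
    (h0 : (0 : EuclideanSpace ℝ (Fin n)) ∈ S) :
    Integrable (fun g => supportFun S (-g)) (stdGaussian (EuclideanSpace ℝ (Fin n))) :=
  measurePreserving_neg_stdGaussian.integrable_comp_of_integrable (integrable_supportFun hS h0)

theorem integral_supportFun_neg :
    ∫ g, supportFun S (-g) ∂(stdGaussian (EuclideanSpace ℝ (Fin n))) = gaussianWidth S :=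
  measurePreserving_neg_stdGaussian.integral_comp
    (MeasurableEquiv.neg (EuclideanSpace ℝ (Fin n))).measurableEmbedding (supportFun S)

theorem integrable_inner_stdGaussian (e : EuclideanSpace ℝ (Fin n)) :
    Integrable (fun g => inner ℝ g e) (stdGaussian (EuclideanSpace ℝ (Fin n))) := by
  have h : Integrable (fun g : EuclideanSpace ℝ (Fin n) => g) (stdGaussian _) :=
    IsGaussian.integrable_id
  exact h.inner_const e

theorem integral_inner_stdGaussian (e : EuclideanSpace ℝ (Fin n)) :
    ∫ g, inner ℝ g e ∂(stdGaussian (EuclideanSpace ℝ (Fin n))) = 0 := by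
  simpa [real_inner_comm] using integral_strongDual_stdGaussian (innerSL ℝ e)

end SupportFun

/-- The properties of the Gaussian matrix used in the analysis of projected gradient descent. -/
structure GoodMatrix (S : Set (EuclideanSpace ℝ (Fin n))) (e : EuclideanSpace ℝ (Fin n))
    (w : EuclideanSpace ℝ (Fin m)) (b L₁ L₂ L₃ : ℝ) (A : Matrix (Fin m) (Fin n) ℝ) : Prop where
  lower : ∀ z ∈ S, b * ‖z‖ - L₁ ≤ ‖A.toEuclideanLin z‖
  upper : ∀ u ∈ S, ∀ v ∈ S, ‖A.toEuclideanLin (u - v)‖ ≤ b * ‖u - v‖ + 2 * L₁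
  lower_shift : ∀ u ∈ S, b * ‖u + e‖ - L₂ ≤ ‖A.toEuclideanLin (u + e)‖
  upper_shift : ∀ u ∈ S, ‖A.toEuclideanLin (u - e)‖ ≤ b * ‖u - e‖ + L₂
  noise : ∀ u ∈ S, inner ℝ (A.transpose.toEuclideanLin w) u ≤ L₃ * ‖w‖

/-- A union bound over five suprema. `S` has radius `1` and width `ω`; `S - S` has radius `2`, and
the majorant `supportFun S g + supportFun S (-g)` has mean `2 ω`. The translates `S ± e` also have
radius `2`, but their width stays `ω` because `⟪g, e⟫` has mean zero. -/
theorem measure_not_goodMatrix_le (hm : 2 ≤ m) {S : Set (EuclideanSpace ℝ (Fin n))}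
    (hS : ∀ z ∈ S, ‖z‖ ≤ 1) (h0 : (0 : EuclideanSpace ℝ (Fin n)) ∈ S)
    {e : EuclideanSpace ℝ (Fin n)} (he : ‖e‖ ≤ 1) (w : EuclideanSpace ℝ (Fin m))
    {t₁ t₂ t₃ : ℝ} (ht₁ : 0 ≤ t₁) (ht₂ : 0 ≤ t₂) (ht₃ : 0 ≤ t₃) :
    (stdPi (Fin m × Fin n)).real {x | ¬ GoodMatrix S e w (phi m) (gaussianWidth S + 1 / 2 + t₁)
      (gaussianWidth S + 1 + 2 * t₂) (gaussianWidth S + t₃) (toMatrix x)} ≤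
      2 * Real.exp (-t₁ ^ 2 / 2) + 2 * Real.exp (-t₂ ^ 2 / 2) + Real.exp (-t₃ ^ 2 / 2) := by
  set μ := stdPi (Fin m × Fin n)
  have hi := integrable_supportFun hS h0
  have hin := integrable_supportFun_neg hS h0
  have E₁ := measure_exists_mem_gt_le (m := m) (σ := -1) (Or.inr rfl) (R := 1) one_pos (Z := S)
    (by simpa using hS) (integral_max_norm_sub_phi_le hm (Or.inr rfl)) hi
    (fun z hz g => inner_le_supportFun hS hz g) ht₁
  have E₂ := measure_exists_mem_gt_le (m := m) (σ := 1) (Or.inl rfl) (R := 2) two_pos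
    (Z := {z | ∃ u ∈ S, ∃ v ∈ S, u - v = z})
    (by
      rintro _ ⟨u, hu, v, hv, rfl⟩
      refine (norm_sub_le u v).trans ?_
      have := hS u hu
      have := hS v hv
      push_cast
      linarith) (integral_max_norm_sub_phi_le hm (Or.inl rfl)) (hi.add hin)
    (by
      rintro _ ⟨u, hu, v, hv, rfl⟩ g
      have h1 := inner_le_supportFun hS hu g
      have h2 := inner_le_supportFun hS hv (-g)
      rw [inner_neg_left] at h2
      rw [inner_sub_right]
      simp only [Pi.add_apply]
      linarith) ht₁
  have hshift : ∀ d : EuclideanSpace ℝ (Fin n), ‖d‖ ≤ 1 → ∀ σ : ℝ, (σ = 1 ∨ σ = -1) →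
      μ.real {x | ∃ z ∈ {z | ∃ u ∈ S, u + d = z}, gaussianWidth S + 1 + 2 * t₂ <
        σ * (‖(toMatrix x).toEuclideanLin z‖ - phi m * ‖z‖)} ≤ Real.exp (-t₂ ^ 2 / 2) := by
    intro d hd σ hσ
    have h := measure_exists_mem_gt_le (m := m) hσ (R := 2) two_pos
      (Z := {z | ∃ u ∈ S, u + d = z})
      (by
        rintro _ ⟨u, hu, rfl⟩
        refine (norm_add_le u d).trans ?_
        have := hS u hu
        push_cast
        linarith) (integral_max_norm_sub_phi_le hm hσ)
      (hi.add (integrable_inner_stdGaussian d))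
      (by
        rintro _ ⟨u, hu, rfl⟩ g
        have h1 := inner_le_supportFun hS hu g
        rw [inner_add_right]
        simp only [Pi.add_apply]
        linarith) ht₂
    have hint : ∫ g, (supportFun S + fun g => inner ℝ g d) g ∂(stdGaussian _) =
        gaussianWidth S := by
      rw [integral_add' hi (integrable_inner_stdGaussian d), integral_inner_stdGaussian, add_zero,
        gaussianWidth_eq]
    rw [hint] at h
    simpa using h
  have E₃ := hshift e he (-1) (Or.inr rfl)
  have E₄ := hshift (-e) (by simpa using he) 1 (Or.inl rfl)
  have E₅ : μ.real {x | ∃ z ∈ S, (gaussianWidth S + t₃) * ‖w‖ <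
      inner ℝ ((toMatrix x).transpose.toEuclideanLin w) z} ≤ Real.exp (-t₃ ^ 2 / 2) := by
    rcases eq_or_ne w 0 with rfl | hw
    · simpa using (Real.exp_pos _).le
    · have hw0 : 0 < ‖w‖ := norm_pos_iff.2 hw
      have h := measure_exists_mem_inner_gt_le (n := n) (w := ‖w‖⁻¹ • w)
        (by rw [norm_smul, norm_inv, norm_norm, inv_mul_cancel₀ hw0.ne']) (R := 1) one_pos (Z := S)
        (by simpa using hS) hi (fun z hz g => inner_le_supportFun hS hz g) ht₃
      refine le_trans (measureReal_mono ?_ (measure_ne_top _ _)) h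
      rintro x ⟨z, hz, hx⟩
      refine ⟨z, hz, ?_⟩
      rw [map_smul, real_inner_smul_left, NNReal.coe_one, one_mul, ← gaussianWidth_eq]
      rwa [lt_inv_mul_iff₀ hw0, mul_comm]
  have hint₂ : ∫ g, (supportFun S + fun g => supportFun S (-g)) g ∂(stdGaussian _) =
      2 * gaussianWidth S := by
    rw [integral_add' hi hin, integral_supportFun_neg, ← gaussianWidth_eq, two_mul]
  rw [hint₂] at E₂
  rw [← gaussianWidth_eq] at E₁
  refine (measureReal_mono (s₂ := _ ∪ (_ ∪ (_ ∪ (_ ∪ _)))) ?_ (measure_ne_top _ _)).trans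
    ((measureReal_union_le _ _).trans (add_le_add E₁ ((measureReal_union_le _ _).trans
      (add_le_add E₂ ((measureReal_union_le _ _).trans (add_le_add E₃
        ((measureReal_union_le _ _).trans (add_le_add E₄ E₅)))))) |>.trans_eq (by ring)))
  intro x hx
  by_contra hnot
  simp only [Set.mem_union, not_or, Set.mem_ofPred_eq, not_exists, not_and, not_lt,
    NNReal.coe_one, NNReal.coe_ofNat] at hnot
  obtain ⟨h1, h2, h3, h4, h5⟩ := hnot
  refine hx ⟨fun z hz => ?_, fun u hu v hv => ?_, fun u hu => ?_, fun u hu => ?_, h5⟩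
  · linarith [h1 z hz]
  · linarith [h2 (u - v) ⟨u, hu, v, hv, rfl⟩]
  · linarith [h3 (u + e) ⟨u, hu, rfl⟩]
  · linarith [h4 (u - e) ⟨u, hu, (sub_eq_add_neg u e).symm⟩]

end

/-! ### Algebra of the step size. -/

section

/-- With `s = √(m₀ / m)` and `t = (1 - s) ^ (3 / 2)`, the relation between `s` and the normalized
step size `ν = μ b²`. -/
structure StepRelation (s t ν : ℝ) : Prop where
  nonneg : 0 ≤ s
  lt_half : s < 1 / 2
  pos : 0 < t
  sq_eq : t ^ 2 = (1 - s) ^ 3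
  eq : ν * (t * ((1 - s) ^ 2 + 1)) = √2 * (√2 * t - s)

namespace StepRelation

variable {s t ν : ℝ}

/-- After squaring this is `s² < 2 (1 - s)³`, with equality at `s = 1/2`: the condition `m > 4 m₀`
is exactly what makes the step size positive. -/
theorem lt_sqrt_two_mul (h : StepRelation s t ν) : s < √2 * t := by
  have h2 : √2 ^ 2 = 2 := Real.sq_sqrt zero_le_two
  have := h.nonneg
  have := h.lt_half
  refine lt_of_pow_lt_pow_left₀ 2 (mul_nonneg (Real.sqrt_nonneg _) h.pos.le) ?_
  rw [mul_pow, h2, h.sq_eq]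
  nlinarith [mul_pos (sub_pos.2 h.lt_half) (sub_pos.2 h.lt_half), pow_pos (sub_pos.2 h.lt_half) 3]

theorem step_pos (h : StepRelation s t ν) : 0 < ν := by
  have h1 : 0 < √2 * (√2 * t - s) := mul_pos (by positivity) (sub_pos.2 h.lt_sqrt_two_mul)
  rw [← h.eq] at h1
  exact pos_of_mul_pos_left h1 (mul_nonneg h.pos.le (by positivity))

theorem step_le (h : StepRelation s t ν) : ν ≤ 8 / 5 := by
  have h2 : √2 ^ 2 = 2 := Real.sq_sqrt zero_le_two
  have h1 : ν * ((1 - s) ^ 2 + 1) ≤ 2 := by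
    refine le_of_mul_le_mul_left ?_ h.pos
    linear_combination h.eq + mul_nonneg (Real.sqrt_nonneg 2) h.nonneg + t * h2
  have h3 : (1 / 4 : ℝ) ≤ (1 - s) ^ 2 := by nlinarith [h.lt_half]
  nlinarith [h.step_pos, mul_nonneg h.step_pos.le (sub_nonneg.2 h3)]

/-- It follows from `2 t² - s² = 2 (1 - s)³ - s² = (1 - 2 s) ((1 - s)² + 1)`. It is also the
stationarity condition in `ν` for the worst-case rate found in `contraction_le`. -/
theorem one_sub_two_mul (h : StepRelation s t ν) :
    1 - 2 * s = ν * (t ^ 2 + √2 * s * t / 2) := by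
  have h2 : √2 ^ 2 = 2 := Real.sq_sqrt zero_le_two
  have hD : 0 < (1 - s) ^ 2 + 1 := by positivity
  refine mul_right_cancel₀ hD.ne' ?_
  have : ν * (t ^ 2 + √2 * s * t / 2) * ((1 - s) ^ 2 + 1) =
      ν * (t * ((1 - s) ^ 2 + 1)) * (t + √2 * s / 2) := by ring
  rw [this, h.eq]
  have h3 : √2 * (√2 * t - s) * (t + √2 * s / 2) = 2 * t ^ 2 - s ^ 2 := by
    linear_combination (t ^ 2 + √2 * s * t / 2 - s ^ 2 / 2) * h2
  rw [h3, h.sq_eq]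
  ring

theorem one_sub_sq (h : StepRelation s t ν) :
    1 - (ν * t) ^ 2 = 1 - ν * (1 - 2 * s) + ν ^ 2 * (√2 * s * t / 2) := by
  rw [h.one_sub_two_mul]; ring

/-- The left side is quadratic in `r` with leading coefficient `-(2 - ν ((1 - s)² + 1)) = -√2 s /
t`. Completing the square at `r = √2 ν t` shows that the right side is its value there. -/
theorem contraction_le (h : StepRelation s t ν) (r : ℝ) :
    (4 - r ^ 2) * (1 - ν * (1 - s) ^ 2) - r ^ 2 + ν * (r + 2 * s) ^ 2 ≤
      4 * (1 - (ν * t) ^ 2) := by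
  have h2 : √2 ^ 2 = 2 := Real.sq_sqrt zero_le_two
  have hq : 2 - ν * ((1 - s) ^ 2 + 1) = √2 * s / t := by
    rw [eq_div_iff h.pos.ne']
    linear_combination -h.eq + (-t) * h2
  rw [h.one_sub_sq]
  have h3 : 0 ≤ √2 * s / t * (r - √2 * ν * t) ^ 2 :=
    mul_nonneg (div_nonneg (mul_nonneg (Real.sqrt_nonneg _) h.nonneg) h.pos.le) (sq_nonneg _)
  have h4 : √2 * s / t * (r - √2 * ν * t) ^ 2 =
      √2 * s / t * r ^ 2 - 4 * ν * s * r + 2 * √2 * s * ν ^ 2 * t := by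
    have := h.pos.ne'
    field_simp
    linear_combination (-2 * r * t * ν + √2 * ν ^ 2 * t ^ 2) * s * h2
  rw [h4, ← hq] at h3
  linarith

/-- The left side is the rate of the cruder first-step estimate; the inequality also shows that the
contraction factor is nonnegative. For `ν ≤ 1` it follows from `one_sub_sq` by dropping a
nonnegative term; for `ν ≥ 1` it reduces to `2 (ν - 1) ≤ √2 s t / 2`. -/
theorem abs_add_le (h : StepRelation s t ν) : |1 - ν| + 2 * ν * s ≤ 1 - (ν * t) ^ 2 := by
  have h2 : √2 ^ 2 = 2 := Real.sq_sqrt zero_le_two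
  have hc : (4 / 3 : ℝ) ≤ √2 := Real.le_sqrt_of_sq_le (by norm_num)
  have hs0 := h.nonneg
  have hs := h.lt_half
  have ht := h.pos
  rw [h.one_sub_sq]
  have h0 : 0 ≤ √2 * s * t / 2 := by positivity
  rcases le_total ν 1 with hν | hν
  · rw [abs_of_nonneg (sub_nonneg.2 hν)]
    have := mul_nonneg (sq_nonneg ν) h0
    linarith
  · rw [abs_of_nonpos (sub_nonpos.2 hν)]
    -- Since `t = (1 - s)^(3/2)`, this and `ht2` are the tangent-line bounds at `s = 0` for the
    -- convex functions `1 / t` and `t`.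
    have ht1 : t * (1 + 3 / 2 * s) ≤ 1 := by
      refine le_of_sq_le_sq ?_ zero_le_one
      rw [mul_pow, h.sq_eq]
      nlinarith [mul_nonneg hs0 hs0, mul_nonneg (mul_nonneg hs0 hs0) hs0]
    have ht2 : 1 - 3 / 2 * s ≤ t := by
      refine le_of_sq_le_sq ?_ ht.le
      rw [h.sq_eq]
      nlinarith [mul_nonneg (mul_nonneg hs0 hs0) (sub_pos.2 hs).le]
    have h3 : 2 * (ν - 1) ≤ √2 * s * t / 2 := by
      have hD : 0 < (1 - s) ^ 2 + 1 := by positivity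
      have h5 : (ν - 1) * ((1 - s) ^ 2 + 1) ≤ s * (2 - s - √2 * (1 + 3 / 2 * s)) := by
        refine le_of_mul_le_mul_left ?_ ht
        have h6 := mul_le_mul_of_nonneg_left ht1 (mul_nonneg (Real.sqrt_nonneg 2) hs0)
        linear_combination h6 + h.eq + t * h2
      have h7 : s * (4 - 2 * s - 2 * √2 * (1 + 3 / 2 * s)) ≤
          √2 * s * t / 2 * ((1 - s) ^ 2 + 1) := by
        have h8 : (2 - 2 * s) * (1 - 3 / 2 * s) ≤ t * ((1 - s) ^ 2 + 1) := by
          nlinarith [mul_nonneg ht.le (sq_nonneg s), mul_nonneg (sub_nonneg.2 ht2)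
            (by linarith : 0 ≤ 2 - 2 * s)]
        have h9 := mul_le_mul_of_nonneg_left h8 (mul_nonneg (Real.sqrt_nonneg 2) hs0)
        have h10 : 4 - 2 * s - 2 * √2 * (1 + 3 / 2 * s) ≤
            √2 * ((2 - 2 * s) * (1 - 3 / 2 * s)) / 2 := by
          nlinarith [mul_nonneg (Real.sqrt_nonneg 2) hs0,
            mul_nonneg (Real.sqrt_nonneg 2) (mul_nonneg hs0 hs0)]
        have h11 := mul_le_mul_of_nonneg_left h10 hs0
        linarith
      refine le_of_mul_le_mul_right ?_ hD
      linarith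
    nlinarith [mul_le_mul_of_nonneg_right (one_le_pow₀ hν (n := 2)) h0]

/-- Split off `(1 - ν)(a² - r²) ≤ 4 |1 - ν|`. The rest is `ν` times at most `2 ε (a + r) ≤ 8 s`,
because `a + r ≤ 2 √2`; this is why `ε` may be as large as `√2 s`. -/
theorem first_step_le (h : StepRelation s t ν) {a r ε X Y : ℝ} (ha : 0 ≤ a) (hr : 0 ≤ r)
    (har : a ^ 2 + r ^ 2 = 4) (hε0 : 0 ≤ ε) (hε : ε ≤ √2 * s) (hX : a - ε ≤ X)
    (hY0 : 0 ≤ Y) (hY : Y ≤ r + ε) :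
    a ^ 2 - r ^ 2 - ν * X ^ 2 + ν * Y ^ 2 ≤ 4 * (1 - (ν * t) ^ 2) := by
  refine le_trans ?_ (mul_le_mul_of_nonneg_left h.abs_add_le zero_le_four)
  have h2 : √2 ^ 2 = 2 := Real.sq_sqrt zero_le_two
  have hs0 := h.nonneg
  have hs := h.lt_half
  have hν := h.step_pos
  have hYY : Y ^ 2 ≤ (r + ε) ^ 2 := pow_le_pow_left₀ hY0 hY 2
  have h1 : (1 - ν) * (a ^ 2 - r ^ 2) ≤ 4 * |1 - ν| := by
    refine (le_abs_self _).trans ?_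
    rw [abs_mul, mul_comm]
    refine mul_le_mul_of_nonneg_right (abs_le.2 ⟨?_, ?_⟩) (abs_nonneg _) <;> nlinarith
  suffices hs' : a ^ 2 - r ^ 2 - X ^ 2 + Y ^ 2 ≤ 8 * s by
    linear_combination h1 + ν * hs'
  rcases le_total ε a with hεa | hεa
  · have hXX : (a - ε) ^ 2 ≤ X ^ 2 := pow_le_pow_left₀ (sub_nonneg.2 hεa) hX 2
    have h3 : a + r ≤ 2 * √2 := by
      refine le_of_sq_le_sq ?_ (by positivity)
      rw [mul_pow, h2]
      nlinarith [sq_nonneg (a - r)]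
    have h4 : ε * (a + r) ≤ √2 * s * (2 * √2) := mul_le_mul hε h3 (by positivity) (by positivity)
    linear_combination hXX + hYY + 2 * h4 + 4 * s * h2
  -- Here `a ≤ ε`, so the lower bound on `X` is void; the term `-X²` is dropped and `a² ≤ ε²` used
  -- instead.
  · have h3 : r ≤ 2 := by nlinarith
    have hc : √2 ≤ 3 / 2 := Real.sqrt_le_iff.2 ⟨by norm_num, by norm_num⟩
    have h4 : ε ^ 2 ≤ (√2 * s) ^ 2 := pow_le_pow_left₀ hε0 hε 2
    have h5 : a ^ 2 ≤ ε ^ 2 := pow_le_pow_left₀ ha hεa 2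
    have h6 : ε * r ≤ √2 * s * 2 := mul_le_mul hε h3 hr (by positivity)
    have h7 : √2 * s ≤ 3 / 2 * s := mul_le_mul_of_nonneg_right hc hs0
    rw [mul_pow, h2] at h4
    have h8 : s ^ 2 ≤ s * (1 / 2) := by rw [sq]; exact mul_le_mul_of_nonneg_left hs.le hs0
    linarith [sq_nonneg X]

end StepRelation

end

/-! ### Deterministic convergence on the good event. -/

section

variable {m n : ℕ}

theorem inner_transpose_toEuclideanLin (A : Matrix (Fin m) (Fin n) ℝ)
    (y : EuclideanSpace ℝ (Fin m)) (u : EuclideanSpace ℝ (Fin n)) :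
    inner ℝ (A.transpose.toEuclideanLin y) u = inner ℝ y (A.toEuclideanLin u) := by
  rw [← Matrix.conjTranspose_eq_transpose_of_trivial,
    Matrix.toEuclideanLin_conjTranspose_eq_adjoint, LinearMap.adjoint_inner_left]

theorem four_mul_inner_sub {E F : Type*} [NormedAddCommGroup E] [InnerProductSpace ℝ E]
    [NormedAddCommGroup F] [InnerProductSpace ℝ F] (T : E →ₗ[ℝ] F) (μ : ℝ) (u v : E) :
    4 * (inner ℝ u v - μ * inner ℝ (T u) (T v)) =
      ‖u + v‖ ^ 2 - ‖u - v‖ ^ 2 - μ * ‖T (u + v)‖ ^ 2 + μ * ‖T (u - v)‖ ^ 2 := by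
  rw [map_add, map_sub, norm_add_sq_real, norm_sub_sq_real, norm_add_sq_real, norm_sub_sq_real]
  ring

theorem norm_add_sq_add_norm_sub_sq {E : Type*} [NormedAddCommGroup E] [InnerProductSpace ℝ E]
    {u v : E} (hu : ‖u‖ = 1) (hv : ‖v‖ = 1) : ‖u + v‖ ^ 2 + ‖u - v‖ ^ 2 = 4 := by
  rw [norm_add_sq_real, norm_sub_sq_real, hu, hv]
  ring

/-- The combination is a positive multiple of a convex combination, which lies in `D`; convexity of
`C` is thereby avoided. -/
theorem smul_add_smul_mem_of_convex {E : Type*} [AddCommGroup E] [Module ℝ E] {D C : Set E}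
    (hD : Convex ℝ D) (hDC : D ⊆ C) (hC : ∀ v ∈ C, ∀ t : ℝ, 0 ≤ t → t • v ∈ C) {p q : E}
    (hp : p ∈ D) (hq : q ∈ D) {α β : ℝ} (hα : 0 < α) (hβ : 0 < β) : α • p + β • q ∈ C := by
  have h := hC _ (hDC (hD hp hq (div_nonneg hα.le (add_pos hα hβ).le)
    (div_nonneg hβ.le (add_pos hα hβ).le) (by rw [← add_div, div_self (add_pos hα hβ).ne'])))
    (α + β) (add_pos hα hβ).le
  rwa [smul_add, smul_smul, smul_smul, mul_div_cancel₀ _ (add_pos hα hβ).ne',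
    mul_div_cancel₀ _ (add_pos hα hβ).ne'] at h

theorem norm_inv_norm_smul {E : Type*} [NormedAddCommGroup E] [NormedSpace ℝ E] {p : E}
    (hp : p ≠ 0) : ‖‖p‖⁻¹ • p‖ = 1 := by
  rw [norm_smul, norm_inv, norm_norm, inv_mul_cancel₀ (norm_ne_zero_iff.2 hp)]

theorem inv_norm_smul_mem {C : Set (EuclideanSpace ℝ (Fin n))}
    (hC : ∀ v ∈ C, ∀ t : ℝ, 0 ≤ t → t • v ∈ C) {p : EuclideanSpace ℝ (Fin n)} (hp : p ∈ C)
    (hp0 : p ≠ 0) : ‖p‖⁻¹ • p ∈ C ∩ Metric.closedBall 0 1 :=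
  ⟨hC _ hp _ (inv_nonneg.2 (norm_nonneg _)), by simp [norm_smul, hp0]⟩

namespace GoodMatrix

variable {C : Set (EuclideanSpace ℝ (Fin n))} {e : EuclideanSpace ℝ (Fin n)}
  {w : EuclideanSpace ℝ (Fin m)} {b L₁ L₂ L₃ s t μ : ℝ} {A : Matrix (Fin m) (Fin n) ℝ}

theorem inner_sub_le (hA : GoodMatrix (C ∩ Metric.closedBall 0 1) e w b L₁ L₂ L₃ A)
    (hC : ∀ v ∈ C, ∀ t : ℝ, 0 ≤ t → t • v ∈ C) (hb : 0 < b)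
    (hrel : StepRelation s t (μ * b ^ 2)) (hL₁ : L₁ ≤ s * b)
    {u v : EuclideanSpace ℝ (Fin n)} (hu : u ∈ C) (hv : v ∈ C) (hu1 : ‖u‖ = 1) (hv1 : ‖v‖ = 1)
    (huv : u + v ∈ C) :
    inner ℝ u v - μ * inner ℝ (A.toEuclideanLin u) (A.toEuclideanLin v) ≤
      1 - (μ * b ^ 2 * t) ^ 2 := by
  have hμ : 0 < μ := pos_of_mul_pos_left hrel.step_pos (sq_nonneg b)
  have h1 : b * (1 - s) * ‖u + v‖ ≤ ‖A.toEuclideanLin (u + v)‖ := by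
    rcases eq_or_ne (u + v) 0 with h0 | h0
    · simp [h0]
    · have h := hA.lower _ (inv_norm_smul_mem hC huv h0)
      have hpos := norm_pos_iff.2 h0
      rw [norm_inv_norm_smul h0, map_smul, norm_smul, norm_inv, norm_norm, ← div_eq_inv_mul,
        le_div_iff₀ hpos] at h
      nlinarith
  have h2 : ‖A.toEuclideanLin (u - v)‖ ≤ b * (‖u - v‖ + 2 * s) := by
    have h := hA.upper u ⟨hu, by simp [hu1]⟩ v ⟨hv, by simp [hv1]⟩
    linarith
  have h3 := pow_le_pow_left₀ (mul_nonneg (mul_nonneg hb.le (by linarith [hrel.lt_half]))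
    (norm_nonneg (u + v))) h1 2
  have h4 := pow_le_pow_left₀ (norm_nonneg _) h2 2
  have h5 := hrel.contraction_le ‖u - v‖
  have h6 := four_mul_inner_sub A.toEuclideanLin μ u v
  have h7 := norm_add_sq_add_norm_sub_sq hu1 hv1
  have h8 := mul_le_mul_of_nonneg_left h3 hμ.le
  have h9 := mul_le_mul_of_nonneg_left h4 hμ.le
  have h10 : ‖u + v‖ ^ 2 = 4 - ‖u - v‖ ^ 2 := by linarith
  rw [mul_pow, h10] at h8
  rw [h10] at h6
  linarith

theorem inner_sub_le_of_shift (hA : GoodMatrix (C ∩ Metric.closedBall 0 1) e w b L₁ L₂ L₃ A)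
    (hb : 0 < b) (hrel : StepRelation s t (μ * b ^ 2)) (hL₂0 : 0 ≤ L₂)
    (hL₂ : L₂ ≤ √2 * s * b) {u : EuclideanSpace ℝ (Fin n)} (hu : u ∈ C) (hu1 : ‖u‖ = 1)
    (he : ‖e‖ = 1) :
    inner ℝ u e - μ * inner ℝ (A.toEuclideanLin u) (A.toEuclideanLin e) ≤
      1 - (μ * b ^ 2 * t) ^ 2 := by
  have h1 := hA.lower_shift u ⟨hu, by simp [hu1]⟩
  have h2 := hA.upper_shift u ⟨hu, by simp [hu1]⟩
  have h3 := hrel.first_step_le (norm_nonneg (u + e)) (norm_nonneg (u - e))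
    (norm_add_sq_add_norm_sub_sq hu1 he) (div_nonneg hL₂0 hb.le) ((div_le_iff₀ hb).2 hL₂)
    (X := ‖A.toEuclideanLin (u + e)‖ / b)
    (by rw [le_div_iff₀ hb, sub_mul, div_mul_cancel₀ _ hb.ne']; linarith)
    (Y := ‖A.toEuclideanLin (u - e)‖ / b) (div_nonneg (norm_nonneg _) hb.le)
    (by rw [div_le_iff₀ hb, add_mul, div_mul_cancel₀ _ hb.ne']; linarith)
  have h4 := four_mul_inner_sub A.toEuclideanLin μ u e
  have h5 : ∀ X : ℝ, μ * b ^ 2 * (X / b) ^ 2 = μ * X ^ 2 := fun X => by field_simp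
  rw [h5, h5] at h3
  linarith

/-- One step of projected gradient descent, for a vector `h` whose direction satisfies the
restricted contraction bound. -/
theorem norm_le_of_norm_sq_le (hA : GoodMatrix (C ∩ Metric.closedBall 0 1) e w b L₁ L₂ L₃ A)
    (hC : ∀ v ∈ C, ∀ t : ℝ, 0 ≤ t → t • v ∈ C) (hμ : 0 ≤ μ) {ρ : ℝ}
    {h p : EuclideanSpace ℝ (Fin n)} (hp : p ∈ C) (hp0 : p ≠ 0)
    (hle : ‖p‖ ^ 2 ≤ inner ℝ (h + μ • A.transpose.toEuclideanLin (w - A.toEuclideanLin h)) p)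
    (hρ : h ≠ 0 → inner ℝ (‖p‖⁻¹ • p) (‖h‖⁻¹ • h) -
      μ * inner ℝ (A.toEuclideanLin (‖p‖⁻¹ • p)) (A.toEuclideanLin (‖h‖⁻¹ • h)) ≤ ρ) :
    ‖p‖ ≤ ρ * ‖h‖ + μ * (L₃ * ‖w‖) := by
  have hpos : 0 < ‖p‖ := norm_pos_iff.2 hp0
  have hn := hA.noise _ (inv_norm_smul_mem hC hp hp0)
  rw [inner_transpose_toEuclideanLin, map_smul, real_inner_smul_right, inv_mul_le_iff₀ hpos] at hn
  rw [inner_add_left, real_inner_smul_left, inner_transpose_toEuclideanLin, inner_sub_left] at hle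
  have h1 : inner ℝ h p - μ * inner ℝ (A.toEuclideanLin h) (A.toEuclideanLin p) ≤
      ‖p‖ * (ρ * ‖h‖) := by
    rcases eq_or_ne h 0 with rfl | h0
    · simp
    · have hh : 0 < ‖h‖ := norm_pos_iff.2 h0
      have h2 := hρ h0
      simp only [map_smul, real_inner_smul_left, real_inner_smul_right] at h2
      have h3 : ‖p‖⁻¹ * ‖h‖⁻¹ *
          (inner ℝ h p - μ * inner ℝ (A.toEuclideanLin h) (A.toEuclideanLin p)) ≤ ρ := by
        rw [real_inner_comm p h, real_inner_comm (A.toEuclideanLin p) (A.toEuclideanLin h)]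
        linarith
      rw [← mul_inv, inv_mul_le_iff₀ (mul_pos hpos hh)] at h3
      linarith
  refine le_of_mul_le_mul_left ?_ hpos
  have h4 := mul_le_mul_of_nonneg_left hn hμ
  linarith

/-- Unrolls the one-step inequality. The shift estimate serves only for `h 0`, which may lie outside
the cone; every later pair of errors lies in `D`. -/
theorem norm_le_pow_mul_add (hA : GoodMatrix (C ∩ Metric.closedBall 0 1) e w b L₁ L₂ L₃ A)
    (hC : ∀ v ∈ C, ∀ t : ℝ, 0 ≤ t → t • v ∈ C) {D : Set (EuclideanSpace ℝ (Fin n))}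
    (hD : Convex ℝ D) (hDC : D ⊆ C) (hb : 0 < b) (hrel : StepRelation s t (μ * b ^ 2))
    (hL₁ : L₁ ≤ s * b) (hL₂0 : 0 ≤ L₂) (hL₂ : L₂ ≤ √2 * s * b) (hL₃ : 0 ≤ L₃)
    {h : ℕ → EuclideanSpace ℝ (Fin n)} (he : ‖h 0‖⁻¹ • h 0 = e) (hmem : ∀ τ, h (τ + 1) ∈ D)
    (hstep : ∀ τ, ‖h (τ + 1)‖ ^ 2 ≤ inner ℝ
      (h τ + μ • A.transpose.toEuclideanLin (w - A.toEuclideanLin (h τ))) (h (τ + 1))) (τ : ℕ) :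
    ‖h τ‖ ≤ (1 - (μ * b ^ 2 * t) ^ 2) ^ τ * ‖h 0‖ +
      μ * (L₃ * ‖w‖) / (μ * b ^ 2 * t) ^ 2 := by
  have hμ : 0 < μ := pos_of_mul_pos_left hrel.step_pos (sq_nonneg b)
  have hψ : 0 < (μ * b ^ 2 * t) ^ 2 := pow_pos (mul_pos hrel.step_pos hrel.pos) 2
  have hρ : 0 ≤ 1 - (μ * b ^ 2 * t) ^ 2 := le_trans (add_nonneg (abs_nonneg _)
    (mul_nonneg (mul_nonneg zero_le_two hrel.step_pos.le) hrel.nonneg)) hrel.abs_add_le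
  have hN : 0 ≤ μ * (L₃ * ‖w‖) := by positivity
  have hone : ∀ τ, ‖h (τ + 1)‖ ≤ (1 - (μ * b ^ 2 * t) ^ 2) * ‖h τ‖ + μ * (L₃ * ‖w‖) := by
    intro τ
    rcases eq_or_ne (h (τ + 1)) 0 with h0 | h0
    · rw [h0, norm_zero]
      positivity
    · refine hA.norm_le_of_norm_sq_le hC hμ.le (hDC (hmem τ)) h0 (hstep τ) fun hτ => ?_
      have hu := (inv_norm_smul_mem hC (hDC (hmem τ)) h0).1
      cases τ with
      | zero =>
        rw [he]
        exact hA.inner_sub_le_of_shift hb hrel hL₂0 hL₂ hu (norm_inv_norm_smul h0)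
          (he ▸ norm_inv_norm_smul hτ)
      | succ k =>
        exact hA.inner_sub_le hC hb hrel hL₁ hu (inv_norm_smul_mem hC (hDC (hmem k)) hτ).1
          (norm_inv_norm_smul h0) (norm_inv_norm_smul hτ)
          (smul_add_smul_mem_of_convex hD hDC hC (hmem _) (hmem _)
            (inv_pos.2 (norm_pos_iff.2 h0)) (inv_pos.2 (norm_pos_iff.2 hτ)))
  induction τ with
  | zero =>
    rw [pow_zero, one_mul]
    exact le_add_of_nonneg_right (div_nonneg hN hψ.le)
  | succ k ih =>
    -- The noise level divided by `ψ` is the fixed point of the affine recursion, so it is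
    -- reproduced at every step.
    refine (hone k).trans ((add_le_add_left (mul_le_mul_of_nonneg_left ih hρ) _).trans_eq ?_)
    generalize (μ * b ^ 2 * t) ^ 2 = ψ at hψ
    have h1 := div_mul_cancel₀ (μ * (L₃ * ‖w‖)) hψ.ne'
    generalize μ * (L₃ * ‖w‖) / ψ = M at h1
    rw [← h1]
    ring

end GoodMatrix

theorem inner_sub_proj_nonpos {K : Set (EuclideanSpace ℝ (Fin n))} (hK : Convex ℝ K)
    {v p q : EuclideanSpace ℝ (Fin n)} (hp : IsProj K v p) (hq : q ∈ K) :
    inner ℝ (v - p) (q - p) ≤ 0 := by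
  have : Nonempty K := ⟨⟨q, hq⟩⟩
  refine (norm_eq_iInf_iff_real_inner_le_zero hK hp.1).1 (le_antisymm ?_ ?_) q hq
  · exact le_ciInf fun y => hp.2 y y.2
  · exact ciInf_le ⟨0, by rintro _ ⟨y, rfl⟩; exact norm_nonneg _⟩ (⟨p, hp.1⟩ : K)

theorem norm_iterate_sub_sq_le {K : Set (EuclideanSpace ℝ (Fin n))} (hK : Convex ℝ K)
    (hKc : IsClosed K) {x : EuclideanSpace ℝ (Fin n)} (hx : x ∈ K) (A : Matrix (Fin m) (Fin n) ℝ)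
    (w : EuclideanSpace ℝ (Fin m)) (μ : ℝ) (τ : ℕ) :
    ‖iterate K A (A.toEuclideanLin x + w) μ (τ + 1) - x‖ ^ 2 ≤ inner ℝ
      (iterate K A (A.toEuclideanLin x + w) μ τ - x + μ • A.transpose.toEuclideanLin
        (w - A.toEuclideanLin (iterate K A (A.toEuclideanLin x + w) μ τ - x)))
      (iterate K A (A.toEuclideanLin x + w) μ (τ + 1) - x) := by
  have h := inner_sub_proj_nonpos hK (isProj_proj hKc ⟨x, hx⟩
    (iterate K A (A.toEuclideanLin x + w) μ τ + μ • A.transpose.toEuclideanLin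
      (A.toEuclideanLin x + w - A.toEuclideanLin (iterate K A (A.toEuclideanLin x + w) μ τ)))) hx
  change inner ℝ (_ - iterate K A (A.toEuclideanLin x + w) μ (τ + 1))
    (x - iterate K A (A.toEuclideanLin x + w) μ (τ + 1)) ≤ 0 at h
  set z := iterate K A (A.toEuclideanLin x + w) μ τ
  set z' := iterate K A (A.toEuclideanLin x + w) μ (τ + 1)
  have h1 : w - A.toEuclideanLin (z - x) = A.toEuclideanLin x + w - A.toEuclideanLin z := by
    rw [map_sub]; abel
  rw [h1]
  set g := μ • A.transpose.toEuclideanLin (A.toEuclideanLin x + w - A.toEuclideanLin z)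
  have h2 : z + g - z' = z - x + g - (z' - x) := by abel
  rw [h2, ← neg_sub z' x, inner_neg_right, inner_sub_left, real_inner_self_eq_norm_sq] at h
  linarith

end

/-! ### Numerical constants and assembly. -/

section

variable {m n : ℕ}

/-- These two properties are all that is needed of `φ⁻¹`; injectivity of `φ` plays no role. -/
theorem phaseTransition_nonneg_and_phi_eq {C : Set (EuclideanSpace ℝ (Fin n))} {η : ℝ}
    (h : 0 ≤ gaussianWidth (C ∩ Metric.closedBall 0 1) + η) :
    0 ≤ phaseTransition C η ∧
      phi (phaseTransition C η) = gaussianWidth (C ∩ Metric.closedBall 0 1) + η :=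
  ⟨Function.invFunOn_mem (exists_phi_eq h), Function.invFunOn_eq (exists_phi_eq h)⟩

theorem sqrt_div_lt_half {m₀ : ℝ} (hm : 4 * m₀ < m) (hm0 : 0 < m) : √(m₀ / m) < 1 / 2 := by
  have hm' : (0 : ℝ) < m := by exact_mod_cast hm0
  rw [Real.sqrt_lt' (by norm_num), div_lt_iff₀ hm']
  linarith

theorem stepSize_mul_phi_sq {m₀ : ℝ} (h₀ : 0 ≤ m₀) (hm : 4 * m₀ < m) (hm0 : 0 < m) :
    stepSize m m₀ * phi m ^ 2 =
      (2 - √2 * √(m₀ / m) / (1 - √(m₀ / m)) ^ (3 / 2 : ℝ)) / ((1 - √(m₀ / m)) ^ 2 + 1) := by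
  have hm' : (0 : ℝ) < m := by exact_mod_cast hm0
  have hs := sqrt_div_lt_half hm hm0
  have hb : phi m ≠ 0 := (phi_pos hm').ne'
  set s := √(m₀ / m) with hsdef
  have hr : 0 < √(m : ℝ) := Real.sqrt_pos.2 hm'
  have hrr : √(m : ℝ) ^ 2 = m := Real.sq_sqrt hm'.le
  have h1 : √m₀ = s * √m := by
    rw [hsdef, Real.sqrt_div h₀, div_mul_cancel₀ _ hr.ne']
  have h2 : √(2 * m₀) = √2 * (s * √m) := by rw [Real.sqrt_mul zero_le_two, h1]
  have h3 : √(m * m₀) = s * m := by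
    rw [Real.sqrt_mul hm'.le, h1, ← hrr, Real.sqrt_sq hr.le]; ring
  have h4 : m₀ = s ^ 2 * m := by
    rw [hsdef, Real.sq_sqrt (div_nonneg h₀ hm'.le), div_mul_cancel₀ _ hm'.ne']
  have h5 : √m * ((m : ℝ) ^ (1 / 4 : ℝ) * √m ^ (-(3 / 2) : ℝ)) = 1 := by
    rw [Real.sqrt_eq_rpow, ← Real.rpow_mul hm'.le, ← Real.rpow_add hm', ← Real.rpow_add hm']
    norm_num
  have h6 : (√m - √m₀) ^ (-(3 / 2) : ℝ) =
      √m ^ (-(3 / 2) : ℝ) * ((1 - s) ^ (3 / 2 : ℝ))⁻¹ := by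
    rw [h1, show √(m : ℝ) - s * √m = √m * (1 - s) by ring,
      Real.mul_rpow hr.le (by linarith), Real.rpow_neg (by linarith : 0 ≤ 1 - s)]
  have h7 : m₀ - 2 * √(m * m₀) + 2 * m = m * ((1 - s) ^ 2 + 1) := by
    rw [h3]; linear_combination h4
  have h8 : √(2 * m₀) * (m : ℝ) ^ (1 / 4 : ℝ) * (√m - √m₀) ^ (-(3 / 2) : ℝ) =
      √2 * s / (1 - s) ^ (3 / 2 : ℝ) := by
    rw [h2, h6, div_eq_mul_inv (√2 * s)]
    generalize (m : ℝ) ^ (1 / 4 : ℝ) = y at h5 ⊢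
    generalize √(m : ℝ) ^ (-(3 / 2) : ℝ) = z at h5 ⊢
    linear_combination √2 * s * ((1 - s) ^ (3 / 2 : ℝ))⁻¹ * h5
  rw [stepSize, h8, h7]
  generalize 2 - √2 * s / (1 - s) ^ (3 / 2 : ℝ) = q
  have hD : 0 < (1 - s) ^ 2 + 1 := by positivity
  field_simp

theorem stepRelation_stepSize {m₀ : ℝ} (h₀ : 0 ≤ m₀) (hm : 4 * m₀ < m) (hm0 : 0 < m) :
    StepRelation (√(m₀ / m)) ((1 - √(m₀ / m)) ^ (3 / 2 : ℝ)) (stepSize m m₀ * phi m ^ 2) := by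
  have hs := sqrt_div_lt_half hm hm0
  rw [stepSize_mul_phi_sq h₀ hm hm0]
  set s := √(m₀ / m) with hsdef
  have hpos : 0 < (1 - s) ^ (3 / 2 : ℝ) := Real.rpow_pos_of_pos (by linarith) _
  refine ⟨Real.sqrt_nonneg _, hs, hpos, ?_, ?_⟩
  · rw [← Real.rpow_natCast, ← Real.rpow_mul (by linarith), ← Real.rpow_natCast]
    norm_num
  · generalize (1 - s) ^ (3 / 2 : ℝ) = t at hpos
    have hD : 0 < (1 - s) ^ 2 + 1 := by positivity
    have h2 : √2 ^ 2 = 2 := Real.sq_sqrt zero_le_two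
    field_simp
    linear_combination (-t) * h2

theorem psi_eq {m₀ : ℝ} (h₀ : 0 ≤ m₀) (hm : 4 * m₀ < m) (hm0 : 0 < m) :
    (stepSize m m₀ * phi m ^ 2 * (1 - √(m₀ / m)) ^ (3 / 2 : ℝ)) ^ 2 = psi (m₀ / m) := by
  have h := (stepRelation_stepSize h₀ hm hm0).eq
  have h2 : √2 ^ 2 = 2 := Real.sq_sqrt zero_le_two
  have h3 : m₀ / m = √(m₀ / m) ^ 2 := (Real.sq_sqrt (by positivity)).symm
  have hD : 0 < (1 - √(m₀ / m)) ^ 2 + 1 := by positivity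
  have h4 : m₀ / m - 2 * √(m₀ / m) + 2 = (1 - √(m₀ / m)) ^ 2 + 1 := by
    linear_combination h3
  rw [psi, h4]
  generalize √(m₀ / m) = s at *
  have h5 : stepSize m m₀ * phi m ^ 2 * (1 - s) ^ (3 / 2 : ℝ) =
      √2 * (√2 * (1 - s) ^ (3 / 2 : ℝ) - s) / ((1 - s) ^ 2 + 1) := by
    rw [eq_div_iff hD.ne', ← h]; ring
  rw [h5, div_pow, mul_pow, h2, mul_div_assoc]

section Numerics

variable {ω η m₀ : ℝ}

theorem add_le_sqrt_of_phi_eq (h₀ : 0 ≤ m₀) (hφ : phi m₀ = ω + η) : ω + η ≤ √m₀ :=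
  hφ ▸ Real.le_sqrt_of_sq_le (phi_sq_le h₀)

theorem thirtyFive_le (hω : 0 ≤ ω) (hη : 2.95 ≤ η) (h₀ : 0 ≤ m₀) (hφ : phi m₀ = ω + η)
    (hm : 4 * m₀ < m) : 35 ≤ m := by
  have h1 := add_le_sqrt_of_phi_eq h₀ hφ
  have h2 := Real.sq_sqrt h₀
  have h3 : (34 : ℝ) < m := by nlinarith
  exact_mod_cast h3

/-- Replacing `φ(m)` by `√m` costs at most `√m₀ / m < 1 / (2 √m)`, which is below `0.085` once `m ≥
35`. -/
theorem sub_le_sqrt_div_mul_phi (hω : 0 ≤ ω) (hη : 2.95 ≤ η) (h₀ : 0 ≤ m₀)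
    (hφ : phi m₀ = ω + η) (hm : 4 * m₀ < m) : ω + η - 0.085 ≤ √(m₀ / m) * phi m := by
  have hm35 : (35 : ℝ) ≤ m := by exact_mod_cast thirtyFive_le hω hη h₀ hφ hm
  have hm' : (0 : ℝ) < m := by linarith
  have h1 := add_le_sqrt_of_phi_eq h₀ hφ
  have h2 := Real.sq_sqrt h₀
  have hr : 0 < √(m : ℝ) := Real.sqrt_pos.2 hm'
  have h3 : (1 - 1 / (m : ℝ)) * √m ≤ phi m := by
    refine le_of_sq_le_sq ?_ (phi_pos hm').le
    refine le_trans ?_ (sub_one_le_phi_sq (by linarith))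
    rw [mul_pow, Real.sq_sqrt hm'.le]
    have h5 : 1 / (m : ℝ) * m = 1 := one_div_mul_cancel hm'.ne'
    have h6 : 1 / (m : ℝ) ≤ 1 := (div_le_one hm').2 (by linarith)
    nlinarith
  have h4 : √(m₀ / m) * √m = √m₀ := by
    rw [Real.sqrt_div h₀, div_mul_cancel₀ _ hr.ne']
  have h5 : √m₀ / m ≤ 0.085 := by
    rw [div_le_iff₀ hm']
    nlinarith
  calc ω + η - 0.085 ≤ √m₀ - √m₀ / m := by linarith
    _ = √(m₀ / m) * ((1 - 1 / (m : ℝ)) * √m) := by rw [← h4]; ring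
    _ ≤ _ := mul_le_mul_of_nonneg_left h3 (Real.sqrt_nonneg _)

/-- From `μ φ(m)² ≤ 8/5` and `φ(m)² ≥ m - 1` with `m ≥ 35` one gets `μ ≤ 1.65 / m`, while `(4/5)
√(2π)` exceeds `1.65`. -/
theorem stepSize_mul_le (hω : 0 ≤ ω) (hη : 2.95 ≤ η) (h₀ : 0 ≤ m₀)
    (hφ : phi m₀ = ω + η) (hm : 4 * m₀ < m) :
    stepSize m m₀ * (ω + η) ≤ 4 / 5 * √(2 * Real.pi) * (√m₀ / m) := by
  have hm35 : (35 : ℝ) ≤ m := by exact_mod_cast thirtyFive_le hω hη h₀ hφ hm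
  have hm' : (0 : ℝ) < m := by linarith
  have hrel := stepRelation_stepSize h₀ hm (by exact_mod_cast hm')
  have hpos : 0 < stepSize m m₀ := pos_of_mul_pos_left hrel.step_pos (sq_nonneg _)
  have h1 : stepSize m m₀ ≤ 1.65 / m := by
    rw [le_div_iff₀ hm']
    have h2 := hrel.step_le
    have h3 := mul_le_mul_of_nonneg_left (sub_one_le_phi_sq (by linarith : (1 : ℝ) < m)) hpos.le
    have h4 := mul_le_mul_of_nonneg_left hm35 hpos.le
    linarith
  have h2 : (2.4 : ℝ) ≤ √(2 * Real.pi) :=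
    Real.le_sqrt_of_sq_le (by linarith [Real.pi_gt_three])
  calc stepSize m m₀ * (ω + η) ≤ 1.65 / m * √m₀ :=
        mul_le_mul h1 (add_le_sqrt_of_phi_eq h₀ hφ) (by linarith) (by positivity)
    _ = 1.65 * (√m₀ / m) := by ring
    _ ≤ _ := mul_le_mul_of_nonneg_right (by linarith) (by positivity)

theorem one_le_three_mul_exp (hη : 0 ≤ η) (hη' : η < 2.95) : 1 ≤ 3 * Real.exp (-(η ^ 2 / 8)) := by
  have h1 : Real.exp (1.088 : ℝ) ≤ 3 := by
    have h2 : Real.exp (0.088 : ℝ) ≤ 1 / (1 - 0.088) :=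
      Real.exp_bound_div_one_sub_of_interval (by norm_num) (by norm_num)
    rw [show (1.088 : ℝ) = 1 + 0.088 by norm_num, Real.exp_add]
    have h3 := mul_le_mul Real.exp_one_lt_d9.le h2 (Real.exp_pos _).le (by norm_num)
    exact h3.trans (by norm_num)
  have h2 : Real.exp (-1.088) ≤ Real.exp (-(η ^ 2 / 8)) := Real.exp_le_exp.2 (by nlinarith)
  have h3 : Real.exp (1.088 : ℝ) * Real.exp (-1.088) = 1 := by rw [← Real.exp_add]; norm_num
  nlinarith [Real.exp_pos (-1.088 : ℝ)]

theorem two_mul_exp_le (hη : 2.95 ≤ η) :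
    2 * Real.exp (-(η - 0.6) ^ 2 / 2) ≤ Real.exp (-(η ^ 2 / 8)) := by
  have h1 : (2 : ℝ) ≤ Real.exp ((η - 0.6) ^ 2 / 2 - η ^ 2 / 8) := by
    refine le_trans ?_ (Real.add_one_le_exp _)
    nlinarith
  calc 2 * Real.exp (-(η - 0.6) ^ 2 / 2)
      ≤ Real.exp ((η - 0.6) ^ 2 / 2 - η ^ 2 / 8) * Real.exp (-(η - 0.6) ^ 2 / 2) :=
        mul_le_mul_of_nonneg_right h1 (Real.exp_pos _).le
    _ = _ := by rw [← Real.exp_add]; congr 1; ring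

end Numerics

theorem map_entries_eq_stdPi {Ω : Type*} [MeasurableSpace Ω] {P : Measure Ω}
    [IsProbabilityMeasure P] {A : Ω → Matrix (Fin m) (Fin n) ℝ}
    (hlaw : ∀ i j, HasLaw (fun ω => A ω i j) (gaussianReal 0 1) P)
    (hindep : iIndepFun (fun (p : Fin m × Fin n) ω => A ω p.1 p.2) P) :
    P.map (fun ω (p : Fin m × Fin n) => A ω p.1 p.2) = stdPi (Fin m × Fin n) :=
  ((iIndepFun_iff_map_fun_eq_pi_map fun p : Fin m × Fin n => (hlaw p.1 p.2).aemeasurable).1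
    hindep).trans (congrArg Measure.pi (funext fun p => (hlaw p.1 p.2).map_eq))

/-- An event that holds for every matrix in `{x | Q x}` has probability at least one minus the
Gaussian measure of the complement. -/
theorem one_sub_le_measureReal_of_map {Ω ι : Type*} [Fintype ι] [MeasurableSpace Ω]
    {P : Measure Ω} [IsProbabilityMeasure P] {X : Ω → ι → ℝ} (hX : AEMeasurable X P)
    (hmap : P.map X = stdPi ι) {Q : (ι → ℝ) → Prop} {E : Set Ω} (hE : ∀ ω, Q (X ω) → ω ∈ E) :
    1 - (stdPi ι).real {x | ¬ Q x} ≤ P.real E := by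
  have h1 : P.real (X ⁻¹' {x | ¬ Q x}) ≤ (stdPi ι).real {x | ¬ Q x} := by
    rw [← hmap]
    -- Only an inequality between outer measures is used, so no measurability of the events is
    -- required.
    refine ENNReal.toReal_mono ?_ (Measure.le_map_apply hX _)
    rw [hmap]
    exact measure_ne_top _ _
  have h2 : (1 : ℝ) ≤ P.real (E ∪ X ⁻¹' {x | ¬ Q x}) := by
    have : E ∪ X ⁻¹' {x | ¬ Q x} = Set.univ :=
      Set.eq_univ_of_forall fun ω => (em (Q (X ω))).imp (hE ω) id
    rw [this, probReal_univ]
  linarith [measureReal_union_le (μ := P) E (X ⁻¹' {x | ¬ Q x})]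

theorem norm_iterate_sub_le {x : EuclideanSpace ℝ (Fin n)} {w : EuclideanSpace ℝ (Fin m)}
    {f : EuclideanSpace ℝ (Fin n) → ℝ} (hproper : ∀ r : ℝ, IsClosed {z | f z ≤ r})
    (hconv : ConvexOn ℝ Set.univ f) {C : Set (EuclideanSpace ℝ (Fin n))}
    (hC : IsDescentCone f x C) {ω η m₀ : ℝ} (hω : 0 ≤ ω) (hη : 2.95 ≤ η) (h₀ : 0 ≤ m₀)
    (hφ : phi m₀ = ω + η) (hm : 4 * m₀ < m) {A : Matrix (Fin m) (Fin n) ℝ}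
    (hA : GoodMatrix (C ∩ Metric.closedBall 0 1) (‖-x‖⁻¹ • -x) w (phi m)
      (ω + 1 / 2 + (η - 0.6)) (ω + 1 + 2 * (η / 2)) (ω + η) A) (τ : ℕ) :
    ‖iterate {z | f z ≤ f x} A (A.toEuclideanLin x + w) (stepSize m m₀) τ - x‖ ≤
      (1 - psi (m₀ / m)) ^ τ * ‖x‖ +
        4 / 5 * (√(2 * Real.pi) / psi (m₀ / m)) * (√m₀ / m) * ‖w‖ := by
  have hm0 : 0 < m := by linarith [thirtyFive_le hω hη h₀ hφ hm]
  have hb : 0 < phi m := phi_pos (by exact_mod_cast hm0)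
  have hsb := sub_le_sqrt_div_mul_phi hω hη h₀ hφ hm
  have hrel := stepRelation_stepSize h₀ hm hm0
  have hK : Convex ℝ {z | f z ≤ f x} := by simpa using hconv.convex_le (f x)
  have hD : Convex ℝ (descentSet f x) := hK.translate_preimage_right x
  have hx : x ∈ {z | f z ≤ f x} := le_refl (f x)
  have hc : (1.41 : ℝ) ≤ √2 := Real.le_sqrt_of_sq_le (by norm_num)
  have h := hA.norm_le_pow_mul_add hC.smul_mem hD hC.descentSet_subset hb hrel
    (by linarith) (by linarith)
    -- `L₂ = ω + η + 1` against `1.41 (ω + η - 0.085)`: the gain of `0.41 η` covers the extra `1`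
    -- since `η ≥ 2.95`.
    (by
      have h1 := mul_le_mul hc hsb (by linarith) (Real.sqrt_nonneg 2)
      rw [← mul_assoc] at h1
      linarith) (by linarith)
    (h := fun τ => iterate {z | f z ≤ f x} A (A.toEuclideanLin x + w) (stepSize m m₀) τ - x)
    (by simp [iterate])
    (fun τ => by
      have h1 : iterate {z | f z ≤ f x} A (A.toEuclideanLin x + w) (stepSize m m₀) (τ + 1) ∈
        {z | f z ≤ f x} := (isProj_proj (hproper _) ⟨x, hx⟩ _).1
      change f (x + (_ - x)) ≤ f x
      rwa [add_sub_cancel])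
    (norm_iterate_sub_sq_le hK (hproper _) hx A w _) τ
  rw [psi_eq h₀ hm hm0] at h
  have hψ : 0 < psi (m₀ / m) := by
    rw [← psi_eq h₀ hm hm0]
    exact pow_pos (mul_pos hrel.step_pos hrel.pos) 2
  refine h.trans (add_le_add (by simp [iterate]) ?_)
  have h1 := stepSize_mul_le hω hη h₀ hφ hm
  calc _ = stepSize m m₀ * (ω + η) * (‖w‖ / psi (m₀ / m)) := by ring
    _ ≤ 4 / 5 * √(2 * Real.pi) * (√m₀ / m) * (‖w‖ / psi (m₀ / m)) :=
      mul_le_mul_of_nonneg_right h1 (by positivity)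
    _ = _ := by ring

end

end PGD

end

theorem theorem4 {m n : ℕ} (x : EuclideanSpace ℝ (Fin n)) (w : EuclideanSpace ℝ (Fin m))
    (f : EuclideanSpace ℝ (Fin n) → ℝ) (hproper : ∀ r : ℝ, IsClosed {z | f z ≤ r})
    (hconv : ConvexOn ℝ Set.univ f)
    (C : Set (EuclideanSpace ℝ (Fin n))) (hC : PGD.IsDescentCone f x C)
    (η : ℝ) (hη : 0 ≤ η) (m₀ : ℝ) (hm₀ : m₀ = PGD.phaseTransition C η) (hm : 4 * m₀ < m)
    {Ω : Type*} [MeasurableSpace Ω] (P : Measure Ω) [IsProbabilityMeasure P]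
    (A : Ω → Matrix (Fin m) (Fin n) ℝ)
    (hA_law : ∀ i j, HasLaw (fun ω => A ω i j) (gaussianReal 0 1) P)
    (hA_indep : iIndepFun (fun (p : Fin m × Fin n) ω => A ω p.1 p.2) P) :
    1 - 3 * Real.exp (-(η ^ 2 / 8)) - Real.exp (-(η ^ 2 / 2)) ≤
      P.real {ω | ∀ τ : ℕ,
        ‖PGD.iterate {z | f z ≤ f x} (A ω) ((A ω).toEuclideanLin x + w)
            (PGD.stepSize m m₀) τ - x‖ ≤
          (1 - PGD.psi (m₀ / m)) ^ τ * ‖x‖ +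
            4 / 5 * (√(2 * Real.pi) / PGD.psi (m₀ / m)) * (√m₀ / m) * ‖w‖} := by
  -- Below `2.95` one has `η² / 8 < log 3`, so the asserted probability is negative.
  rcases lt_or_ge η 2.95 with hη' | hη'
  · linarith [PGD.one_le_three_mul_exp hη hη', Real.exp_pos (-(η ^ 2 / 2)),
      measureReal_nonneg (μ := P) (s := {ω | ∀ τ : ℕ,
        ‖PGD.iterate {z | f z ≤ f x} (A ω) ((A ω).toEuclideanLin x + w)
            (PGD.stepSize m m₀) τ - x‖ ≤
          (1 - PGD.psi (m₀ / m)) ^ τ * ‖x‖ +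
            4 / 5 * (√(2 * Real.pi) / PGD.psi (m₀ / m)) * (√m₀ / m) * ‖w‖})]
  have hS : ∀ z ∈ C ∩ Metric.closedBall (0 : EuclideanSpace ℝ (Fin n)) 1, ‖z‖ ≤ 1 :=
    fun z hz => by simpa using hz.2
  have h0 : (0 : EuclideanSpace ℝ (Fin n)) ∈ C ∩ Metric.closedBall 0 1 :=
    ⟨hC.descentSet_subset (by simp [PGD.descentSet]), by simp⟩
  have hω := PGD.gaussianWidth_nonneg hS h0
  obtain ⟨h₀, hφ⟩ := PGD.phaseTransition_nonneg_and_phi_eq (C := C) (add_nonneg hω hη)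
  rw [← hm₀] at h₀ hφ
  have he : ‖‖-x‖⁻¹ • -x‖ ≤ 1 := by
    rcases eq_or_ne x 0 with rfl | hx
    · simp
    · exact (PGD.norm_inv_norm_smul (neg_ne_zero.2 hx)).le
  have hbad := PGD.measure_not_goodMatrix_le
    ((by norm_num : 2 ≤ 35).trans (PGD.thirtyFive_le hω hη' h₀ hφ hm)) hS h0 he w
    -- With `t₁ = η - 0.6` the level `L₁ = ω + η - 0.1` fits under `√(m₀ / m) φ(m)`, and its two
    -- tails together cost one `exp (-η² / 8)`. The two shift events at `t₂ = η / 2` cost one each,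
    -- and the noise event at level `η` gives `exp (-η² / 2)`.
    (t₁ := η - 0.6) (t₂ := η / 2) (by linarith) (by linarith) hη
  have hX : AEMeasurable (fun ω (p : Fin m × Fin n) => A ω p.1 p.2) P :=
    aemeasurable_pi_lambda _ fun p => (hA_law p.1 p.2).aemeasurable
  refine le_trans ?_ (PGD.one_sub_le_measureReal_of_map hX
    (PGD.map_entries_eq_stdPi hA_law hA_indep)
    (Q := fun q => PGD.GoodMatrix _ _ w _ _ _ _ (PGD.toMatrix q)) fun ω hgood =>
      PGD.norm_iterate_sub_le hproper hconv hC hω hη' h₀ hφ hm hgood)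
  have h1 := PGD.two_mul_exp_le hη'
  have h2 : -(η / 2) ^ 2 / 2 = -(η ^ 2 / 8) := by ring
  rw [h2, show -η ^ 2 / 2 = -(η ^ 2 / 2) by ring] at hbad
  linarith
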